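/- Let $\mathbb X=(X_t)_{t\ge0}$ be a Feller process with càdlàg paths in a Polish space $E$, with laws $\mathbb P_x$, semigroup $S_tg(x)=\mathbb E_xg(X_t)$ (mapping $C_b(E)$ to itself) and generator $Ag(y)=\lim_{\epsilon\downarrow0}\frac{S_\epsilon g(y)-g(y)}{\epsilon}$; a Borel function $g:E\to\mathbb R$ is in the domain of $A$ if for every $y\in E$, $g(X_\epsilon)$ is $\mathbb P_y$-integrable for small $\epsilon$ and this limit exists. For a probability measure $\nu$ on $E$ put $\mathbb E_\nu=\int\mathbb E_x\,\nu(dx)$. Let $f_t:E\to\mathbb R$, $t\ge0$, be functions with $(t,x)\mapsto f_t(x)$ Borel, and $$F(\mathbb X)=\int_0^\infty f_t(X_t)\,dt,\qquad \Phi_t(x,y)=\int_0^\infty \bigl(S_uf_{t+u}(x)-S_uf_{t+u}(y)\bigr)\,du .$$ The family $(f_t)$ is called $k$-regular if (a) for all $x\in E$, $t\ge0$, the map $s\mapsto f_{t+s}(X_s)$ is $\mathbb P_x$-a.s. Lebesgue integrable and $\mathbb E_x\int_0^\infty|f_{t+s}(X_s)|\,ds<\infty$; (b) for all $x,t$ and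 all small $\epsilon>0$, $\mathbb E_x\sup_{0\le s\le\epsilon}|f_{t+s}(X_s)|^k$ is well defined and finite; (c) there are a measurable $r:E\to[0,\infty)$ and $\epsilon_0>0$ such that for $0<\epsilon<\epsilon_0$ and $x\in E$, $\sup_{t\ge0}\mathbb E_x\int_0^\infty|f_{t+\epsilon+s}(X_s)-f_{t+s}(X_s)|\,ds\le\epsilon\,r(x)$ and $\mathbb E_x r(X_\epsilon)^k<\infty$. Let $\rho:E\times E\to[0,\infty]$ be a lower semi-continuous semi-metric (symmetric, zero on the diagonal, satisfying the triangle inequality), and let $$\|g\|_{Lip}=\inf\{r\ge0: g(x)-g(y)\le r\rho(x,y)\ \forall x,y\in E\},$$ $$\rho_t(x,y)=\inf_\pi\int\rho\,d\pi,\qquad h(x,y)=\int_0^\infty\rho_t(x,y)\,dt,$$ where $\pi$ ranges over all couplings of the laws $\delta_xS_t$ and $\delta_yS_t$ of $X_t$ started in $x$ and in $y$. Here $h$ is the generalized coupling time. Assume that $\sup_{t\ge0}\|f_t\|_{Lip}<\infty$; that for all integers $k\ge1$ the family $(f_t)$ is $k$-regular and $\Phi_t(\cdot,x)^k$ is in the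 domain of $A$ for all $t\ge0$, $x\in E$; and that $h$ is finite and $A(h^k(\cdot,x))(x)$ exists for all $x\in E$ and $k\ge2$ (with $h^k(X_\epsilon,x)$ being $\mathbb P_x$-integrable for small $\epsilon$). Then for all probability measures $\mu,\nu$ on $E$, $$\mathbb E_\mu\left[e^{F(\mathbb X)-\mathbb E_\nu F(\mathbb X)}\right]\le c_0\exp\left(\sum_{k=2}^\infty\frac{c_k}{k!}\sup_{x\in E}\bigl(A(h^k(\cdot,x))\bigr)(x)\right)\quad\text{in }[0,\infty],$$ $$c_0=\int e^{\sup_{t\ge0}\|f_t\|_{Lip}\,\nu(h(x,\cdot))}\,\mu(dx),\qquad c_k=\int_0^\infty\sup_{s\ge t}\|f_s\|_{Lip}^k\,dt,$$ with the convention $0\cdot\infty=0$; if the right-hand side is finite, then $F(\mathbb X)$ is integrable under $\mathbb P_\nu$, so that $\mathbb E_\nu F(\mathbb X)$ is well defined. In particular, if $f_t=f$ for $t\le T$ and $f_t=0$ for $t>T$, then $c_0\le\int e^{\|f\|_{Lip}\,\nu(h(x,\cdot))}\,\mu(dx)$ and $c_k\le T\|f\|_{Lip}^k$ for $k\ge2$,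 and the bound holds with $c_0$, $c_k$ replaced by these upper estimates. -/

import Mathlib

open MeasureTheory ProbabilityTheory Filter Topology Set
open scoped NNReal ENNReal BoundedContinuousFunction

noncomputable section

/-- Right-continuous with left limits (at `0` the left neighbourhood is empty). -/
def IsCadlag {E : Type*} [TopologicalSpace E] (w : ℝ≥0 → E) : Prop :=
  ∀ t : ℝ≥0, ContinuousWithinAt w (Ici t) t ∧ ∃ l : E, Tendsto w (𝓝[<] t) (𝓝 l)

/-- The path space `D_{[0,∞[}(E)`, with the σ-algebra generated by the coordinate maps
(the restriction of the product σ-algebra). -/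
abbrev CadlagPath (E : Type*) [TopologicalSpace E] : Type _ := {w : ℝ≥0 → E // IsCadlag w}

/-- The canonical filtration `𝓕_t = σ(X_s ; 0 ≤ s ≤ t)` on path space. -/
abbrev canonicalSigma (E : Type*) [TopologicalSpace E] [mE : MeasurableSpace E] (t : ℝ≥0) :
    MeasurableSpace (CadlagPath E) :=
  ⨆ s : Iic t, MeasurableSpace.comap (fun w : CadlagPath E => w.1 s.1) mE

/-- A (conservative) Feller process with càdlàg paths: the family `(ℙ_x)` of its laws on path
space, which satisfies the Markov property, and whose semigroup preserves `C_b(E)`. -/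
structure FellerProcess (E : Type*) [TopologicalSpace E] [MeasurableSpace E]
    [OpensMeasurableSpace E] where
  /-- `ℙ_x`, measurable in the starting point `x` -/
  law : Kernel E (CadlagPath E)
  isMarkovKernel : IsMarkovKernel law
  start : ∀ x : E, ∀ᵐ w ∂(law x), w.1 0 = x
  markov : ∀ (x : E) (s t : ℝ≥0) (A : Set (CadlagPath E)) (B : Set E),
    MeasurableSet[canonicalSigma E s] A → MeasurableSet B →
      law x (A ∩ {w | w.1 (s + t) ∈ B}) = ∫⁻ w in A, law (w.1 s) {w' | w'.1 t ∈ B} ∂(law x)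
  feller : ∀ (t : ℝ≥0) (g : E →ᵇ ℝ), Continuous fun x => ∫ w, g (w.1 t) ∂(law x)

attribute [instance] FellerProcess.isMarkovKernel

/-- Lebesgue measure on the time axis `[0,∞)`. -/
def timeMeasure : Measure ℝ≥0 := (volume : Measure ℝ).comap NNReal.toReal

namespace FellerProcess

variable {E : Type*} [TopologicalSpace E] [MeasurableSpace E] [OpensMeasurableSpace E]

/-- `ℙ_ν = ∫ ℙ_x ν(dx)`, the law of the process started from the distribution `ν`. -/
def lawFrom (X : FellerProcess E) (ν : Measure E) : Measure (CadlagPath E) := ν.bind X.law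

/-- The transition probability `δ_x S_t`, i.e. the distribution of `X_t` started in `x`. -/
def transition (X : FellerProcess E) (t : ℝ≥0) (x : E) : Measure E :=
  (X.law x).map fun w => w.1 t

/-- The semigroup `S_t g (x) = 𝔼_x g(X_t)`. -/
def semigroup (X : FellerProcess E) (t : ℝ≥0) (g : E → ℝ) (x : E) : ℝ :=
  ∫ w, g (w.1 t) ∂(X.law x)

/-- `A g (y)` exists and equals `v`: `g(X_ε)` is `ℙ_y`-integrable for small `ε > 0`, and
`(S_ε g (y) - g (y)) / ε → v` as `ε ↓ 0`. -/
def HasGeneratorAt (X : FellerProcess E) (g : E → ℝ) (y : E) (v : ℝ) : Prop :=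
  (∀ᶠ ε in 𝓝[>] (0 : ℝ≥0), Integrable (fun w : CadlagPath E => g (w.1 ε)) (X.law y)) ∧
    Tendsto (fun ε : ℝ≥0 => (X.semigroup ε g y - g y) / (ε : ℝ)) (𝓝[>] 0) (𝓝 v)

/-- The domain of the generator `A` of the semigroup on Borel functions (with pointwise limits). -/
def InDomain (X : FellerProcess E) (g : E → ℝ) : Prop :=
  Measurable g ∧ ∀ y : E, ∃ v : ℝ, X.HasGeneratorAt g y v

/-- The value `A g (y)` of the generator (meaningful if `HasGeneratorAt` holds for some `v`). -/
def generator (X : FellerProcess E) (g : E → ℝ) (y : E) : ℝ :=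
  limUnder (𝓝[>] (0 : ℝ≥0)) fun ε : ℝ≥0 => (X.semigroup ε g y - g y) / (ε : ℝ)

/-- `k`-regularity of the family `(f_t)_{t ≥ 0}`. -/
structure IsRegular (X : FellerProcess E) (f : ℝ≥0 → E → ℝ) (k : ℕ) : Prop where
  measurable : Measurable fun p : ℝ≥0 × E => f p.1 p.2
  integrable : ∀ (x : E) (t : ℝ≥0),
    (∀ᵐ w ∂(X.law x), Integrable (fun s : ℝ≥0 => f (t + s) (w.1 s)) timeMeasure) ∧
      ∫⁻ w, (∫⁻ s, ‖f (t + s) (w.1 s)‖ₑ ∂timeMeasure) ∂(X.law x) < ∞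
  sup_moment : ∀ (x : E) (t : ℝ≥0), ∀ᶠ ε in 𝓝[>] (0 : ℝ≥0),
    AEMeasurable (fun w : CadlagPath E => ⨆ s ≤ ε, ‖f (t + s) (w.1 s)‖ₑ ^ k) (X.law x) ∧
      ∫⁻ w, (⨆ s ≤ ε, ‖f (t + s) (w.1 s)‖ₑ ^ k) ∂(X.law x) < ∞
  time_increment : ∃ (r : E → ℝ≥0) (ε₀ : ℝ≥0), Measurable r ∧ 0 < ε₀ ∧
    ∀ ε : ℝ≥0, 0 < ε → ε < ε₀ → ∀ x : E,
      (⨆ t : ℝ≥0, ∫⁻ w, (∫⁻ s, ‖f (t + ε + s) (w.1 s) - f (t + s) (w.1 s)‖ₑ ∂timeMeasure) ∂(X.law x))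
          ≤ (ε : ℝ≥0∞) * r x ∧
        ∫⁻ w, (r (w.1 ε) : ℝ≥0∞) ^ k ∂(X.law x) < ∞

/-- The coupled function difference
`Φ_t(x,y) = ∫_0^∞ (S_u f_{t+u}(x) - S_u f_{t+u}(y)) du`. -/
def coupledDiff (X : FellerProcess E) (f : ℝ≥0 → E → ℝ) (t : ℝ≥0) (x y : E) : ℝ :=
  ∫ u, (X.semigroup u (f (t + u)) x - X.semigroup u (f (t + u)) y) ∂timeMeasure

/-- The optimal coupling distance `ρ_t(x,y)`: the infimum of `∫ ρ dπ` over all couplings `π` of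
`δ_x S_t` and `δ_y S_t`. -/
def couplingDist (X : FellerProcess E) (ρ : E → E → ℝ≥0∞) (t : ℝ≥0) (x y : E) : ℝ≥0∞ :=
  ⨅ (π : Measure (E × E)) (_ : π.map Prod.fst = X.transition t x)
    (_ : π.map Prod.snd = X.transition t y), ∫⁻ p, ρ p.1 p.2 ∂π

/-- The generalized coupling time `h(x,y) = ∫_0^∞ ρ_t(x,y) dt`. -/
def couplingTime (X : FellerProcess E) (ρ : E → E → ℝ≥0∞) (x y : E) : ℝ≥0∞ :=
  ∫⁻ t, X.couplingDist ρ t x y ∂timeMeasure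

/-- The function `y ↦ h(y,x)^k`, real-valued when `h` is finite. -/
def couplingTimePow (X : FellerProcess E) (ρ : E → E → ℝ≥0∞) (k : ℕ) (x y : E) : ℝ :=
  (X.couplingTime ρ y x).toReal ^ k

/-- `sup_x A(h^k(·,x))(x)`, as an element of `[0,∞]` (the values are nonnegative for `k ≥ 1`, since
`h ≥ 0` and `h(x,x) = 0`). -/
def supGenerator (X : FellerProcess E) (ρ : E → E → ℝ≥0∞) (k : ℕ) : ℝ≥0∞ :=
  ⨆ x : E, ENNReal.ofReal (X.generator (X.couplingTimePow ρ k x) x)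

end FellerProcess

/-- A semi-metric: a `[0,∞]`-valued pseudo-distance. -/
structure IsSemimetric {E : Type*} (ρ : E → E → ℝ≥0∞) : Prop where
  self : ∀ x, ρ x x = 0
  symm : ∀ x y, ρ x y = ρ y x
  triangle : ∀ x y z, ρ x z ≤ ρ x y + ρ y z

/-- The Lipschitz seminorm
`‖g‖_Lip = inf {r ≥ 0 : g(x) - g(y) ≤ r ρ(x,y) for all x, y}` (`∞` if there is no such `r`). -/
def lipNorm {E : Type*} (ρ : E → E → ℝ≥0∞) (g : E → ℝ) : ℝ≥0∞ :=
  ⨅ (r : ℝ≥0) (_ : ∀ x y : E, ENNReal.ofReal (g x - g y) ≤ (r : ℝ≥0∞) * ρ x y), (r : ℝ≥0∞)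

/-- The additive functional `F(X) = ∫_0^∞ f_t(X_t) dt`. -/
def additiveFunctional {E : Type*} [TopologicalSpace E] (f : ℝ≥0 → E → ℝ) (w : CadlagPath E) : ℝ :=
  ∫ t, f t (w.1 t) ∂timeMeasure

section Constants

variable {E : Type*} [TopologicalSpace E] [MeasurableSpace E] [OpensMeasurableSpace E]

/-- `∫ exp(L ν(h(x,·))) μ(dx)`. -/
def initialFactor (X : FellerProcess E) (ρ : E → E → ℝ≥0∞) (μ ν : Measure E) (L : ℝ≥0∞) : ℝ≥0∞ :=
  ∫⁻ x, EReal.exp ((L * ∫⁻ y, X.couplingTime ρ x y ∂ν : ℝ≥0∞) : EReal) ∂μ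

/-- `c_0 = ∫ exp(sup_{t ≥ 0} ‖f_t‖_Lip ν(h(x,·))) μ(dx)`. -/
def constZero (X : FellerProcess E) (ρ : E → E → ℝ≥0∞) (f : ℝ≥0 → E → ℝ) (μ ν : Measure E) :
    ℝ≥0∞ :=
  initialFactor X ρ μ ν (⨆ t : ℝ≥0, lipNorm ρ (f t))

/-- `c_k = ∫_0^∞ sup_{s ≥ t} ‖f_s‖_Lip^k dt`. -/
def constPow {E : Type*} (ρ : E → E → ℝ≥0∞) (f : ℝ≥0 → E → ℝ) (k : ℕ) : ℝ≥0∞ :=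
  ∫⁻ t, (⨆ s ≥ t, lipNorm ρ (f s) ^ k) ∂timeMeasure

/-- `exp(∑_{k ≥ 2} (c_k / k!) sup_x A(h^k(·,x))(x))` for a given sequence `c`. -/
def expFactor (X : FellerProcess E) (ρ : E → E → ℝ≥0∞) (c : ℕ → ℝ≥0∞) : ℝ≥0∞ :=
  EReal.exp ((∑' j : ℕ, c (j + 2) / ((j + 2).factorial : ℝ≥0∞) * X.supGenerator ρ (j + 2) :
    ℝ≥0∞) : EReal)

/-- `𝔼_μ[exp(F(X) - 𝔼_ν F(X))]`, as an element of `[0,∞]`. -/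
def expMoment (X : FellerProcess E) (f : ℝ≥0 → E → ℝ) (μ ν : Measure E) : ℝ≥0∞ :=
  ∫⁻ w, ENNReal.ofReal (Real.exp (additiveFunctional f w -
    ∫ w', additiveFunctional f w' ∂(X.lawFrom ν))) ∂(X.lawFrom μ)

end Constants

end

noncomputable section

/-! ### Operations on càdlàg paths -/

namespace CadlagPath

section Topological

variable {E : Type*} [TopologicalSpace E]

/-! Let V_t(y) = 𝔼_y ∫_0^∞ f_{t+s}(X_s) ds (`tailMean`). Under ℙ_x the process M_u = ∫_0^u f_s(X_s)
ds + V_u(X_u) (`closedMart`) is the martingale closed by F, so F - V_0(x) is the total of its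
increments, and the exponential moment can be built up from short conditional steps. Over a span ε
from time t and state y the increment is V_{t+ε}(X_ε) - V_{t+ε}(y) plus terms whose k-th moments are
O(ε^k). Couplings make V_t Lipschitz with respect to h with constant L_t = sup_{s≥t} ‖f_s‖_Lip
(`enorm_tailMean_sub_le`), and h(y,y) = 0. So for k ≥ 2 the k-th absolute moment is at most ε
(L_{t+ε}^k A(h^k(·,y))(y) + o(1)) (`eventually_lintegral_increment_pow_le`), while the first moment
vanishes. Summing the Taylor series of exp gives the growth rate ∑_{k≥2} (L_t^k / k!) sup_x
A(h^k(·,x))(x), whose time integral is at most the claimed exponent (`lintegral_growthRate_le`).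

Two difficulties shape the argument. The moment bounds are not uniform in k, and exp(M) is not known
to be integrable. Hence exp is replaced by `truncExp N`, which grows linearly and whose remainder is
dominated by finitely many Taylor terms plus θ z² (`truncExp_add_le`). Secondly, the admissible ε
depends on the time, the state and the value of M, with no uniformity, so no fixed time grid works.
Instead one considers stopping times τ at which the exponential moment, discounted by exp(-Γ(τ)) for
a clock Γ, is at most 1. They can be prolonged by a measurably chosen dyadic step (`prolong`) and
are stable under increasing limits (`IsControlled.iSup`), so one of maximal mean must reach any
given T (`exists_ge`). Stability requires M to converge along increasing stopping times although V
has no assumed continuity. This follows from Lévy's upward theorem and quasi-left-continuity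
(`ae_tendsto_closedMart_iSup`).

Fatou's lemma then removes T, the slack η of the clock and N. Integrating over the starting point,
with V_0(x) - ν(V_0) ≤ L_0 ν(h(x,·)), gives the factor c_0. -/

@[ext] theorem ext {v w : CadlagPath E} (h : ∀ t, v.1 t = w.1 t) : v = w :=
  Subtype.ext (funext h)

/-- The path shifted by time `s`. -/
def shift (s : ℝ≥0) (w : CadlagPath E) : CadlagPath E :=
  ⟨fun t => w.1 (s + t), fun t => by
    refine ⟨(w.2 (s + t)).1.comp (by fun_prop) fun u hu => add_le_add_right hu s, ?_⟩
    obtain ⟨l, hl⟩ := (w.2 (s + t)).2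
    refine ⟨l, hl.comp (tendsto_nhdsWithin_iff.2 ⟨?_, ?_⟩)⟩
    · exact ((continuous_const.add continuous_id).tendsto t).mono_left nhdsWithin_le_nhds
    · filter_upwards [self_mem_nhdsWithin] with u hu using add_lt_add_right hu s⟩

/-- The path stopped at time `s`. -/
def stopped (s : ℝ≥0) (w : CadlagPath E) : CadlagPath E :=
  ⟨fun t => w.1 (min t s), fun t => by
    refine ⟨ContinuousWithinAt.comp (f := fun u => min u s) (w.2 (min t s)).1 (by fun_prop)
      fun u hu => min_le_min_right s (show t ≤ u from hu), ?_⟩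
    rcases le_or_gt t s with h | h
    · obtain ⟨l, hl⟩ := (w.2 t).2
      refine ⟨l, hl.congr' ?_⟩
      filter_upwards [self_mem_nhdsWithin] with u hu
      rw [min_eq_left ((le_of_lt hu).trans h)]
    · refine ⟨w.1 s, tendsto_const_nhds.congr' ?_⟩
      filter_upwards [mem_nhdsWithin_of_mem_nhds (Ioi_mem_nhds h)] with u hu
      rw [min_eq_right (le_of_lt hu)]⟩

@[simp] theorem shift_apply (s t : ℝ≥0) (w : CadlagPath E) : (shift s w).1 t = w.1 (s + t) := rfl

@[simp] theorem stopped_apply (s t : ℝ≥0) (w : CadlagPath E) : (stopped s w).1 t = w.1 (min t s) := rfl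

theorem stopped_stopped {s t : ℝ≥0} (h : s ≤ t) (w : CadlagPath E) : stopped s (stopped t w) = stopped s w := by
  ext u
  simp [h]

theorem tendsto_of_right (w : CadlagPath E) {ι : Type*} {l : Filter ι} {u : ι → ℝ≥0} {t : ℝ≥0}
    (hu : Tendsto u l (𝓝 t)) (h : ∀ i, t ≤ u i) : Tendsto (fun i => w.1 (u i)) l (𝓝 (w.1 t)) :=
  (w.2 t).1.tendsto.comp (tendsto_nhdsWithin_iff.2 ⟨hu, Eventually.of_forall h⟩)

/-- A càdlàg path converges along every increasing convergent sequence of times. -/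
theorem exists_tendsto_of_monotone (w : CadlagPath E) {u : ℕ → ℝ≥0} (hm : Monotone u) {t : ℝ≥0}
    (hu : Tendsto u atTop (𝓝 t)) : ∃ z, Tendsto (fun n => w.1 (u n)) atTop (𝓝 z) := by
  have hle : ∀ n, u n ≤ t := fun n => hm.ge_of_tendsto hu n
  by_cases h : ∃ n, u n = t
  · obtain ⟨n, hn⟩ := h
    refine ⟨w.1 t, tendsto_const_nhds.congr' ?_⟩
    filter_upwards [eventually_ge_atTop n] with m hmn
    rw [le_antisymm (hle m) (hn ▸ hm hmn)]
  · push Not at h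
    obtain ⟨l, hl⟩ := (w.2 t).2
    exact ⟨l, hl.comp (tendsto_nhdsWithin_iff.2
      ⟨hu, Eventually.of_forall fun n => lt_of_le_of_ne (hle n) (h n)⟩)⟩

/-- The limits of a path along sequences increasing to `t + ε j` converge to its value at `t`
as `ε j ↓ 0`. -/
theorem tendsto_of_limits [RegularSpace E] (w : CadlagPath E) {u : ℕ → ℝ≥0} {t : ℝ≥0}
    (hu : Tendsto u atTop (𝓝 t)) {ε : ℕ → ℝ≥0} (hε : Tendsto ε atTop (𝓝 0)) (hpos : ∀ j, 0 < ε j)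
    {z : ℕ → E} (hz : ∀ j, Tendsto (fun n => w.1 (u n + ε j)) atTop (𝓝 (z j))) :
    Tendsto z atTop (𝓝 (w.1 t)) := by
  rw [(closed_nhds_basis (w.1 t)).tendsto_right_iff]
  rintro U ⟨hU, hUc⟩
  have h1 : ∀ᶠ s in 𝓝[≥] t, w.1 s ∈ U := (w.2 t).1 hU
  obtain ⟨a, ha, hsub⟩ := mem_nhdsGE_iff_exists_Ico_subset.1 h1
  have h2 : ∀ᶠ j in atTop, t + ε j < a := by
    have : Tendsto (fun j => t + ε j) atTop (𝓝 (t + 0)) := tendsto_const_nhds.add hε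
    rw [add_zero] at this
    exact this.eventually (gt_mem_nhds ha)
  filter_upwards [h2] with j hj
  refine hUc.mem_of_tendsto (hz j) ?_
  have h3 : Tendsto (fun n => u n + ε j) atTop (𝓝 (t + ε j)) := hu.add tendsto_const_nhds
  filter_upwards [h3.eventually (gt_mem_nhds hj),
    h3.eventually (lt_mem_nhds (lt_add_of_pos_right t (hpos j)))] with n hn1 hn2
  exact hsub ⟨hn2.le, hn1⟩

end Topological

/-- The first point strictly after `t` in the dyadic grid of level `m`. -/
def dyadicAbove (m : ℕ) (t : ℝ≥0) : ℝ≥0 := (⌊t * 2 ^ m⌋₊ + 1) / 2 ^ m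

theorem lt_dyadicAbove (m : ℕ) (t : ℝ≥0) : t < dyadicAbove m t := by
  rw [dyadicAbove, lt_div_iff₀ (by positivity)]
  exact Nat.lt_floor_add_one _

theorem dyadicAbove_le (m : ℕ) (t : ℝ≥0) : dyadicAbove m t ≤ t + (1 / 2) ^ m := by
  rw [dyadicAbove, add_div]
  gcongr
  · rw [div_le_iff₀ (by positivity)]
    exact Nat.floor_le zero_le
  · simp

theorem tendsto_dyadicAbove (t : ℝ≥0) : Tendsto (fun m => dyadicAbove m t) atTop (𝓝 t) := by
  refine tendsto_of_tendsto_of_tendsto_of_le_of_le tendsto_const_nhds ?_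
    (fun m => (lt_dyadicAbove m t).le) (fun m => dyadicAbove_le m t)
  have : Tendsto (fun m : ℕ => t + (1 / 2 : ℝ≥0) ^ m) atTop (𝓝 (t + 0)) :=
    tendsto_const_nhds.add (NNReal.tendsto_pow_atTop_nhds_zero_of_lt_one
      (by rw [← NNReal.coe_lt_coe]; norm_num))
  simpa using this

/-! ### Measurability of evaluation, shift and stopping -/

section Measurable

variable {E : Type*} [TopologicalSpace E] [MeasurableSpace E]

theorem measurable_eval (t : ℝ≥0) : Measurable fun w : CadlagPath E => w.1 t :=
  (measurable_pi_apply t).comp measurable_subtype_coe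

theorem measurable_of_eval {α : Type*} [MeasurableSpace α] {F : α → CadlagPath E}
    (h : ∀ t, Measurable fun a => (F a).1 t) : Measurable F :=
  (measurable_pi_lambda _ h).subtype_mk

theorem canonicalSigma_le (s : ℝ≥0) :
    canonicalSigma E s ≤ (inferInstance : MeasurableSpace (CadlagPath E)) :=
  iSup_le fun u => (measurable_eval u.1).comap_le

/-- `w ∈ C` is decided by the path up to time `s` if `C` belongs to `canonicalSigma E s`. -/
theorem stop_mem_iff {s : ℝ≥0} {C : Set (CadlagPath E)}
    (hC : MeasurableSet[canonicalSigma E s] C) (w : CadlagPath E) : stopped s w ∈ C ↔ w ∈ C := by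
  -- Only the form of the event as a preimage under stopping matters, so the target may carry the
  -- largest σ-algebra.
  have h : canonicalSigma E s ≤ MeasurableSpace.comap (stopped s : CadlagPath E → CadlagPath E) ⊤ := by
    refine iSup_le fun u => ?_
    rintro _ ⟨B, -, rfl⟩
    refine ⟨{w | w.1 u.1 ∈ B}, trivial, ?_⟩
    ext w
    simp [min_eq_left (show u.1 ≤ s from u.2)]
  obtain ⟨B, -, rfl⟩ := h _ hC
  simp only [mem_preimage, stopped_stopped le_rfl]

theorem measurableSet_canonicalSigma_stop (s : ℝ≥0) {B : Set (CadlagPath E)}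
    (hB : MeasurableSet B) : MeasurableSet[canonicalSigma E s] {w | stopped s w ∈ B} := by
  have h : Measurable[canonicalSigma E s] (stopped s : CadlagPath E → CadlagPath E) := by
    refine @Measurable.subtype_mk _ _ (canonicalSigma E s) _ _ _ ?_ _
    refine @measurable_pi_lambda _ _ _ (canonicalSigma E s) _ _ fun t => ?_
    exact (comap_measurable _).mono
      (le_iSup (fun u : Iic s => MeasurableSpace.comap (fun w : CadlagPath E => w.1 u.1) _)
        ⟨min t s, show min t s ≤ s from min_le_right _ _⟩) le_rfl
  exact h hB

variable [PolishSpace E] [BorelSpace E]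

/-- By right-continuity the evaluation is a limit of evaluations at dyadic times just above; these
take countably many values, so each approximation is jointly measurable. -/
theorem measurable_eval_uncurry : Measurable fun p : ℝ≥0 × CadlagPath E => p.2.1 p.1 := by
  let := TopologicalSpace.upgradeIsCompletelyMetrizable E
  refine measurable_of_tendsto_metrizable
    (f := fun m (p : ℝ≥0 × CadlagPath E) => p.2.1 (dyadicAbove m p.1)) (fun m => ?_) ?_
  · have h : Measurable fun q : ℕ × CadlagPath E => q.2.1 ((q.1 + 1) / 2 ^ m) :=
      measurable_from_prod_countable_right fun n => measurable_eval ((n + 1) / 2 ^ m : ℝ≥0)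
    exact h.comp (((Nat.measurable_floor.comp (measurable_fst.mul_const _))).prodMk measurable_snd)
  · rw [tendsto_pi_nhds]
    intro p
    exact p.2.tendsto_of_right (tendsto_dyadicAbove p.1) fun m => (lt_dyadicAbove m p.1).le

theorem measurable_eval_comp {α : Type*} [MeasurableSpace α] {u : α → ℝ≥0} (hu : Measurable u)
    {F : α → CadlagPath E} (hF : Measurable F) : Measurable fun a => (F a).1 (u a) :=
  measurable_eval_uncurry.comp (hu.prodMk hF)

theorem measurable_shift_comp {α : Type*} [MeasurableSpace α] {u : α → ℝ≥0} (hu : Measurable u)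
    {F : α → CadlagPath E} (hF : Measurable F) : Measurable fun a => shift (u a) (F a) :=
  measurable_of_eval fun t => measurable_eval_comp (hu.add_const t) hF

theorem measurable_stop_comp {α : Type*} [MeasurableSpace α] {u : α → ℝ≥0} (hu : Measurable u)
    {F : α → CadlagPath E} (hF : Measurable F) : Measurable fun a => stopped (u a) (F a) :=
  measurable_of_eval fun _ => measurable_eval_comp (measurable_const.min hu) hF

end Measurable

/-! ### Random times determined by the path up to that time -/

section RandomTime

variable {E : Type*} [TopologicalSpace E] [MeasurableSpace E]

/-- A finite random time `τ` such that the value `τ w` is determined by the restriction of the path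
`w` to `[0, τ w]` (Galmarino's characterization of stopping times). -/
structure IsStopTime (τ : CadlagPath E → ℝ≥0) : Prop where
  measurable : Measurable τ
  congr : ∀ v w : CadlagPath E, (∀ s ≤ τ v, v.1 s = w.1 s) → τ w = τ v

/-- The path stopped at the random time `τ`. -/
def stopAt (τ : CadlagPath E → ℝ≥0) (w : CadlagPath E) : CadlagPath E := stopped (τ w) w

/-- The path after the random time `τ`. -/
def shiftAt (τ : CadlagPath E → ℝ≥0) (w : CadlagPath E) : CadlagPath E := shift (τ w) w

/-- The information available at time `τ`. -/
abbrev pastSigma (τ : CadlagPath E → ℝ≥0) : MeasurableSpace (CadlagPath E) :=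
  MeasurableSpace.comap (stopAt τ) inferInstance

theorem isStopTime_const (s : ℝ≥0) : IsStopTime fun _ : CadlagPath E => s :=
  ⟨measurable_const, fun _ _ _ => rfl⟩

namespace IsStopTime

variable {τ σ : CadlagPath E → ℝ≥0}

theorem apply_stop (hτ : IsStopTime τ) (w : CadlagPath E) {s : ℝ≥0} (h : τ w ≤ s) :
    τ (stopped s w) = τ w :=
  hτ.congr w (stopped s w) fun u hu => by simp [min_eq_left (hu.trans h)]

theorem apply_stopAt (hτ : IsStopTime τ) (w : CadlagPath E) : τ (stopAt τ w) = τ w :=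
  hτ.apply_stop w le_rfl

/-- A stopped path that decides before `s` agrees with `w` up to its decision, hence gives the same
time. -/
theorem apply_lt_iff (hτ : IsStopTime τ) (w : CadlagPath E) (s : ℝ≥0) :
    τ (stopped s w) < s ↔ τ w < s := by
  refine ⟨fun h => ?_, fun h => (hτ.apply_stop w h.le).symm ▸ h⟩
  rwa [hτ.congr (stopped s w) w fun u hu => by simp [min_eq_left (hu.trans h.le)]]

theorem add_const (hτ : IsStopTime τ) (t : ℝ≥0) : IsStopTime fun w => τ w + t :=
  ⟨hτ.measurable.add_const t, fun v w h => by
    rw [hτ.congr v w fun s hs => h s (hs.trans le_self_add)]⟩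

theorem stopAt_stopAt (hτ : IsStopTime τ) (h : ∀ w, τ w ≤ σ w) (w : CadlagPath E) :
    stopAt τ (stopAt σ w) = stopAt τ w := by
  simp only [stopAt]
  rw [hτ.apply_stop w (h w), stopped_stopped (h w)]

/-- The shifted path up to `s` depends only on the path up to `τ + s`. Its events therefore belong
to the past of `τ + s`. -/
theorem stop_shiftAt_stopAt (hτ : IsStopTime τ) (s : ℝ≥0) (w : CadlagPath E) :
    stopped s (shiftAt τ (stopAt (fun w => τ w + s) w)) = stopped s (shiftAt τ w) := by
  have h : τ (stopAt (fun w => τ w + s) w) = τ w := hτ.apply_stop w le_self_add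
  ext u
  simp only [shiftAt, stopped_apply, shift_apply, h]
  simp only [stopAt, stopped_apply]
  exact congrArg w.1 (min_eq_left (add_le_add_right (min_le_right u s) (τ w)))

/-- A function of the path up to time `τ` added to `τ`. -/
theorem add (hτ : IsStopTime τ) {δ : CadlagPath E → ℝ≥0} (hδ : Measurable δ)
    (h : ∀ w, δ (stopAt τ w) = δ w) : IsStopTime fun w => τ w + δ w := by
  refine ⟨hτ.measurable.add hδ, fun v w hvw => ?_⟩
  have h1 : τ w = τ v := hτ.congr v w fun s hs => hvw s (hs.trans le_self_add)
  have h2 : stopAt τ w = stopAt τ v := by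
    ext s
    simp only [stopAt, stopped_apply, h1]
    exact (hvw _ ((min_le_right _ _).trans le_self_add)).symm
  rw [h1, ← h w, h2, h v]

theorem iSup {τ : ℕ → CadlagPath E → ℝ≥0} (hτ : ∀ n, IsStopTime (τ n))
    (hb : ∀ w, BddAbove (range fun n => τ n w)) : IsStopTime fun w => ⨆ n, τ n w := by
  refine ⟨Measurable.iSup fun n => (hτ n).measurable, fun v w h => ?_⟩
  have : ∀ n, τ n w = τ n v := fun n =>
    (hτ n).congr v w fun s hs => h s (hs.trans (le_ciSup (hb v) n))
  simp only [this]

/-- `G` factors through the stopped path, which generates `pastSigma τ`. -/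
theorem measurable_of_stopAt_eq {β : Type*} [MeasurableSpace β] {G : CadlagPath E → β}
    (hG : Measurable G) (h : ∀ w, G (stopAt τ w) = G w) : Measurable[pastSigma τ] G := by
  have : G = G ∘ stopAt τ := funext fun w => (h w).symm
  rw [this]
  exact hG.comp (comap_measurable _)

variable [PolishSpace E] [BorelSpace E]

theorem measurable_stopAt (hτ : IsStopTime τ) : Measurable (stopAt τ) :=
  measurable_stop_comp hτ.measurable measurable_id

theorem measurable_shiftAt (hτ : IsStopTime τ) : Measurable (shiftAt τ) :=
  measurable_shift_comp hτ.measurable measurable_id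

theorem pastSigma_le (hτ : IsStopTime τ) :
    pastSigma τ ≤ (inferInstance : MeasurableSpace (CadlagPath E)) :=
  hτ.measurable_stopAt.comap_le

theorem pastSigma_mono (hτ : IsStopTime τ) (h : ∀ w, τ w ≤ σ w) : pastSigma τ ≤ pastSigma σ :=
  Measurable.comap_le (measurable_of_stopAt_eq hτ.measurable_stopAt (hτ.stopAt_stopAt h))

end IsStopTime

end RandomTime

end CadlagPath

/-! ### The strong Markov property -/

namespace FellerProcess

open CadlagPath

section Kernels

variable {E : Type*} [TopologicalSpace E] [MeasurableSpace E] [OpensMeasurableSpace E]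

/-- The transition kernel of a Feller process. -/
def transKernel (X : FellerProcess E) (t : ℝ≥0) : Kernel E E := X.law.map fun w => w.1 t

instance (X : FellerProcess E) (t : ℝ≥0) : IsMarkovKernel (X.transKernel t) :=
  Kernel.IsMarkovKernel.map _ (measurable_eval t)

theorem transKernel_apply (X : FellerProcess E) (t : ℝ≥0) (x : E) {B : Set E}
    (hB : MeasurableSet B) : X.transKernel t x B = X.law x {w | w.1 t ∈ B} := by
  rw [transKernel, Kernel.map_apply' _ (measurable_eval t) _ hB]; rfl

/-- The Markov property as an identity of measures, so that it can be tested on bounded continuous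
functions. -/
theorem map_restrict_eval_add (X : FellerProcess E) (x : E) (s t : ℝ≥0) {A : Set (CadlagPath E)}
    (hA : MeasurableSet[canonicalSigma E s] A) :
    ((X.law x).restrict A).map (fun w => w.1 (s + t)) =
      (((X.law x).restrict A).map fun w => w.1 s).bind (X.transKernel t) := by
  ext B hB
  rw [Measure.map_apply (measurable_eval _) hB, Measure.restrict_apply (measurable_eval _ hB),
    Measure.bind_apply hB (Kernel.aemeasurable _),
    lintegral_map ((X.transKernel t).measurable_coe hB) (measurable_eval s), inter_comm]
  simp only [X.transKernel_apply t _ hB]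
  exact X.markov x s t A B hA hB

/-- The semigroup on bounded continuous functions. -/
def semigroupBCF (X : FellerProcess E) (t : ℝ≥0) (g : E →ᵇ ℝ) : E →ᵇ ℝ :=
  BoundedContinuousFunction.ofNormedAddCommGroup (fun x => ∫ w, g (w.1 t) ∂(X.law x))
    (X.feller t g) ‖g‖ fun x => by
      have := norm_integral_le_of_norm_le_const (μ := X.law x)
        (Eventually.of_forall fun w : CadlagPath E => g.norm_coe_le_norm (w.1 t))
      simpa using this

theorem integral_transKernel (X : FellerProcess E) (t : ℝ≥0) (x : E) (g : E →ᵇ ℝ) :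
    ∫ y, g y ∂(X.transKernel t x) = X.semigroupBCF t g x := by
  rw [transKernel, Kernel.map_apply _ (measurable_eval t),
    integral_map (measurable_eval t).aemeasurable
      g.continuous.measurable.aestronglyMeasurable]
  rfl

theorem integral_bind_transKernel (X : FellerProcess E) (t : ℝ≥0) (m : Measure E)
    [IsFiniteMeasure m] (g : E →ᵇ ℝ) :
    ∫ y, g y ∂(m.bind (X.transKernel t)) = ∫ y, X.semigroupBCF t g y ∂m := by
  rw [← Measure.snd_compProd, Measure.snd, integral_map measurable_snd.aemeasurable
    g.continuous.measurable.aestronglyMeasurable, Measure.integral_compProd]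
  · simp only [integral_transKernel]
  · refine Integrable.of_bound (C := ‖g‖)
      (g.continuous.measurable.comp measurable_snd).aestronglyMeasurable ?_
    exact Eventually.of_forall fun p => g.norm_coe_le_norm _

end Kernels

section StrongMarkov

variable {E : Type*} [TopologicalSpace E] [PolishSpace E] [MeasurableSpace E] [BorelSpace E]
  (X : FellerProcess E) {τ : CadlagPath E → ℝ≥0}

/-- Where `⌊τ * 2 ^ m⌋₊ = j`, the dyadic time is the constant (j+1)/2^m and lies after `τ`. The
corresponding piece of `A` is thus known at that time, and the Markov property at fixed times
applies to each piece. -/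
theorem setIntegral_dyadicAbove (x : E) (hτ : IsStopTime τ) {A : Set (CadlagPath E)}
    (hA : MeasurableSet[pastSigma τ] A) (t : ℝ≥0) (g : E →ᵇ ℝ) (m : ℕ) :
    ∫ w in A, g (w.1 (dyadicAbove m (τ w) + t)) ∂(X.law x) =
      ∫ w in A, X.semigroupBCF t g (w.1 (dyadicAbove m (τ w))) ∂(X.law x) := by
  have hAm : MeasurableSet A := hτ.pastSigma_le _ hA
  obtain ⟨B, hB, rfl⟩ := hA
  set S : ℕ → Set (CadlagPath E) := fun j => {w | w ∈ stopAt τ ⁻¹' B ∧ ⌊τ w * 2 ^ m⌋₊ = j}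
    with hS
  have hSm : ∀ j, MeasurableSet (S j) := fun j => hAm.inter
    ((Nat.measurable_floor.comp (hτ.measurable.mul_const _)) (measurableSet_singleton j))
  have hunion : stopAt τ ⁻¹' B = ⋃ j, S j := by
    ext w; simp [hS]
  have hdisj : Pairwise (Function.onFun Disjoint S) := by
    intro i j hij
    refine Set.disjoint_left.2 fun w hi hj => hij ?_
    exact hi.2.symm.trans hj.2
  -- Membership in `S j` forces `τ` below the grid point, so stopping there changes neither `τ` nor
  -- the path stopped at `τ`.
  have hcan : ∀ j : ℕ, MeasurableSet[canonicalSigma E ((j + 1) / 2 ^ m)] (S j) := by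
    intro j
    convert measurableSet_canonicalSigma_stop ((j + 1) / 2 ^ m) (hSm j) using 1
    ext w
    have key : ∀ v, v ∈ S j → τ v < ((j : ℝ≥0) + 1) / 2 ^ m := by
      intro v hv
      have := lt_dyadicAbove m (τ v)
      rwa [dyadicAbove, hv.2] at this
    have h2 : τ w < ((j : ℝ≥0) + 1) / 2 ^ m → (w ∈ S j ↔ stopped ((j + 1) / 2 ^ m) w ∈ S j) := by
      intro h
      simp only [hS, mem_ofPred_eq, mem_preimage, hτ.apply_stop w h.le]
      rw [show stopAt τ (stopped ((j + 1) / 2 ^ m) w) = stopAt τ w from by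
        simp only [stopAt]
        rw [hτ.apply_stop w h.le, stopped_stopped h.le]]
    refine ⟨fun h => (h2 (key w h)).1 h, fun h => (h2 ?_).2 h⟩
    exact (hτ.apply_lt_iff w _).1 (key _ h)
  have hbdd : ∀ (g : E →ᵇ ℝ) (u : CadlagPath E → ℝ≥0), Measurable u →
      Integrable (fun w : CadlagPath E => g (w.1 (u w))) (X.law x) := fun g u hu =>
    Integrable.of_bound
      (g.continuous.measurable.comp (measurable_eval_comp hu measurable_id)).aestronglyMeasurable
      ‖g‖ (Eventually.of_forall fun w => g.norm_coe_le_norm _)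
  have hd : Measurable fun w => dyadicAbove m (τ w) := by
    unfold dyadicAbove
    have := (Nat.measurable_floor.comp (hτ.measurable.mul_const (2 ^ m)))
    have h2 : Measurable fun n : ℕ => ((n : ℝ≥0) + 1) / 2 ^ m := measurable_from_top
    exact h2.comp this
  rw [hunion, integral_iUnion hSm hdisj (hbdd g _ (hd.add_const t)).integrableOn,
    integral_iUnion hSm hdisj (hbdd _ _ hd).integrableOn]
  congr 1
  ext j
  have e1 : ∫ w in S j, g (w.1 (dyadicAbove m (τ w) + t)) ∂(X.law x) =
      ∫ w in S j, g (w.1 ((j + 1) / 2 ^ m + t)) ∂(X.law x) :=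
    setIntegral_congr_fun (hSm j) fun w hw => by
      simp only [dyadicAbove, hw.2]
  have e2 : ∫ w in S j, X.semigroupBCF t g (w.1 (dyadicAbove m (τ w))) ∂(X.law x) =
      ∫ w in S j, X.semigroupBCF t g (w.1 ((j + 1) / 2 ^ m)) ∂(X.law x) :=
    setIntegral_congr_fun (hSm j) fun w hw => by
      simp only [dyadicAbove, hw.2]
  rw [e1, e2]
  have h := congrArg (fun m => ∫ y, g y ∂m) (X.map_restrict_eval_add x _ t (hcan j))
  simp only [integral_bind_transKernel] at h
  rwa [integral_map (measurable_eval _).aemeasurable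
      g.continuous.measurable.aestronglyMeasurable,
    integral_map (measurable_eval _).aemeasurable
      (X.semigroupBCF t g).continuous.measurable.aestronglyMeasurable] at h

/-- Let the dyadic times decrease to `τ`: the left side converges by right-continuity of the paths,
the right side because the Feller property makes S_t g continuous. -/
theorem setIntegral_stopTime_add (x : E) (hτ : IsStopTime τ) {A : Set (CadlagPath E)}
    (hA : MeasurableSet[pastSigma τ] A) (t : ℝ≥0) (g : E →ᵇ ℝ) :
    ∫ w in A, g (w.1 (τ w + t)) ∂(X.law x) =
      ∫ w in A, X.semigroupBCF t g (w.1 (τ w)) ∂(X.law x) := by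
  have hlim : ∀ (g : E →ᵇ ℝ) (t : ℝ≥0),
      Tendsto (fun m => ∫ w in A, g (w.1 (dyadicAbove m (τ w) + t)) ∂(X.law x)) atTop
        (𝓝 (∫ w in A, g (w.1 (τ w + t)) ∂(X.law x))) := by
    intro g t
    refine tendsto_integral_of_dominated_convergence (fun _ => ‖g‖) (fun m => ?_)
      (integrable_const _) (fun m => Eventually.of_forall fun w => g.norm_coe_le_norm _)
      (Eventually.of_forall fun w => ?_)
    · have hd : Measurable fun w => dyadicAbove m (τ w) + t := by
        unfold dyadicAbove
        have := (Nat.measurable_floor.comp (hτ.measurable.mul_const (2 ^ m)))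
        have h2 : Measurable fun n : ℕ => ((n : ℝ≥0) + 1) / 2 ^ m + t := measurable_from_top
        exact h2.comp this
      exact (g.continuous.measurable.comp
        (measurable_eval_comp hd measurable_id)).aestronglyMeasurable
    · refine (g.continuous.tendsto _).comp (w.tendsto_of_right ?_ fun m => ?_)
      · exact (tendsto_dyadicAbove _).add_const t
      · exact add_le_add_left (lt_dyadicAbove m _).le t
  have h1 := hlim g t
  have h2 := hlim (X.semigroupBCF t g) 0
  simp only [add_zero] at h2
  simp only [X.setIntegral_dyadicAbove x hτ hA t g] at h1
  exact tendsto_nhds_unique h1 h2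

/-- The strong Markov property for one later time. -/
theorem map_restrict_stopTime_add (x : E) (hτ : IsStopTime τ) {A : Set (CadlagPath E)}
    (hA : MeasurableSet[pastSigma τ] A) (t : ℝ≥0) :
    ((X.law x).restrict A).map (fun w => w.1 (τ w + t)) =
      (((X.law x).restrict A).map fun w => w.1 (τ w)).bind (X.transKernel t) := by
  have hm : ∀ t, Measurable fun w : CadlagPath E => w.1 (τ w + t) := fun t =>
    measurable_eval_comp (hτ.measurable.add_const t) measurable_id
  have hm0 : Measurable fun w : CadlagPath E => w.1 (τ w) := by simpa using hm 0
  refine ext_of_forall_integral_eq_of_IsFiniteMeasure fun g => ?_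
  rw [integral_bind_transKernel, integral_map (hm t).aemeasurable
      g.continuous.measurable.aestronglyMeasurable, integral_map hm0.aemeasurable
      (X.semigroupBCF t g).continuous.measurable.aestronglyMeasurable]
  exact X.setIntegral_stopTime_add x hτ hA t g

end StrongMarkov

end FellerProcess

/-! ### Markov laws on path space and the strong Markov property for whole paths -/

namespace FellerProcess

open CadlagPath

section MarkovLaw

variable {E : Type*} [TopologicalSpace E] [MeasurableSpace E] [OpensMeasurableSpace E]
  (X : FellerProcess E)

/-- A measure on path space has the Markov property with the transition kernels of `X`. -/
def IsMarkovLaw (m : Measure (CadlagPath E)) : Prop :=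
  ∀ (s t : ℝ≥0) (C : Set (CadlagPath E)), MeasurableSet[canonicalSigma E s] C →
    (m.restrict C).map (fun w => w.1 (s + t)) =
      ((m.restrict C).map fun w => w.1 s).bind (X.transKernel t)

theorem isMarkovLaw_bind (n : Measure E) : X.IsMarkovLaw (n.bind X.law) := by
  intro s t C hC
  have hC' : MeasurableSet C := canonicalSigma_le s _ hC
  ext B hB
  have hg : Measurable fun w : CadlagPath E => X.transKernel t (w.1 s) B :=
    ((X.transKernel t).measurable_coe hB).comp (measurable_eval s)
  rw [Measure.map_apply (measurable_eval _) hB, Measure.restrict_apply (measurable_eval _ hB),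
    Measure.bind_apply hB (Kernel.aemeasurable _),
    lintegral_map ((X.transKernel t).measurable_coe hB) (measurable_eval s),
    Measure.bind_apply ((measurable_eval _ hB).inter hC') (Kernel.aemeasurable _),
    ← lintegral_indicator hC', Measure.lintegral_bind (Kernel.aemeasurable _)
      (hg.indicator hC').aemeasurable]
  congr 1
  ext y
  rw [lintegral_indicator hC', inter_comm]
  simp only [X.transKernel_apply t _ hB]
  exact X.markov y s t C B hC hB

variable {X}

/-- Induction over the times in increasing order: a new last time `a` restricts the law at `a` to `B
a` and transports it by the kernel over `b - a`. Keeping track of the law at an arbitrary later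
time, not only of the mass, closes the induction. -/
theorem IsMarkovLaw.map_restrict_eq {m₁ m₂ : Measure (CadlagPath E)} (h₁ : X.IsMarkovLaw m₁)
    (h₂ : X.IsMarkovLaw m₂)
    (h₀ : m₁.map (fun w => w.1 0) = m₂.map (fun w => w.1 0)) (I : Finset ℝ≥0) (B : ℝ≥0 → Set E)
    (hB : ∀ i, MeasurableSet (B i)) : ∀ b : ℝ≥0, (∀ i ∈ I, i ≤ b) →
    (m₁.restrict {w | ∀ i ∈ I, w.1 i ∈ B i}).map (fun w => w.1 b) =
      (m₂.restrict {w | ∀ i ∈ I, w.1 i ∈ B i}).map (fun w => w.1 b) := by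
  classical
  induction I using Finset.induction_on_max with
  | empty =>
    intro b _
    have e1 := h₁ 0 b univ (@MeasurableSet.univ _ (canonicalSigma E 0))
    have e2 := h₂ 0 b univ (@MeasurableSet.univ _ (canonicalSigma E 0))
    simp only [Measure.restrict_univ, zero_add] at e1 e2
    simp [e1, e2, h₀]
  | insert a I ha ih =>
    intro b hb
    have hab : a ≤ b := hb a (Finset.mem_insert_self _ _)
    set C : Set (CadlagPath E) := {w | ∀ i ∈ I, w.1 i ∈ B i} with hC
    have hset : {w : CadlagPath E | ∀ i ∈ insert a I, w.1 i ∈ B i} = {w | w.1 a ∈ B a} ∩ C := by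
      ext w; simp [hC]
    have hcoord : ∀ i ≤ a, MeasurableSet[canonicalSigma E a] {w : CadlagPath E | w.1 i ∈ B i} :=
      fun i hi => le_iSup (fun u : Iic a =>
        MeasurableSpace.comap (fun w : CadlagPath E => w.1 u.1) _) ⟨i, hi⟩ _ ⟨B i, hB i, rfl⟩
    have hCa : MeasurableSet[canonicalSigma E a] C := by
      have : C = ⋂ i ∈ I, {w | w.1 i ∈ B i} := by ext w; simp [hC]
      rw [this]
      exact Finset.measurableSet_biInter I fun i hi => hcoord i (ha i hi).le
    have hD : MeasurableSet[canonicalSigma E a] ({w | w.1 a ∈ B a} ∩ C) :=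
      MeasurableSet.inter (hcoord a le_rfl) hCa
    have key : ∀ m : Measure (CadlagPath E), X.IsMarkovLaw m →
        (m.restrict ({w | w.1 a ∈ B a} ∩ C)).map (fun w => w.1 b) =
        (((m.restrict C).map fun w => w.1 a).restrict (B a)).bind (X.transKernel (b - a)) := by
      intro m hm
      have e := hm a (b - a) _ hD
      rw [add_tsub_cancel_of_le hab] at e
      rw [e, Measure.restrict_map (measurable_eval a) (hB a),
        Measure.restrict_restrict (measurable_eval a (hB a))]
      rfl
    rw [hset, key m₁ h₁, key m₂ h₂, ih a fun i hi => (ha i hi).le]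

/-- The finite-dimensional cylinders form a generating π-system, and their masses are determined by
the initial distribution. -/
theorem IsMarkovLaw.ext {m₁ m₂ : Measure (CadlagPath E)} [IsFiniteMeasure m₁]
    (h₁ : X.IsMarkovLaw m₁) (h₂ : X.IsMarkovLaw m₂)
    (h₀ : m₁.map (fun w => w.1 0) = m₂.map (fun w => w.1 0)) : m₁ = m₂ := by
  have hrect : ∀ (I : Finset ℝ≥0) (B : ℝ≥0 → Set E), (∀ i, MeasurableSet (B i)) →
      m₁ {w | ∀ i ∈ I, w.1 i ∈ B i} = m₂ {w | ∀ i ∈ I, w.1 i ∈ B i} := by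
    intro I B hB
    have h := h₁.map_restrict_eq h₂ h₀ I B hB (I.sup id) fun i hi => Finset.le_sup (f := id) hi
    have := congrArg (fun m => m univ) h
    simpa [Measure.map_apply (measurable_eval _) MeasurableSet.univ] using this
  refine MeasureTheory.ext_of_generate_finite
    (preimage Subtype.val '' squareCylinders fun _ : ℝ≥0 => {s : Set E | MeasurableSet s}) ?_ ?_ ?_ ?_
  · rw [← MeasurableSpace.comap_generateFrom, generateFrom_squareCylinders]
    rfl
  · exact IsPiSystem.comap (isPiSystem_squareCylinders (fun _ ↦ MeasurableSpace.isPiSystem_measurableSet)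
      (by simp)) _
  · rintro _ ⟨_, ⟨I, B, hB, rfl⟩, rfl⟩
    exact hrect I B fun i => hB i (mem_univ i)
  · simpa using hrect ∅ (fun _ => univ) fun _ => MeasurableSet.univ

end MarkovLaw

section StrongMarkov

variable {E : Type*} [TopologicalSpace E] [PolishSpace E] [MeasurableSpace E] [BorelSpace E]
  (X : FellerProcess E) {τ : CadlagPath E → ℝ≥0}

/-- An event of the shifted path up to `s`, intersected with `A`, lies in the past of the stopping
time `τ + s`, so the strong Markov property for one later time applies at `τ + s`. -/
theorem isMarkovLaw_shiftAt (x : E) (hτ : IsStopTime τ) {A : Set (CadlagPath E)}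
    (hA : MeasurableSet[pastSigma τ] A) :
    X.IsMarkovLaw (((X.law x).restrict A).map (shiftAt τ)) := by
  intro s t C hC
  have hC' : MeasurableSet C := canonicalSigma_le s _ hC
  have hσ := hτ.add_const s
  have hpre : MeasurableSet[pastSigma fun w => τ w + s] (shiftAt τ ⁻¹' C) := by
    refine ⟨shiftAt τ ⁻¹' C, hτ.measurable_shiftAt hC', ?_⟩
    ext w
    simp only [mem_preimage]
    rw [← stop_mem_iff hC, hτ.stop_shiftAt_stopAt s, stop_mem_iff hC]
  have hAC : MeasurableSet[pastSigma fun w => τ w + s] (shiftAt τ ⁻¹' C ∩ A) :=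
    MeasurableSet.inter hpre (hτ.pastSigma_mono (fun w => le_self_add) _ hA)
  have h := X.map_restrict_stopTime_add x hσ hAC t
  rw [Measure.restrict_map hτ.measurable_shiftAt hC',
    Measure.restrict_restrict (hτ.measurable_shiftAt hC'),
    Measure.map_map (measurable_eval _) hτ.measurable_shiftAt,
    Measure.map_map (measurable_eval _) hτ.measurable_shiftAt]
  simpa [Function.comp_def, shiftAt, add_assoc] using h

/-- Both sides are Markov laws with the same initial distribution. This passes from one later time
to the whole future path. -/
theorem map_shiftAt_restrict (x : E) (hτ : IsStopTime τ) {A : Set (CadlagPath E)}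
    (hA : MeasurableSet[pastSigma τ] A) :
    ((X.law x).restrict A).map (shiftAt τ) =
      (((X.law x).restrict A).map fun w => w.1 (τ w)).bind X.law := by
  have hm0 : Measurable fun w : CadlagPath E => w.1 (τ w) :=
    measurable_eval_comp hτ.measurable measurable_id
  refine (X.isMarkovLaw_shiftAt x hτ hA).ext (X.isMarkovLaw_bind _) ?_
  rw [Measure.map_map (measurable_eval _) hτ.measurable_shiftAt]
  ext B hB
  rw [Measure.map_apply (measurable_eval 0) hB, Measure.bind_apply (measurable_eval 0 hB)
    (Kernel.aemeasurable _)]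
  have : ∀ y, X.law y ((fun w : CadlagPath E => w.1 0) ⁻¹' B) = B.indicator 1 y := by
    intro y
    by_cases hy : y ∈ B
    · rw [indicator_of_mem hy, Pi.one_apply, ← prob_compl_eq_zero_iff (measurable_eval 0 hB)]
      refine ae_iff.1 ((X.start y).mono fun w h0 => ?_)
      simpa [h0] using hy
    · rw [indicator_of_notMem hy]
      have h : ∀ᵐ w ∂(X.law y), w.1 0 ∉ B := (X.start y).mono fun w h0 => by rwa [h0]
      convert ae_iff.1 h using 2
      ext w
      simp
  simp only [this]
  rw [lintegral_indicator_one hB]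
  simp [Function.comp_def, shiftAt]

/-- The starting distribution of the process after `τ`. -/
def restartKernel (hτ : IsStopTime τ) : Kernel (CadlagPath E) (CadlagPath E) :=
  X.law.comap (fun w => w.1 (τ w)) (measurable_eval_comp hτ.measurable measurable_id)

instance (hτ : IsStopTime τ) : IsMarkovKernel (X.restartKernel hτ) := by
  unfold restartKernel; infer_instance

/-- The strong Markov property. -/
theorem map_stopAt_shiftAt (x : E) (hτ : IsStopTime τ) :
    (X.law x).map (fun w => (stopAt τ w, shiftAt τ w)) =
      ((X.law x).map (stopAt τ)) ⊗ₘ X.restartKernel hτ := by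
  have hm0 : Measurable fun w : CadlagPath E => w.1 (τ w) :=
    measurable_eval_comp hτ.measurable measurable_id
  have hms := hτ.measurable_stopAt
  have hpair : Measurable fun w => (stopAt τ w, shiftAt τ w) := hms.prodMk hτ.measurable_shiftAt
  have : IsProbabilityMeasure ((X.law x).map fun w => (stopAt τ w, shiftAt τ w)) :=
    Measure.isProbabilityMeasure_map hpair.aemeasurable
  have : IsProbabilityMeasure ((X.law x).map (stopAt τ)) :=
    Measure.isProbabilityMeasure_map hms.aemeasurable
  refine Measure.ext_prod fun {B C} hB hC => ?_
  have h := congrArg (fun m => m C) (X.map_shiftAt_restrict x hτ (A := stopAt τ ⁻¹' B) ⟨B, hB, rfl⟩)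
  rw [Measure.map_apply hτ.measurable_shiftAt hC,
    Measure.restrict_apply (hτ.measurable_shiftAt hC), Measure.bind_apply hC
      (Kernel.aemeasurable _), lintegral_map (X.law.measurable_coe hC) hm0] at h
  rw [Measure.map_apply hpair (hB.prod hC), Measure.compProd_apply_prod hB hC,
    setLIntegral_map hB ((X.restartKernel hτ).measurable_coe hC) hms]
  have e : (fun w => (stopAt τ w, shiftAt τ w)) ⁻¹' (B ×ˢ C) = shiftAt τ ⁻¹' C ∩ stopAt τ ⁻¹' B := by
    ext w; simp [and_comm]
  rw [e, h]
  refine lintegral_congr fun w => ?_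
  simp [restartKernel, Kernel.comap_apply, stopAt, hτ.apply_stop w le_rfl]

/-- The past enters only through the stopped path, which is frozen in the inner integral. -/
theorem lintegral_strongMarkov (x : E) (hτ : IsStopTime τ)
    {Ψ : CadlagPath E × CadlagPath E → ℝ≥0∞} (hΨ : Measurable Ψ) :
    ∫⁻ w, Ψ (stopAt τ w, shiftAt τ w) ∂(X.law x) =
      ∫⁻ w, (∫⁻ w', Ψ (stopAt τ w, w') ∂(X.law (w.1 (τ w)))) ∂(X.law x) := by
  have hms := hτ.measurable_stopAt
  have : IsProbabilityMeasure ((X.law x).map (stopAt τ)) :=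
    Measure.isProbabilityMeasure_map hms.aemeasurable
  have hpair : Measurable fun w => (stopAt τ w, shiftAt τ w) := hms.prodMk hτ.measurable_shiftAt
  rw [← lintegral_map (f := Ψ) (g := fun w => (stopAt τ w, shiftAt τ w)) hΨ hpair,
    X.map_stopAt_shiftAt x hτ, Measure.lintegral_compProd hΨ,
    lintegral_map hΨ.lintegral_kernel_prod_right' hms]
  refine lintegral_congr fun w => ?_
  simp [restartKernel, Kernel.comap_apply, stopAt, hτ.apply_stop w le_rfl]

theorem setIntegral_strongMarkov (x : E) (hτ : IsStopTime τ)
    {Ψ : CadlagPath E × CadlagPath E → ℝ} (hΨ : StronglyMeasurable Ψ)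
    (hi : Integrable (fun w => Ψ (stopAt τ w, shiftAt τ w)) (X.law x))
    {A : Set (CadlagPath E)} (hA : MeasurableSet[pastSigma τ] A) :
    ∫ w in A, Ψ (stopAt τ w, shiftAt τ w) ∂(X.law x) =
      ∫ w in A, (∫ w', Ψ (stopAt τ w, w') ∂(X.law (w.1 (τ w)))) ∂(X.law x) := by
  have hms := hτ.measurable_stopAt
  have : IsProbabilityMeasure ((X.law x).map (stopAt τ)) :=
    Measure.isProbabilityMeasure_map hms.aemeasurable
  have hpair : Measurable fun w => (stopAt τ w, shiftAt τ w) := hms.prodMk hτ.measurable_shiftAt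
  obtain ⟨B, hB, rfl⟩ := hA
  have hi2 : Integrable Ψ (((X.law x).map (stopAt τ)) ⊗ₘ X.restartKernel hτ) := by
    rw [← X.map_stopAt_shiftAt x hτ, integrable_map_measure hΨ.aestronglyMeasurable
      hpair.aemeasurable]
    exact hi
  have h := Measure.setIntegral_compProd hB MeasurableSet.univ (f := Ψ) hi2.integrableOn
  rw [← X.map_stopAt_shiftAt x hτ, setIntegral_map (hB.prod MeasurableSet.univ)
    hΨ.aestronglyMeasurable hpair.aemeasurable, setIntegral_map hB
      (by
        simp only [Measure.restrict_univ]
        exact (StronglyMeasurable.integral_kernel_prod_right' hΨ).aestronglyMeasurable)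
      hms.aemeasurable] at h
  have e : (fun w => (stopAt τ w, shiftAt τ w)) ⁻¹' (B ×ˢ univ) = stopAt τ ⁻¹' B := by
    ext w; simp
  rw [e] at h
  rw [h]
  congr 1
  ext w
  simp [restartKernel, Kernel.comap_apply, stopAt, hτ.apply_stop w le_rfl]

end StrongMarkov

end FellerProcess

/-! ### Quasi-left-continuity -/

namespace FellerProcess

open CadlagPath

section Semigroup

variable {E : Type*} [TopologicalSpace E] [MeasurableSpace E] [OpensMeasurableSpace E]
  (X : FellerProcess E)

theorem tendsto_semigroupBCF (k : E →ᵇ ℝ) {ε : ℕ → ℝ≥0} (hε : Tendsto ε atTop (𝓝 0)) (y : E) :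
    Tendsto (fun j => X.semigroupBCF (ε j) k y) atTop (𝓝 (k y)) := by
  have h0 : ∫ w : CadlagPath E, k (w.1 0) ∂(X.law y) = k y := by
    rw [integral_congr_ae (g := fun _ => k y) ((X.start y).mono fun w hw => by simp [hw])]
    simp
  rw [← h0]
  refine tendsto_integral_of_dominated_convergence (fun _ => ‖k‖) (fun j =>
      (k.continuous.measurable.comp (measurable_eval _)).aestronglyMeasurable)
    (integrable_const _) (fun j => Eventually.of_forall fun w => k.norm_coe_le_norm _)
    (Eventually.of_forall fun w => ?_)
  exact (k.continuous.tendsto _).comp (w.tendsto_of_right hε fun _ => zero_le)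

end Semigroup

variable {E : Type*} [TopologicalSpace E] [PolishSpace E] [MeasurableSpace E] [BorelSpace E]
  (X : FellerProcess E)

theorem integral_mul_stopTime_add (x : E) {τ : CadlagPath E → ℝ≥0} (hτ : IsStopTime τ)
    (g k : E →ᵇ ℝ) (t : ℝ≥0) :
    ∫ w, g (w.1 (τ w)) * k (w.1 (τ w + t)) ∂(X.law x) =
      ∫ w, g (w.1 (τ w)) * X.semigroupBCF t k (w.1 (τ w)) ∂(X.law x) := by
  have hm0 : Measurable fun w : CadlagPath E => w.1 (τ w) :=
    measurable_eval_comp hτ.measurable measurable_id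
  have hΨ : Measurable fun p : CadlagPath E × CadlagPath E => g (p.1.1 (τ p.1)) * k (p.2.1 t) :=
    ((g.continuous.measurable.comp hm0).comp measurable_fst).mul
      ((k.continuous.measurable.comp (measurable_eval t)).comp measurable_snd)
  have h := X.setIntegral_strongMarkov x hτ hΨ.stronglyMeasurable (A := univ) ?_
    (@MeasurableSet.univ _ (pastSigma τ))
  · simp only [Measure.restrict_univ, hτ.apply_stopAt, integral_const_mul] at h
    have e : ∀ w : CadlagPath E, (stopAt τ w).1 (τ w) = w.1 (τ w) := fun w => by simp [stopAt]
    simp only [e] at h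
    exact h
  · refine Integrable.of_bound (C := ‖g‖ * ‖k‖)
      (hΨ.comp (hτ.measurable_stopAt.prodMk hτ.measurable_shiftAt)).aestronglyMeasurable
      (Eventually.of_forall fun w => ?_)
    rw [norm_mul]
    exact mul_le_mul (g.norm_coe_le_norm _) (k.norm_coe_le_norm _) (norm_nonneg _) (norm_nonneg _)

/-- Quasi-left-continuity of Feller processes. -/
theorem ae_tendsto_eval_iSup (x : E) {τ : ℕ → CadlagPath E → ℝ≥0} (hτ : ∀ n, IsStopTime (τ n))
    (hm : ∀ w, Monotone fun n => τ n w) (hb : ∀ w, BddAbove (range fun n => τ n w)) :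
    ∀ᵐ w ∂(X.law x), Tendsto (fun n => w.1 (τ n w)) atTop (𝓝 (w.1 (⨆ n, τ n w))) := by
  let := TopologicalSpace.upgradeIsCompletelyMetrizable E
  have hlim : ∀ w, Tendsto (fun n => τ n w) atTop (𝓝 (⨆ n, τ n w)) := fun w =>
    tendsto_atTop_ciSup (hm w) (hb w)
  have hσ := IsStopTime.iSup hτ hb
  have hex : ∀ (t : ℝ≥0) (w : CadlagPath E), ∃ z, Tendsto (fun n => w.1 (τ n w + t)) atTop (𝓝 z) :=
    fun t w => w.exists_tendsto_of_monotone (fun _ _ h => add_le_add_left (hm w h) t)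
      ((hlim w).add_const t)
  -- `Z t` is the limit of the path along `τ n + t`; the claim is that `Z 0` is almost surely the
  -- value at the supremum.
  choose Z hZ using hex
  have hmeas : ∀ t n, Measurable fun w : CadlagPath E => w.1 (τ n w + t) := fun t n =>
    measurable_eval_comp ((hτ n).measurable.add_const t) measurable_id
  have hZm : ∀ t, Measurable (Z t) := fun t =>
    measurable_of_tendsto_metrizable (hmeas t) (tendsto_pi_nhds.2 (hZ t))
  have hYm : Measurable fun w : CadlagPath E => w.1 (⨆ n, τ n w) :=
    measurable_eval_comp hσ.measurable measurable_id
  have hZ0 : ∀ w, Tendsto (fun n => w.1 (τ n w)) atTop (𝓝 (Z 0 w)) := fun w => by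
    simpa using hZ 0 w
  let ε : ℕ → ℝ≥0 := fun j => 1 / ((j : ℝ≥0) + 1)
  have hε : Tendsto ε atTop (𝓝 0) := tendsto_one_div_add_atTop_nhds_zero_nat
  have hεpos : ∀ j, 0 < ε j := fun j => by positivity
  have hZε : ∀ w, Tendsto (fun j => Z (ε j) w) atTop (𝓝 (w.1 (⨆ n, τ n w))) := fun w =>
    w.tendsto_of_limits (hlim w) hε hεpos fun j => hZ (ε j) w
  have hbd : ∀ (g k : E →ᵇ ℝ) (y z : E), ‖g y * k z‖ ≤ ‖g‖ * ‖k‖ := fun g k y z => by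
    rw [norm_mul]
    exact mul_le_mul (g.norm_coe_le_norm _) (k.norm_coe_le_norm _) (norm_nonneg _) (norm_nonneg _)
  have hgk : ∀ (g k : E →ᵇ ℝ) {U W : CadlagPath E → E}, Measurable U → Measurable W →
      AEStronglyMeasurable (fun w => g (U w) * k (W w)) (X.law x) := fun g k U W hU hW =>
    ((g.continuous.measurable.comp hU).mul (k.continuous.measurable.comp hW)).aestronglyMeasurable
  -- The strong Markov property at `τ n`, passed to the limit: `Z t` is distributed, given `Z 0`,
  -- like the process at time `t` started from `Z 0`.
  have key1 : ∀ (g k : E →ᵇ ℝ) (t : ℝ≥0), ∫ w, g (Z 0 w) * k (Z t w) ∂(X.law x) =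
      ∫ w, g (Z 0 w) * X.semigroupBCF t k (Z 0 w) ∂(X.law x) := by
    intro g k t
    have h1 : Tendsto (fun n => ∫ w, g (w.1 (τ n w)) * k (w.1 (τ n w + t)) ∂(X.law x)) atTop
        (𝓝 (∫ w, g (Z 0 w) * k (Z t w) ∂(X.law x))) := by
      refine tendsto_integral_of_dominated_convergence (fun _ => ‖g‖ * ‖k‖)
        (fun n => hgk g k (by simpa using hmeas 0 n) (hmeas t n)) (integrable_const _)
        (fun n => Eventually.of_forall fun w => hbd g k _ _) (Eventually.of_forall fun w => ?_)
      exact ((g.continuous.tendsto _).comp (hZ0 w)).mul ((k.continuous.tendsto _).comp (hZ t w))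
    have h2 : Tendsto (fun n => ∫ w, g (w.1 (τ n w)) * X.semigroupBCF t k (w.1 (τ n w))
        ∂(X.law x)) atTop (𝓝 (∫ w, g (Z 0 w) * X.semigroupBCF t k (Z 0 w) ∂(X.law x))) := by
      refine tendsto_integral_of_dominated_convergence (fun _ => ‖g‖ * ‖X.semigroupBCF t k‖)
        (fun n => hgk g _ (by simpa using hmeas 0 n) (by simpa using hmeas 0 n))
        (integrable_const _)
        (fun n => Eventually.of_forall fun w => hbd g _ _ _) (Eventually.of_forall fun w => ?_)
      exact ((g.continuous.tendsto _).comp (hZ0 w)).mul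
        (((X.semigroupBCF t k).continuous.tendsto _).comp (hZ0 w))
    simp only [X.integral_mul_stopTime_add x (hτ _)] at h1
    exact tendsto_nhds_unique h1 h2
  -- Now t = `ε j` tends to 0: `Z (ε j)` tends to the value at the supremum, and S_t k tends to k.
  have key2 : ∀ (g k : E →ᵇ ℝ), ∫ w, g (Z 0 w) * k (w.1 (⨆ n, τ n w)) ∂(X.law x) =
      ∫ w, g (Z 0 w) * k (Z 0 w) ∂(X.law x) := by
    intro g k
    have h1 : Tendsto (fun j => ∫ w, g (Z 0 w) * k (Z (ε j) w) ∂(X.law x)) atTop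
        (𝓝 (∫ w, g (Z 0 w) * k (w.1 (⨆ n, τ n w)) ∂(X.law x))) := by
      refine tendsto_integral_of_dominated_convergence (fun _ => ‖g‖ * ‖k‖)
        (fun n => hgk g k (hZm 0) (hZm _)) (integrable_const _)
        (fun n => Eventually.of_forall fun w => hbd g k _ _) (Eventually.of_forall fun w => ?_)
      exact tendsto_const_nhds.mul ((k.continuous.tendsto _).comp (hZε w))
    have h2 : Tendsto (fun j => ∫ w, g (Z 0 w) * X.semigroupBCF (ε j) k (Z 0 w) ∂(X.law x)) atTop
        (𝓝 (∫ w, g (Z 0 w) * k (Z 0 w) ∂(X.law x))) := by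
      refine tendsto_integral_of_dominated_convergence (fun _ => ‖g‖ * ‖k‖)
        (fun n => hgk g _ (hZm 0) (hZm 0)) (integrable_const _)
        (fun n => Eventually.of_forall fun w => (hbd g _ _ _).trans ?_)
        (Eventually.of_forall fun w => ?_)
      · gcongr
        exact BoundedContinuousFunction.norm_ofNormedAddCommGroup_le _ (norm_nonneg _) _
      · exact tendsto_const_nhds.mul (X.tendsto_semigroupBCF k hε _)
    exact tendsto_nhds_unique (h1.congr fun j => key1 g k (ε j)) h2
  have hp1 : Measurable fun w => (Z 0 w, w.1 (⨆ n, τ n w)) := (hZm 0).prodMk hYm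
  have hp2 : Measurable fun w => (Z 0 w, Z 0 w) := (hZm 0).prodMk (hZm 0)
  -- Products of bounded continuous functions determine the joint law, and the law of (`Z 0`, `Z 0`)
  -- is carried by the diagonal.
  have hmap : (X.law x).map (fun w => (Z 0 w, w.1 (⨆ n, τ n w))) =
      (X.law x).map (fun w => (Z 0 w, Z 0 w)) := by
    refine Measure.ext_of_integral_mul_boundedContinuousFunction fun g k => ?_
    have hc : Continuous fun p : E × E => g p.1 * k p.2 := by fun_prop
    rw [integral_map hp1.aemeasurable hc.measurable.aestronglyMeasurable,
      integral_map hp2.aemeasurable hc.measurable.aestronglyMeasurable]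
    exact key2 g k
  have hdiag : MeasurableSet (diagonal E)ᶜ := measurableSet_diagonal.compl
  have h0 := congrArg (fun m => m (diagonal E)ᶜ) hmap
  simp only [Measure.map_apply hp1 hdiag, Measure.map_apply hp2 hdiag] at h0
  have hae : ∀ᵐ w ∂(X.law x), Z 0 w = w.1 (⨆ n, τ n w) := by
    have h1 : (fun w : CadlagPath E => (Z 0 w, Z 0 w)) ⁻¹' (diagonal E)ᶜ = ∅ := by ext w; simp
    rw [h1, measure_empty] at h0
    exact ae_iff.2 h0
  filter_upwards [hae] with w hw
  exact hw ▸ hZ0 w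

end FellerProcess

/-! ### Lebesgue measure on the time axis -/

section TimeMeasure

theorem measurableEmbedding_nnreal_toReal : MeasurableEmbedding NNReal.toReal :=
  MeasurableEmbedding.subtype_coe (s := {r : ℝ | 0 ≤ r}) measurableSet_Ici

theorem timeMeasure_apply (s : Set ℝ≥0) : timeMeasure s = volume (NNReal.toReal '' s) :=
  measurableEmbedding_nnreal_toReal.comap_apply _ _

theorem timeMeasure_Iic (t : ℝ≥0) : timeMeasure (Iic t) = t := by
  have : NNReal.toReal '' Iic t = Icc 0 (t : ℝ) := by
    ext r
    simp only [mem_image, mem_Iic, mem_Icc]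
    constructor
    · rintro ⟨s, hs, rfl⟩
      exact ⟨s.2, hs⟩
    · rintro ⟨h0, h1⟩
      exact ⟨⟨r, h0⟩, h1, rfl⟩
  rw [timeMeasure_apply, this, Real.volume_Icc, sub_zero, ENNReal.ofReal_coe_nnreal]

theorem timeMeasure_Iio_le (t : ℝ≥0) : timeMeasure (Iio t) ≤ t :=
  (measure_mono Iio_subset_Iic_self).trans (timeMeasure_Iic t).le

theorem timeMeasure_Ico (s t : ℝ≥0) : timeMeasure (Ico s t) = t - s := by
  have : NNReal.toReal '' Ico s t = Ico (s : ℝ) (t : ℝ) := by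
    ext r
    simp only [mem_image, mem_Ico]
    constructor
    · rintro ⟨u, hu, rfl⟩
      exact_mod_cast hu
    · rintro ⟨h0, h1⟩
      exact ⟨⟨r, s.2.trans h0⟩, ⟨h0, h1⟩, rfl⟩
  rw [timeMeasure_apply, this, Real.volume_Ico, ENNReal.ofReal_sub _ s.coe_nonneg,
    ENNReal.ofReal_coe_nnreal, ENNReal.ofReal_coe_nnreal]

instance : IsLocallyFiniteMeasure timeMeasure := by
  refine ⟨fun t => ⟨Iio (t + 1), Iio_mem_nhds (lt_add_one t), ?_⟩⟩
  exact (timeMeasure_Iio_le _).trans_lt ENNReal.coe_lt_top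

theorem measurableEmbedding_nnreal_add_left (t : ℝ≥0) : MeasurableEmbedding fun s : ℝ≥0 => t + s :=
  (Continuous.measurableEmbedding (by fun_prop) fun _ _ h => add_left_cancel h)

theorem map_add_left_timeMeasure (t : ℝ≥0) :
    timeMeasure.map (fun s => t + s) = timeMeasure.restrict (Ici t) := by
  ext s hs
  rw [(measurableEmbedding_nnreal_add_left t).map_apply, Measure.restrict_apply hs,
    timeMeasure_apply, timeMeasure_apply]
  have : NNReal.toReal '' (s ∩ Ici t) =
      (fun r : ℝ => (t : ℝ) + r) '' (NNReal.toReal '' ((fun s => t + s) ⁻¹' s)) := by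
    ext r
    simp only [mem_image, mem_inter_iff, mem_Ici, mem_preimage]
    constructor
    · rintro ⟨u, ⟨hu, htu⟩, rfl⟩
      refine ⟨_, ⟨u - t, ?_, rfl⟩, ?_⟩
      · rwa [add_tsub_cancel_of_le htu]
      · rw [← NNReal.coe_add, add_tsub_cancel_of_le htu]
    · rintro ⟨_, ⟨u, hu, rfl⟩, rfl⟩
      exact ⟨t + u, ⟨hu, le_self_add⟩, NNReal.coe_add _ _⟩
  rw [this, image_add_left, measure_preimage_add]

theorem lintegral_Ici_timeMeasure (t : ℝ≥0) (g : ℝ≥0 → ℝ≥0∞) :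
    ∫⁻ s in Ici t, g s ∂timeMeasure = ∫⁻ s, g (t + s) ∂timeMeasure := by
  rw [← map_add_left_timeMeasure, (measurableEmbedding_nnreal_add_left t).lintegral_map]

theorem integral_Ici_timeMeasure (t : ℝ≥0) (g : ℝ≥0 → ℝ) :
    ∫ s in Ici t, g s ∂timeMeasure = ∫ s, g (t + s) ∂timeMeasure := by
  rw [← map_add_left_timeMeasure, (measurableEmbedding_nnreal_add_left t).integral_map]

end TimeMeasure

/-! ### Additive functionals of the process after a given time -/

section Functionals

open CadlagPath

variable {E : Type*} [TopologicalSpace E]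

/-- `∫_0^∞ f_{t+s}(w_s) ds`. -/
def tailFunctional (f : ℝ≥0 → E → ℝ) (t : ℝ≥0) (w : CadlagPath E) : ℝ :=
  ∫ s, f (t + s) (w.1 s) ∂timeMeasure

/-- `∫_0^u f_{t+s}(w_s) ds`. -/
def headFunctional (f : ℝ≥0 → E → ℝ) (t u : ℝ≥0) (w : CadlagPath E) : ℝ :=
  ∫ s in Iio u, f (t + s) (w.1 s) ∂timeMeasure

/-- `∫_0^∞ |f_{t+s}(w_s)| ds`. -/
def absTail (f : ℝ≥0 → E → ℝ) (t : ℝ≥0) (w : CadlagPath E) : ℝ≥0∞ :=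
  ∫⁻ s, ‖f (t + s) (w.1 s)‖ₑ ∂timeMeasure

theorem tailFunctional_zero (f : ℝ≥0 → E → ℝ) : tailFunctional f 0 = additiveFunctional f := by
  ext w; simp [tailFunctional, additiveFunctional]

theorem absTail_shift (f : ℝ≥0 → E → ℝ) (t u : ℝ≥0) (w : CadlagPath E) :
    absTail f (t + u) (shift u w) = ∫⁻ s in Ici u, ‖f (t + s) (w.1 s)‖ₑ ∂timeMeasure := by
  rw [lintegral_Ici_timeMeasure]; simp [absTail, add_assoc]

theorem absTail_shift_le (f : ℝ≥0 → E → ℝ) (t u : ℝ≥0) (w : CadlagPath E) :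
    absTail f (t + u) (shift u w) ≤ absTail f t w :=
  (absTail_shift f t u w).trans_le (setLIntegral_le_lintegral _ _)

theorem enorm_tailFunctional_le (f : ℝ≥0 → E → ℝ) (t : ℝ≥0) (w : CadlagPath E) :
    ‖tailFunctional f t w‖ₑ ≤ absTail f t w :=
  enorm_integral_le_lintegral_enorm _

theorem enorm_headFunctional_le (f : ℝ≥0 → E → ℝ) (t u : ℝ≥0) (w : CadlagPath E) :
    ‖headFunctional f t u w‖ₑ ≤ ∫⁻ s in Iio u, ‖f (t + s) (w.1 s)‖ₑ ∂timeMeasure :=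
  enorm_integral_le_lintegral_enorm _

theorem headFunctional_congr (f : ℝ≥0 → E → ℝ) (t u : ℝ≥0) {v w : CadlagPath E}
    (h : ∀ s ≤ u, v.1 s = w.1 s) : headFunctional f t u v = headFunctional f t u w :=
  setIntegral_congr_fun measurableSet_Iio fun s hs => by simp [h s (le_of_lt hs)]

variable [MeasurableSpace E] [PolishSpace E] [BorelSpace E] {f : ℝ≥0 → E → ℝ}

theorem measurable_integrand (hf : Measurable fun p : ℝ≥0 × E => f p.1 p.2) :
    Measurable fun q : (ℝ≥0 × CadlagPath E) × ℝ≥0 => f (q.1.1 + q.2) (q.1.2.1 q.2) :=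
  hf.comp ((measurable_fst.fst.add measurable_snd).prodMk
    (measurable_eval_comp measurable_snd measurable_fst.snd))

theorem measurable_absTail (hf : Measurable fun p : ℝ≥0 × E => f p.1 p.2) :
    Measurable fun q : ℝ≥0 × CadlagPath E => absTail f q.1 q.2 :=
  (measurable_integrand hf).enorm.lintegral_prod_right'

theorem measurable_tailFunctional (hf : Measurable fun p : ℝ≥0 × E => f p.1 p.2) :
    Measurable fun q : ℝ≥0 × CadlagPath E => tailFunctional f q.1 q.2 :=
  ((measurable_integrand hf).stronglyMeasurable.integral_prod_right').measurable

theorem measurable_headFunctional (hf : Measurable fun p : ℝ≥0 × E => f p.1 p.2) :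
    Measurable fun q : (ℝ≥0 × ℝ≥0) × CadlagPath E => headFunctional f q.1.1 q.1.2 q.2 := by
  have h : Measurable fun q : ((ℝ≥0 × ℝ≥0) × CadlagPath E) × ℝ≥0 =>
      {p : ((ℝ≥0 × ℝ≥0) × CadlagPath E) × ℝ≥0 | p.2 < p.1.1.2}.indicator
        (fun p => f (p.1.1.1 + p.2) (p.1.2.1 p.2)) q :=
    ((measurable_integrand hf).comp ((measurable_fst.fst.fst.prodMk measurable_fst.snd).prodMk
      measurable_snd)).indicator (measurableSet_lt measurable_snd measurable_fst.fst.snd)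
  convert (h.stronglyMeasurable.integral_prod_right' (ν := timeMeasure)).measurable using 1
  ext q
  rw [headFunctional, ← integral_indicator measurableSet_Iio]
  rfl

theorem integrable_of_absTail (hf : Measurable fun p : ℝ≥0 × E => f p.1 p.2) {t : ℝ≥0}
    {w : CadlagPath E} (h : absTail f t w < ∞) :
    Integrable (fun s => f (t + s) (w.1 s)) timeMeasure :=
  ⟨((measurable_integrand hf).comp (measurable_prodMk_left (x := (t, w)))).aestronglyMeasurable, h⟩

theorem head_add_tail (hf : Measurable fun p : ℝ≥0 × E => f p.1 p.2) {t : ℝ≥0}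
    {w : CadlagPath E} (h : absTail f t w < ∞) (u : ℝ≥0) :
    headFunctional f t u w + tailFunctional f (t + u) (shift u w) = tailFunctional f t w := by
  have hi := integrable_of_absTail hf h
  have e : tailFunctional f (t + u) (shift u w) = ∫ s in Ici u, f (t + s) (w.1 s) ∂timeMeasure := by
    rw [integral_Ici_timeMeasure]; simp [tailFunctional, add_assoc]
  rw [e, headFunctional, tailFunctional, ← compl_Iio, integral_add_compl measurableSet_Iio hi]

theorem headFunctional_add (hf : Measurable fun p : ℝ≥0 × E => f p.1 p.2) {t : ℝ≥0}
    {w : CadlagPath E} (h : absTail f t w < ∞) (u v : ℝ≥0) :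
    headFunctional f t (u + v) w =
      headFunctional f t u w + headFunctional f (t + u) v (shift u w) := by
  have h1 := head_add_tail hf h u
  have h2 := head_add_tail hf h (u + v)
  have h3 := head_add_tail hf ((absTail_shift_le f t u w).trans_lt h) v
  have h4 : shift v (shift u w) = shift (u + v) w := by ext s; simp [add_assoc]
  rw [h4, add_assoc] at h3
  linarith

end Functionals

/-! ### The martingale closed by the additive functional -/

namespace FellerProcess

open CadlagPath

section Martingale

variable {E : Type*} [TopologicalSpace E] [MeasurableSpace E] [OpensMeasurableSpace E]

/-- Condition (a) of regularity. -/
structure IsIntegrableFamily (X : FellerProcess E) (f : ℝ≥0 → E → ℝ) : Prop where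
  measurable : Measurable fun p : ℝ≥0 × E => f p.1 p.2
  lintegral_lt_top : ∀ (x : E) (t : ℝ≥0), ∫⁻ w, absTail f t w ∂(X.law x) < ∞

/-- `𝔼_y ∫_0^∞ f_{t+s}(X_s) ds`. -/
def tailMean (X : FellerProcess E) (f : ℝ≥0 → E → ℝ) (t : ℝ≥0) (y : E) : ℝ :=
  ∫ w, tailFunctional f t w ∂(X.law y)

/-- The conditional expectation of `∫_0^∞ f_{t+s}(X_s) ds` given the path up to time `u`. -/
def closedMart (X : FellerProcess E) (f : ℝ≥0 → E → ℝ) (t u : ℝ≥0) (w : CadlagPath E) : ℝ :=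
  headFunctional f t u w + X.tailMean f (t + u) (w.1 u)

variable {X : FellerProcess E} {f : ℝ≥0 → E → ℝ}

theorem closedMart_stopped (t u : ℝ≥0) (w : CadlagPath E) :
    X.closedMart f t u (stopped u w) = X.closedMart f t u w := by
  rw [closedMart, closedMart, headFunctional_congr f t u (w := w)
    (fun s hs => by simp [min_eq_left hs])]
  simp

theorem closedMart_stopAt {τ : CadlagPath E → ℝ≥0} (hτ : IsStopTime τ) (t : ℝ≥0) (w : CadlagPath E) :
    X.closedMart f t (τ (stopAt τ w)) (stopAt τ w) = X.closedMart f t (τ w) w := by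
  rw [hτ.apply_stopAt]
  exact closedMart_stopped t (τ w) w

theorem enorm_tailMean_le (y : E) (t : ℝ≥0) :
    ‖X.tailMean f t y‖ₑ ≤ ∫⁻ w, absTail f t w ∂(X.law y) :=
  (enorm_integral_le_lintegral_enorm _).trans
    (lintegral_mono fun w => enorm_tailFunctional_le f t w)

end Martingale

section Polish

variable {E : Type*} [TopologicalSpace E] [PolishSpace E] [MeasurableSpace E] [BorelSpace E]
  {X : FellerProcess E} {f : ℝ≥0 → E → ℝ} {τ : CadlagPath E → ℝ≥0}

namespace IsIntegrableFamily

theorem ae_absTail_lt_top (hf : X.IsIntegrableFamily f) (x : E) (t : ℝ≥0) :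
    ∀ᵐ w ∂(X.law x), absTail f t w < ∞ :=
  ae_lt_top ((measurable_absTail hf.measurable).comp measurable_prodMk_left)
    (hf.lintegral_lt_top x t).ne

theorem integrable_tailFunctional (hf : X.IsIntegrableFamily f) (x : E) (t : ℝ≥0) :
    Integrable (tailFunctional f t) (X.law x) :=
  ⟨((measurable_tailFunctional hf.measurable).comp measurable_prodMk_left).aestronglyMeasurable,
    (lintegral_mono fun w => enorm_tailFunctional_le f t w).trans_lt (hf.lintegral_lt_top x t)⟩

theorem measurable_tailMean (hf : X.IsIntegrableFamily f) :
    Measurable fun q : ℝ≥0 × E => X.tailMean f q.1 q.2 := by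
  have h : Measurable fun q : (ℝ≥0 × E) × CadlagPath E => tailFunctional f q.1.1 q.2 :=
    (measurable_tailFunctional hf.measurable).comp (measurable_fst.fst.prodMk measurable_snd)
  exact (StronglyMeasurable.integral_kernel_prod_right' (κ := X.law.comap Prod.snd measurable_snd)
    h.stronglyMeasurable).measurable

theorem measurable_closedMart_uncurry (hf : X.IsIntegrableFamily f) :
    Measurable fun q : (ℝ≥0 × ℝ≥0) × CadlagPath E => X.closedMart f q.1.1 q.1.2 q.2 :=
  (measurable_headFunctional hf.measurable).add
    (hf.measurable_tailMean.comp ((measurable_fst.fst.add measurable_fst.snd).prodMk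
      (measurable_eval_comp measurable_fst.snd measurable_snd)))

theorem measurable_closedMart (hf : X.IsIntegrableFamily f) (t : ℝ≥0) :
    Measurable fun q : ℝ≥0 × CadlagPath E => X.closedMart f t q.1 q.2 :=
  hf.measurable_closedMart_uncurry.comp
    ((measurable_const.prodMk measurable_fst).prodMk measurable_snd)

theorem measurable_closedMart_stopTime (hf : X.IsIntegrableFamily f) (hτ : IsStopTime τ)
    (t : ℝ≥0) : Measurable fun w => X.closedMart f t (τ w) w :=
  (hf.measurable_closedMart t).comp (hτ.measurable.prodMk measurable_id)

theorem lintegral_absTail_shift_eq (hf : X.IsIntegrableFamily f) (hτ : IsStopTime τ) (t : ℝ≥0)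
    (x : E) : ∫⁻ w, absTail f (t + τ w) (shiftAt τ w) ∂(X.law x) =
      ∫⁻ w, (∫⁻ w', absTail f (t + τ w) w' ∂(X.law (w.1 (τ w)))) ∂(X.law x) := by
  have hΨ : Measurable fun p : CadlagPath E × CadlagPath E => absTail f (t + τ p.1) p.2 :=
    (measurable_absTail hf.measurable).comp
      ((measurable_const.add (hτ.measurable.comp measurable_fst)).prodMk measurable_snd)
  simpa only [hτ.apply_stopAt] using X.lintegral_strongMarkov x hτ hΨ

theorem integrable_tailFunctional_shiftAt (hf : X.IsIntegrableFamily f) (hτ : IsStopTime τ)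
    (t : ℝ≥0) (x : E) :
    Integrable (fun w => tailFunctional f (t + τ w) (shiftAt τ w)) (X.law x) := by
  refine ⟨((measurable_tailFunctional hf.measurable).comp ((measurable_const.add
    hτ.measurable).prodMk hτ.measurable_shiftAt)).aestronglyMeasurable, ?_⟩
  refine (lintegral_mono fun w => ?_).trans_lt (hf.lintegral_lt_top x t)
  exact (enorm_tailFunctional_le _ _ _).trans (absTail_shift_le f t (τ w) w)

/-- By the strong Markov property the expected absolute tail, restarted at `τ`, is the mean of the
absolute tail after `τ`, which the full one dominates. -/
theorem integrable_tailMean_stopTime (hf : X.IsIntegrableFamily f) (hτ : IsStopTime τ)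
    (t : ℝ≥0) (x : E) :
    Integrable (fun w => X.tailMean f (t + τ w) (w.1 (τ w))) (X.law x) := by
  refine ⟨(hf.measurable_tailMean.comp ((measurable_const.add hτ.measurable).prodMk
    (measurable_eval_comp hτ.measurable measurable_id))).aestronglyMeasurable, ?_⟩
  calc ∫⁻ w, ‖X.tailMean f (t + τ w) (w.1 (τ w))‖ₑ ∂(X.law x)
      ≤ ∫⁻ w, (∫⁻ w', absTail f (t + τ w) w' ∂(X.law (w.1 (τ w)))) ∂(X.law x) :=
        lintegral_mono fun w => enorm_tailMean_le _ _
    _ = ∫⁻ w, absTail f (t + τ w) (shiftAt τ w) ∂(X.law x) :=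
        (hf.lintegral_absTail_shift_eq hτ t x).symm
    _ ≤ ∫⁻ w, absTail f t w ∂(X.law x) := lintegral_mono fun w => absTail_shift_le f t (τ w) w
    _ < ∞ := hf.lintegral_lt_top x t

theorem setIntegral_tailMean_stopTime (hf : X.IsIntegrableFamily f) (hτ : IsStopTime τ)
    (t : ℝ≥0) (x : E) {A : Set (CadlagPath E)} (hA : MeasurableSet[pastSigma τ] A) :
    ∫ w in A, tailFunctional f (t + τ w) (shiftAt τ w) ∂(X.law x) =
      ∫ w in A, X.tailMean f (t + τ w) (w.1 (τ w)) ∂(X.law x) := by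
  have hΨ : Measurable fun p : CadlagPath E × CadlagPath E => tailFunctional f (t + τ p.1) p.2 :=
    (measurable_tailFunctional hf.measurable).comp
      ((measurable_const.add (hτ.measurable.comp measurable_fst)).prodMk measurable_snd)
  have h := X.setIntegral_strongMarkov x hτ hΨ.stronglyMeasurable
    (by simpa only [hτ.apply_stopAt] using hf.integrable_tailFunctional_shiftAt hτ t x) hA
  simpa only [hτ.apply_stopAt, tailMean] using h

theorem integrable_headFunctional (hf : X.IsIntegrableFamily f) (hτ : IsStopTime τ)
    (t : ℝ≥0) (x : E) : Integrable (fun w => headFunctional f t (τ w) w) (X.law x) := by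
  refine ((hf.integrable_tailFunctional x t).sub
    (hf.integrable_tailFunctional_shiftAt hτ t x)).congr ?_
  filter_upwards [hf.ae_absTail_lt_top x t] with w hw
  rw [Pi.sub_apply, ← head_add_tail hf.measurable hw (τ w)]
  simp [shiftAt]

theorem integrable_closedMart (hf : X.IsIntegrableFamily f) (hτ : IsStopTime τ)
    (t : ℝ≥0) (x : E) : Integrable (fun w => X.closedMart f t (τ w) w) (X.law x) :=
  (hf.integrable_headFunctional hτ t x).add (hf.integrable_tailMean_stopTime hτ t x)

/-- Split the functional at `τ`; over events of the past, the part after `τ` may be replaced by its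
mean under the restarted law. -/
theorem setIntegral_closedMart (hf : X.IsIntegrableFamily f) (hτ : IsStopTime τ)
    (t : ℝ≥0) (x : E) {A : Set (CadlagPath E)} (hA : MeasurableSet[pastSigma τ] A) :
    ∫ w in A, X.closedMart f t (τ w) w ∂(X.law x) = ∫ w in A, tailFunctional f t w ∂(X.law x) := by
  have h1 : ∀ᵐ w ∂((X.law x).restrict A), tailFunctional f t w =
      headFunctional f t (τ w) w + tailFunctional f (t + τ w) (shiftAt τ w) :=
    ae_restrict_of_ae ((hf.ae_absTail_lt_top x t).mono fun w hw =>
      (head_add_tail hf.measurable hw (τ w)).symm)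
  rw [integral_congr_ae h1, integral_add (hf.integrable_headFunctional hτ t x).integrableOn
    (hf.integrable_tailFunctional_shiftAt hτ t x).integrableOn,
    hf.setIntegral_tailMean_stopTime hτ t x hA]
  exact integral_add (hf.integrable_headFunctional hτ t x).integrableOn
    (hf.integrable_tailMean_stopTime hτ t x).integrableOn

/-- Optional stopping obtained directly from the strong Markov property, so no path regularity of
the martingale is needed. -/
theorem closedMart_ae_eq_condExp (hf : X.IsIntegrableFamily f) (hτ : IsStopTime τ)
    (t : ℝ≥0) (x : E) :
    (fun w => X.closedMart f t (τ w) w) =ᵐ[X.law x]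
      (X.law x)[tailFunctional f t | pastSigma τ] := by
  refine ae_eq_condExp_of_forall_setIntegral_eq hτ.pastSigma_le
    (hf.integrable_tailFunctional x t) (fun s _ _ => (hf.integrable_closedMart hτ t x).integrableOn)
    (fun s hs _ => hf.setIntegral_closedMart hτ t x hs) ?_
  exact (IsStopTime.measurable_of_stopAt_eq (hf.measurable_closedMart_stopTime hτ t)
    fun w => closedMart_stopAt hτ t w).stronglyMeasurable.aestronglyMeasurable

/-- The increments of the martingale over an additional time span. -/
theorem closedMart_add (hf : X.IsIntegrableFamily f) {t : ℝ≥0} {w : CadlagPath E}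
    (h : absTail f t w < ∞) (u v : ℝ≥0) :
    X.closedMart f t (u + v) w = X.closedMart f t u w +
      (X.closedMart f (t + u) v (shift u w) - X.tailMean f (t + u) (w.1 u)) := by
  rw [closedMart, closedMart, closedMart, headFunctional_add hf.measurable h]
  simp [add_assoc]

end IsIntegrableFamily

end Polish

end FellerProcess

/-! ### Limits of the martingale along increasing stopping times -/

namespace FellerProcess

open CadlagPath

section Limits

variable {E : Type*} [TopologicalSpace E] [PolishSpace E] [MeasurableSpace E] [BorelSpace E]
  {X : FellerProcess E} {f : ℝ≥0 → E → ℝ}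

theorem tendsto_headFunctional_iSup (hf : Measurable fun p : ℝ≥0 × E => f p.1 p.2) {t : ℝ≥0}
    {w : CadlagPath E} (h : absTail f t w < ∞) {u : ℕ → ℝ≥0} (hu : Monotone u)
    (hb : BddAbove (range u)) :
    Tendsto (fun n => headFunctional f t (u n) w) atTop (𝓝 (headFunctional f t (⨆ n, u n) w)) := by
  have hU : ⋃ n, Iio (u n) = Iio (⨆ n, u n) := by
    ext s
    simp only [mem_iUnion, mem_Iio]
    exact (lt_ciSup_iff hb).symm
  rw [headFunctional, ← hU]
  exact tendsto_setIntegral_of_monotone (fun n => measurableSet_Iio)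
    (fun m n hmn => Iio_subset_Iio (hu hmn)) (integrable_of_absTail hf h).integrableOn

/-- The martingale has no jump at the limit of an increasing sequence of stopping times. -/
theorem IsIntegrableFamily.ae_tendsto_closedMart_iSup (hf : X.IsIntegrableFamily f) (t : ℝ≥0)
    (x : E) {τ : ℕ → CadlagPath E → ℝ≥0} (hτ : ∀ n, IsStopTime (τ n))
    (hm : ∀ w, Monotone fun n => τ n w) (hb : ∀ w, BddAbove (range fun n => τ n w)) :
    ∀ᵐ w ∂(X.law x), Tendsto (fun n => X.closedMart f t (τ n w) w) atTop
      (𝓝 (X.closedMart f t (⨆ n, τ n w) w)) := by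
  let := TopologicalSpace.upgradeIsCompletelyMetrizable E
  set σ : CadlagPath E → ℝ≥0 := fun w => ⨆ n, τ n w with hσdef
  have hσ : IsStopTime σ := IsStopTime.iSup hτ hb
  let ℱ : Filtration ℕ (inferInstance : MeasurableSpace (CadlagPath E)) :=
    { seq := fun n => pastSigma (τ n)
      mono' := fun m n hmn => (hτ m).pastSigma_mono fun w => hm w hmn
      le' := fun n => (hτ n).pastSigma_le }
  have hGle : (⨆ n, ℱ n) ≤ pastSigma σ := iSup_le fun n =>
    (hτ n).pastSigma_mono fun w => le_ciSup (hb w) n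
  have hleG : ∀ n, pastSigma (τ n) ≤ ⨆ n, ℱ n := fun n => le_iSup (fun n => ℱ n) n
  have hex : ∀ w : CadlagPath E, ∃ z, Tendsto (fun n => w.1 (τ n w)) atTop (𝓝 z) := fun w =>
    w.exists_tendsto_of_monotone (hm w) (tendsto_atTop_ciSup (hm w) (hb w))
  choose Z hZ using hex
  have hτG : ∀ n, Measurable[⨆ n, ℱ n] (τ n) := fun n =>
    (IsStopTime.measurable_of_stopAt_eq (hτ n).measurable (hτ n).apply_stopAt).mono (hleG n) le_rfl
  have hXG : ∀ n, Measurable[⨆ n, ℱ n] fun w : CadlagPath E => w.1 (τ n w) := fun n => by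
    refine (IsStopTime.measurable_of_stopAt_eq (τ := τ n)
      (measurable_eval_comp (hτ n).measurable measurable_id) fun w => ?_).mono (hleG n) le_rfl
    rw [(hτ n).apply_stopAt]
    simp [stopAt]
  have hZG : Measurable[⨆ n, ℱ n] Z :=
    @measurable_of_tendsto_metrizable _ _ (⨆ n, ℱ n) _ _ _ _ _ _ hXG (tendsto_pi_nhds.2 hZ)
  have hσG : Measurable[⨆ n, ℱ n] σ := Measurable.iSup hτG
  have hHG : ∀ n, Measurable[⨆ n, ℱ n] fun w => headFunctional f t (τ n w) w := fun n => by
    refine (IsStopTime.measurable_of_stopAt_eq (τ := τ n)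
      ((measurable_headFunctional hf.measurable).comp
        ((measurable_const.prodMk (hτ n).measurable).prodMk measurable_id)) fun w => ?_).mono
      (hleG n) le_rfl
    rw [Function.comp_apply, Function.comp_apply, (hτ n).apply_stopAt]
    exact headFunctional_congr f t _ fun s hs => by simp [stopAt, min_eq_left hs]
  have hHlim : ∀ᵐ w ∂(X.law x), Tendsto (fun n => headFunctional f t (τ n w) w) atTop
      (𝓝 (headFunctional f t (σ w) w)) :=
    (hf.ae_absTail_lt_top x t).mono fun w hw =>
      tendsto_headFunctional_iSup hf.measurable hw (hm w) (hb w)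
  have hHm : AEStronglyMeasurable[⨆ n, ℱ n] (fun w => headFunctional f t (σ w) w) (X.law x) :=
    ⟨fun w => liminf (fun n => headFunctional f t (τ n w) w) atTop,
      (Measurable.liminf hHG).stronglyMeasurable, hHlim.mono fun w hw => hw.liminf_eq.symm⟩
  -- `tailMean` need not be continuous in the state, so this term cannot be treated as a limit of
  -- its values at `τ n`. By quasi-left-continuity the state at `σ` is almost surely `Z`, which is
  -- measurable for the joined past.
  have hVm : AEStronglyMeasurable[⨆ n, ℱ n] (fun w => X.tailMean f (t + σ w) (w.1 (σ w)))
      (X.law x) := by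
    refine ⟨fun w => X.tailMean f (t + σ w) (Z w), Measurable.stronglyMeasurable ?_, ?_⟩
    · exact hf.measurable_tailMean.comp
        (Measurable.prodMk ((measurable_const_add t).comp hσG) hZG)
    · filter_upwards [X.ae_tendsto_eval_iSup x hτ hm hb] with w hw
      rw [tendsto_nhds_unique (hZ w) hw]
  have hMm : AEStronglyMeasurable[⨆ n, ℱ n] (fun w => X.closedMart f t (σ w) w) (X.law x) :=
    hHm.add hVm
  -- Tower property: the value at `σ` is the conditional expectation given the past of `σ`, and up
  -- to a null set it is already measurable for the smaller joined past.
  have hcond : (X.law x)[tailFunctional f t | ⨆ n, ℱ n] =ᵐ[X.law x]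
      fun w => X.closedMart f t (σ w) w := by
    refine (condExp_condExp_of_le hGle hσ.pastSigma_le).symm.trans ?_
    refine (condExp_congr_ae (hf.closedMart_ae_eq_condExp hσ t x).symm).trans ?_
    exact condExp_of_aestronglyMeasurable' (hGle.trans hσ.pastSigma_le) hMm
      (hf.integrable_closedMart hσ t x)
  -- Lévy's upward theorem.
  have hlevy := tendsto_ae_condExp (μ := X.law x) (ℱ := ℱ) (tailFunctional f t)
  have hall : ∀ᵐ w ∂(X.law x), ∀ n, X.closedMart f t (τ n w) w =
      ((X.law x)[tailFunctional f t | ℱ n]) w :=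
    ae_all_iff.2 fun n => hf.closedMart_ae_eq_condExp (hτ n) t x
  filter_upwards [hlevy, hall, hcond] with w h1 h2 h3
  simp only [h2]
  exact h3 ▸ h1

end Limits

end FellerProcess

/-! ### Lipschitz estimates by the generalized coupling time -/

theorem ofReal_integral_le_lintegral_ofReal {α : Type*} [MeasurableSpace α] {μ : Measure α}
    {g : α → ℝ} (hg : Integrable g μ) :
    ENNReal.ofReal (∫ a, g a ∂μ) ≤ ∫⁻ a, ENNReal.ofReal (g a) ∂μ := by
  refine (ENNReal.ofReal_le_ofReal ?_).trans ENNReal.ofReal_toReal_le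
  rw [integral_eq_lintegral_pos_part_sub_lintegral_neg_part hg]
  exact sub_le_self _ ENNReal.toReal_nonneg

/-- The supremum of the Lipschitz seminorms from time `t` on. -/
def lipSup {E : Type*} (ρ : E → E → ℝ≥0∞) (f : ℝ≥0 → E → ℝ) (t : ℝ≥0) : ℝ≥0∞ :=
  ⨆ s ≥ t, lipNorm ρ (f s)

section LipSup

variable {E : Type*} {ρ : E → E → ℝ≥0∞} {f : ℝ≥0 → E → ℝ}

theorem lipSup_antitone : Antitone (lipSup ρ f) := fun _ _ hst =>
  biSup_mono fun _ hu => hst.trans hu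

theorem lipSup_le (t : ℝ≥0) : lipSup ρ f t ≤ ⨆ s, lipNorm ρ (f s) :=
  iSup_mono fun _ => iSup_le fun _ => le_rfl

/-- Powers are monotone and continuous, hence commute with suprema; `k ≠ 0` keeps suprema over the
empty index set equal to 0. -/
theorem lipSup_pow_le {k : ℕ} (hk : k ≠ 0) (t : ℝ≥0) :
    lipSup ρ f t ^ k ≤ ⨆ s ≥ t, lipNorm ρ (f s) ^ k := by
  have hc : Continuous fun a : ℝ≥0∞ => a ^ k := ENNReal.continuous_pow k
  have hm : Monotone fun a : ℝ≥0∞ => a ^ k := fun a b h => pow_le_pow_left' h k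
  have h0 : (⊥ : ℝ≥0∞) ^ k = ⊥ := by simp [hk]
  rw [lipSup, hm.map_iSup_of_continuousAt hc.continuousAt h0]
  refine iSup_mono fun s => ?_
  rw [hm.map_iSup_of_continuousAt hc.continuousAt h0]

theorem ofReal_sub_le_of_lipNorm_lt {g : E → ℝ} {r : ℝ≥0} (h : lipNorm ρ g < r) (x y : E) :
    ENNReal.ofReal (g x - g y) ≤ r * ρ x y := by
  obtain ⟨r', h1⟩ := iInf_lt_iff.1 h
  obtain ⟨h2, h3⟩ := iInf_lt_iff.1 h1
  exact (h2 x y).trans (by gcongr)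

end LipSup

/-- Write both expectations as integrals over the coupling and use the Lipschitz bound pointwise. As
`r` is finite, it leaves the integral without measurability of `ρ`. -/
theorem ofReal_integral_sub_le_lintegral_coupling {E : Type*} [MeasurableSpace E]
    {ρ : E → E → ℝ≥0∞} {μ₁ μ₂ : Measure E} {g : E → ℝ}
    (h₁ : Integrable g μ₁) (h₂ : Integrable g μ₂) {π : Measure (E × E)}
    (hπ₁ : π.map Prod.fst = μ₁) (hπ₂ : π.map Prod.snd = μ₂) {r : ℝ≥0}
    (hr : ∀ x y, ENNReal.ofReal (g x - g y) ≤ r * ρ x y) :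
    ENNReal.ofReal (∫ x, g x ∂μ₁ - ∫ x, g x ∂μ₂) ≤ r * ∫⁻ p, ρ p.1 p.2 ∂π := by
  subst hπ₁ hπ₂
  have i₁ : Integrable (fun p : E × E => g p.1) π := h₁.comp_measurable measurable_fst
  have i₂ : Integrable (fun p : E × E => g p.2) π := h₂.comp_measurable measurable_snd
  rw [integral_map measurable_fst.aemeasurable h₁.1, integral_map measurable_snd.aemeasurable h₂.1,
    ← integral_sub i₁ i₂]
  refine (ofReal_integral_le_lintegral_ofReal (i₁.sub i₂)).trans ?_
  rw [← lintegral_const_mul' _ _ ENNReal.coe_ne_top]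
  exact lintegral_mono fun p => hr p.1 p.2

namespace FellerProcess

open CadlagPath

section Coupling

variable {E : Type*} [TopologicalSpace E] [MeasurableSpace E] [OpensMeasurableSpace E]
  {X : FellerProcess E} {ρ : E → E → ℝ≥0∞}

/-- The diagonal coupling has cost zero. -/
theorem couplingDist_self (hρ : IsSemimetric ρ) (t : ℝ≥0) (x : E) :
    X.couplingDist ρ t x x = 0 := by
  have hd : Measurable fun y : E => (y, y) := measurable_id.prodMk measurable_id
  refine le_antisymm ?_ zero_le
  refine (iInf₂_le_of_le ((X.transition t x).map fun y => (y, y)) ?_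
    (iInf_le_of_le ?_ (lintegral_map_le _ _))).trans_eq ?_
  · rw [Measure.map_map measurable_fst hd]; exact Measure.map_id
  · rw [Measure.map_map measurable_snd hd]; exact Measure.map_id
  · simp [hρ.self]

theorem couplingTime_self (hρ : IsSemimetric ρ) (x : E) : X.couplingTime ρ x x = 0 := by
  simp [couplingTime, couplingDist_self hρ]

/-- Dividing by `r` leaves the bare infimum over couplings on the right, so each coupling can be
treated separately. Symmetry of `ρ` handles both signs. -/
theorem enorm_integral_transition_sub_le (hρ : IsSemimetric ρ) {g : E → ℝ} {t : ℝ≥0} {x y : E}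
    (hx : Integrable g (X.transition t x)) (hy : Integrable g (X.transition t y)) {r : ℝ≥0}
    (hr0 : r ≠ 0) (hr : ∀ x y, ENNReal.ofReal (g x - g y) ≤ r * ρ x y) :
    ‖∫ z, g z ∂(X.transition t x) - ∫ z, g z ∂(X.transition t y)‖ₑ ≤
      r * X.couplingDist ρ t x y := by
  have hr' : ∀ x y, ENNReal.ofReal (-g x - -g y) ≤ r * ρ x y := fun x y => by
    rw [hρ.symm]
    convert hr y x using 2
    ring
  rw [mul_comm, ← ENNReal.div_le_iff (by exact_mod_cast hr0) ENNReal.coe_ne_top]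
  refine le_iInf fun π => le_iInf fun h1 => le_iInf fun h2 => ?_
  refine ENNReal.div_le_of_le_mul' ?_
  rw [Real.enorm_eq_ofReal_abs]
  rcases abs_cases (∫ z, g z ∂(X.transition t x) - ∫ z, g z ∂(X.transition t y)) with h | h
  · rw [h.1]
    exact ofReal_integral_sub_le_lintegral_coupling hx hy h1 h2 hr
  · rw [h.1]
    have := ofReal_integral_sub_le_lintegral_coupling hx.neg hy.neg h1 h2 hr'
    convert this using 2
    simp only [Pi.neg_apply, integral_neg]
    ring

end Coupling

section Polish

variable {E : Type*} [TopologicalSpace E] [PolishSpace E] [MeasurableSpace E] [BorelSpace E]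
  {X : FellerProcess E} {f : ℝ≥0 → E → ℝ} {ρ : E → E → ℝ≥0∞}

namespace IsIntegrableFamily

theorem integrable_prod (hf : X.IsIntegrableFamily f) (x : E) (t : ℝ≥0) :
    Integrable (fun p : CadlagPath E × ℝ≥0 => f (t + p.2) (p.1.1 p.2))
      ((X.law x).prod timeMeasure) := by
  have hm : Measurable fun p : CadlagPath E × ℝ≥0 => f (t + p.2) (p.1.1 p.2) :=
    (measurable_integrand hf.measurable).comp
      ((measurable_const.prodMk measurable_fst).prodMk measurable_snd)
  refine ⟨hm.aestronglyMeasurable, ?_⟩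
  rw [HasFiniteIntegral, lintegral_prod _ hm.enorm.aemeasurable]
  exact hf.lintegral_lt_top x t

theorem tailMean_eq_integral (hf : X.IsIntegrableFamily f) (x : E) (t : ℝ≥0) :
    X.tailMean f t x = ∫ u, (∫ w, f (t + u) (w.1 u) ∂(X.law x)) ∂timeMeasure :=
  integral_integral_swap (f := fun (w : CadlagPath E) (u : ℝ≥0) => f (t + u) (w.1 u))
    (hf.integrable_prod x t)

/-- The expectations of the additive functional are Lipschitz continuous with respect to the
generalized coupling time. -/
theorem enorm_tailMean_sub_le (hf : X.IsIntegrableFamily f) (hρ : IsSemimetric ρ) {t : ℝ≥0}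
    (hL : lipSup ρ f t < ∞) {x y : E} (hh : X.couplingTime ρ x y < ∞) :
    ‖X.tailMean f t x - X.tailMean f t y‖ₑ ≤ lipSup ρ f t * X.couplingTime ρ x y := by
  -- The infimum defining `lipNorm` need not be attained, so a strictly larger constant is used
  -- first and then decreased, which is legitimate because the coupling time is finite.
  have hmain : ∀ r : ℝ≥0, lipSup ρ f t < r →
      ‖X.tailMean f t x - X.tailMean f t y‖ₑ ≤ r * X.couplingTime ρ x y := by
    intro r hr
    have hr0 : r ≠ 0 := by
      rintro rfl
      simp at hr
    have hix := hf.integrable_prod x t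
    have hiy := hf.integrable_prod y t
    rw [hf.tailMean_eq_integral x t, hf.tailMean_eq_integral y t,
      ← integral_sub hix.integral_prod_right hiy.integral_prod_right]
    refine (enorm_integral_le_lintegral_enorm _).trans ?_
    rw [couplingTime, ← lintegral_const_mul' _ _ ENNReal.coe_ne_top]
    refine lintegral_mono_ae ?_
    filter_upwards [hix.prod_left_ae, hiy.prod_left_ae] with u hux huy
    have hfm : Measurable (f (t + u)) := hf.measurable.comp measurable_prodMk_left
    have key : ∀ z, Integrable (fun w : CadlagPath E => f (t + u) (w.1 u)) (X.law z) →
        Integrable (f (t + u)) (X.transition u z) := fun z hz =>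
      (integrable_map_measure hfm.aestronglyMeasurable (measurable_eval u).aemeasurable).2 hz
    have key2 : ∀ z, ∫ w, f (t + u) (w.1 u) ∂(X.law z) = ∫ a, f (t + u) a ∂(X.transition u z) :=
      fun z => (integral_map (measurable_eval u).aemeasurable hfm.aestronglyMeasurable).symm
    rw [key2, key2]
    refine enorm_integral_transition_sub_le hρ (key x hux) (key y huy) hr0
      (ofReal_sub_le_of_lipNorm_lt (lt_of_le_of_lt ?_ hr))
    exact le_iSup₂ (f := fun s (_ : s ≥ t) => lipNorm ρ (f s)) (t + u) le_self_add
  have hne : (𝓝[>] (lipSup ρ f t)).NeBot := nhdsGT_neBot_of_exists_gt ⟨∞, hL⟩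
  have hlim : Tendsto (fun r : ℝ≥0∞ => r * X.couplingTime ρ x y) (𝓝[>] (lipSup ρ f t))
      (𝓝 (lipSup ρ f t * X.couplingTime ρ x y)) :=
    (ENNReal.Tendsto.mul_const tendsto_id (Or.inr hh.ne)).mono_left nhdsWithin_le_nhds
  refine ge_of_tendsto hlim ?_
  filter_upwards [self_mem_nhdsWithin, mem_nhdsWithin_of_mem_nhds (Iio_mem_nhds hL)] with r h1 h2
  lift r to ℝ≥0 using (ne_of_lt h2)
  exact hmain r h1

end IsIntegrableFamily

end Polish

end FellerProcess

/-! ### The exponential function, continued linearly -/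

section TruncExp

open Real in
theorem exp_sub_one_sub_self_le_sq {z : ℝ} : exp z - 1 - z ≤ exp (max z 0) * z ^ 2 := by
  have h1 : exp z - 1 ≤ z * exp z := by
    have h := add_one_le_exp (-z)
    have h2 : exp (-z) * exp z = 1 := by rw [← exp_add]; simp
    nlinarith [exp_pos z]
  rcases le_total 0 z with hz | hz
  · rw [max_eq_left hz]
    nlinarith [mul_le_mul_of_nonneg_left h1 hz]
  · rw [max_eq_right hz, exp_zero, one_mul]
    have h2 := add_one_le_exp z
    nlinarith

open Real in
-- For `z ≤ 0` this amounts to -z ≤ sinh(-z).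
theorem exp_sub_one_sub_self_le_abs (z : ℝ) : exp z - 1 - z ≤ exp |z| - 1 - |z| := by
  rcases le_total 0 z with hz | hz
  · rw [abs_of_nonneg hz]
  · rw [abs_of_nonpos hz]
    have h := self_le_sinh_iff.2 (neg_nonneg.2 hz)
    rw [sinh_eq, neg_neg] at h
    linarith

open Real in
theorem exp_sub_one_sub_self_mono {a b : ℝ} (ha : 0 ≤ a) (hab : a ≤ b) :
    exp a - 1 - a ≤ exp b - 1 - b := by
  have h1 : exp b = exp a * exp (b - a) := by rw [← exp_add]; ring_nf
  have h2 := add_one_le_exp (b - a)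
  have h3 := one_le_exp ha
  rw [h1]
  nlinarith

/-- The exponential function up to `N`, continued by its tangent at `N`. -/
def truncExp (N m : ℝ) : ℝ := if m ≤ N then Real.exp m else Real.exp N * (1 + (m - N))

theorem truncExp_of_le {N m : ℝ} (h : m ≤ N) : truncExp N m = Real.exp m := if_pos h

theorem truncExp_of_gt {N m : ℝ} (h : N < m) : truncExp N m = Real.exp N * (1 + (m - N)) :=
  if_neg h.not_ge

theorem truncExp_pos (N m : ℝ) : 0 < truncExp N m := by
  rcases le_or_gt m N with h | h
  · rw [truncExp_of_le h]; positivity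
  · rw [truncExp_of_gt h]
    have : 0 < 1 + (m - N) := by linarith
    positivity

theorem continuous_truncExp (N : ℝ) : Continuous (truncExp N) := by
  refine Continuous.if_le (by fun_prop) (by fun_prop) continuous_id continuous_const ?_
  rintro m rfl
  simp

/-- The second order remainder of the continued exponential function. -/
theorem truncExp_remainder_le (N m : ℝ) : ∃ c : ℝ, 0 ≤ c ∧ ∀ z : ℝ,
    truncExp N (m + z) ≤ truncExp N m + Real.exp (min m N) * z +
      truncExp N m * min (Real.exp |z| - 1 - |z|) (c * z ^ 2) := by
  have hz2 : ∀ z : ℝ, 0 ≤ z ^ 2 := fun z => sq_nonneg z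
  rcases le_or_gt m N with hm | hm
  · refine ⟨Real.exp (N - m), (Real.exp_pos _).le, fun z => ?_⟩
    have hc : (1 : ℝ) ≤ Real.exp (N - m) := Real.one_le_exp (by linarith)
    rw [truncExp_of_le hm, min_eq_left hm]
    suffices h : truncExp N (m + z) ≤ Real.exp m * (1 + z) + Real.exp m *
        min (Real.exp |z| - 1 - |z|) (Real.exp (N - m) * z ^ 2) by linarith
    rw [← mul_add]
    rcases le_or_gt (m + z) N with h | h
    · rw [truncExp_of_le h, Real.exp_add]
      gcongr
      have h1 := exp_sub_one_sub_self_le_abs z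
      have h2 : Real.exp z - 1 - z ≤ Real.exp (N - m) * z ^ 2 := by
        refine exp_sub_one_sub_self_le_sq.trans ?_
        gcongr
        exact max_le (by linarith) (by linarith)
      have := le_min h1 h2
      linarith
    · rw [truncExp_of_gt h]
      set a := N - m with ha
      have ha0 : 0 ≤ a := by linarith
      have hza : a < z := by linarith
      have hN : Real.exp N = Real.exp m * Real.exp a := by rw [← Real.exp_add]; congr 1; ring
      rw [hN, mul_assoc]
      gcongr
      have e : m + z - N = z - a := by linarith
      rw [e, abs_of_nonneg (ha0.trans hza.le)]
      have h1 : Real.exp a * (1 + (z - a)) ≤ Real.exp z := by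
        have : Real.exp z = Real.exp a * Real.exp (z - a) := by rw [← Real.exp_add]; ring_nf
        rw [this]
        gcongr
        linarith [Real.add_one_le_exp (z - a)]
      have h2 : Real.exp a * (1 + (z - a)) - 1 - z ≤ Real.exp a * z ^ 2 := by
        have h3 : Real.exp a - 1 - a ≤ Real.exp a * a ^ 2 := by
          have := exp_sub_one_sub_self_le_sq (z := a)
          rwa [max_eq_left ha0] at this
        have h4 : Real.exp a - 1 ≤ a * Real.exp a := by
          have h := Real.add_one_le_exp (-a)
          have h2 : Real.exp (-a) * Real.exp a = 1 := by rw [← Real.exp_add]; simp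
          nlinarith [Real.exp_pos a]
        have h5 : (Real.exp a - 1) * (z - a) ≤ a * Real.exp a * (z - a) :=
          mul_le_mul_of_nonneg_right h4 (by linarith)
        have h6 : Real.exp a * (a ^ 2 + a * (z - a)) ≤ Real.exp a * z ^ 2 := by
          gcongr
          nlinarith
        nlinarith
      have := le_min (show Real.exp a * (1 + (z - a)) - 1 - z ≤ Real.exp z - 1 - z by linarith) h2
      linarith
  · refine ⟨1, zero_le_one, fun z => ?_⟩
    rw [truncExp_of_gt hm, min_eq_right hm.le]
    have h1m : (1 : ℝ) ≤ 1 + (m - N) := by linarith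
    have hφ : 0 ≤ Real.exp |z| - 1 - |z| := by linarith [Real.add_one_le_exp |z|]
    have hmin : 0 ≤ min (Real.exp |z| - 1 - |z|) (1 * z ^ 2) := le_min hφ (by positivity)
    rcases le_or_gt (m + z) N with h | h
    · rw [truncExp_of_le h]
      set v := m + z - N with hv
      have hv0 : v ≤ 0 := by linarith
      have hvz : |v| ≤ |z| := by
        rw [abs_of_nonpos hv0, abs_of_nonpos (by linarith)]; linarith
      have e : Real.exp (m + z) = Real.exp N * Real.exp v := by
        rw [← Real.exp_add]; congr 1; linarith
      have h1 : Real.exp v - 1 - v ≤ Real.exp |z| - 1 - |z| :=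
        (exp_sub_one_sub_self_le_abs v).trans (exp_sub_one_sub_self_mono (abs_nonneg _) hvz)
      have h2 : Real.exp v - 1 - v ≤ 1 * z ^ 2 := by
        have := exp_sub_one_sub_self_le_sq (z := v)
        rw [max_eq_right hv0, Real.exp_zero, one_mul] at this
        rw [one_mul]
        exact this.trans (sq_le_sq.2 hvz)
      have h3 := le_min h1 h2
      rw [e]
      have h4 : Real.exp N * (1 + (m - N)) * min (Real.exp |z| - 1 - |z|) (1 * z ^ 2) ≥
          Real.exp N * min (Real.exp |z| - 1 - |z|) (1 * z ^ 2) := by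
        rw [mul_assoc]
        gcongr
        nlinarith
      have h5 := mul_le_mul_of_nonneg_left h3 (Real.exp_pos N).le
      have h6 : Real.exp N * Real.exp v = Real.exp N * (1 + (m - N)) + Real.exp N * z +
        Real.exp N * (Real.exp v - 1 - v) := by rw [hv]; ring
      linarith
    · rw [truncExp_of_gt h]
      have : 0 ≤ Real.exp N * (1 + (m - N)) *
          min (Real.exp |z| - 1 - |z|) (1 * z ^ 2) := by positivity
      nlinarith

/-- Compare the tails termwise: (n+K+2)! ≥ (n+K)! and `z ≤ Z` leave z² times the tail of the series
at `Z`, which is uniform over bounded `z`. -/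
theorem exp_sub_taylor_le {z Z : ℝ} (hz : 0 ≤ z) (hZ : z ≤ Z) (K : ℕ) :
    Real.exp z - 1 - z ≤ ∑ k ∈ Finset.range K, z ^ (k + 2) / (k + 2).factorial +
      z ^ 2 * (Real.exp Z - ∑ k ∈ Finset.range K, Z ^ k / k.factorial) := by
  have hs : ∀ x : ℝ, HasSum (fun n : ℕ => x ^ n / n.factorial) (Real.exp x) := fun x => by
    rw [Real.exp_eq_exp_ℝ]; exact NormedSpace.expSeries_div_hasSum_exp x
  have h1 := (hasSum_nat_add_iff' (K + 2)).2 (hs z)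
  have h2 := ((hasSum_nat_add_iff' K).2 (hs Z)).mul_left (z ^ 2)
  have h3 := hasSum_le (fun n => ?_) h1 h2
  · rw [Finset.sum_range_succ', Finset.sum_range_succ'] at h3
    simp only [zero_add, pow_one, Nat.factorial_one, Nat.cast_one, div_one, pow_zero,
      Nat.factorial_zero] at h3
    have e : ∑ k ∈ Finset.range K, z ^ (k + 1 + 1) / ((k + 1 + 1).factorial : ℝ) =
      ∑ k ∈ Finset.range K, z ^ (k + 2) / ((k + 2).factorial : ℝ) := rfl
    linarith
  · rw [← add_assoc, pow_add, mul_comm (z ^ (n + K)), mul_div_assoc]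
    have h0 : (0 : ℝ) < ((n + K).factorial : ℝ) := by exact_mod_cast (n + K).factorial_pos
    have h4 : ((n + K).factorial : ℝ) ≤ ((n + K + 2).factorial : ℝ) := by
      exact_mod_cast Nat.factorial_le (by omega)
    gcongr
    exact pow_nonneg (hz.trans hZ) _

/-- Up to 6c the Taylor tail of the exponential is uniformly below θ z². Beyond 6c one has c z² ≤
z³/6, which is itself a Taylor term. -/
theorem min_le_taylor (c θ : ℝ) (hθ : 0 < θ) : ∃ K : ℕ, ∀ z : ℝ, 0 ≤ z →
    min (Real.exp z - 1 - z) (c * z ^ 2) ≤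
      ∑ k ∈ Finset.range K, z ^ (k + 2) / (k + 2).factorial + θ * z ^ 2 := by
  have hs : HasSum (fun n : ℕ => (6 * c) ^ n / n.factorial) (Real.exp (6 * c)) := by
    rw [Real.exp_eq_exp_ℝ]; exact NormedSpace.expSeries_div_hasSum_exp _
  have hev := hs.tendsto_sum_nat.eventually (lt_mem_nhds (sub_lt_self _ hθ))
  -- `K ≥ 2` keeps the cubic term in the sum.
  obtain ⟨K, hK, hK2⟩ := (hev.and (eventually_ge_atTop 2)).exists
  refine ⟨K, fun z hz => ?_⟩
  rcases le_or_gt z (6 * c) with h | h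
  · refine (min_le_left _ _).trans ((exp_sub_taylor_le hz h K).trans ?_)
    have : z ^ 2 * (Real.exp (6 * c) - ∑ k ∈ Finset.range K, (6 * c) ^ k / k.factorial) ≤
        z ^ 2 * θ := by gcongr; linarith
    linarith
  · refine (min_le_right _ _).trans ?_
    have h1 : z ^ (1 + 2) / (1 + 2).factorial ≤
        ∑ k ∈ Finset.range K, z ^ (k + 2) / ((k + 2).factorial : ℝ) :=
      Finset.single_le_sum (f := fun k => z ^ (k + 2) / ((k + 2).factorial : ℝ))
        (fun k _ => by positivity) (Finset.mem_range.2 (by omega))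
    have h2 : c * z ^ 2 ≤ z ^ (1 + 2) / ((1 + 2).factorial : ℝ) := by
      norm_num [Nat.factorial]
      nlinarith [sq_nonneg z]
    have : 0 ≤ θ * z ^ 2 := by positivity
    linarith

/-- The coefficient of `z` is the derivative at `m`; it drops out for centred increments. Since `K`
does not depend on `z`, finitely many moments suffice. -/
theorem truncExp_add_le (N m θ : ℝ) (hθ : 0 < θ) : ∃ K : ℕ, ∀ z : ℝ,
    truncExp N (m + z) ≤ truncExp N m + Real.exp (min m N) * z + truncExp N m *
      (∑ k ∈ Finset.range K, |z| ^ (k + 2) / (k + 2).factorial + θ * |z| ^ 2) := by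
  obtain ⟨c, -, h⟩ := truncExp_remainder_le N m
  obtain ⟨K, hK⟩ := min_le_taylor c θ hθ
  refine ⟨K, fun z => (h z).trans ?_⟩
  have := hK |z| (abs_nonneg z)
  rw [sq_abs] at this ⊢
  gcongr
  exact (truncExp_pos N m).le

end TruncExp

/-! ### Moments of the increments of the martingale over short times -/

/-- Either v ≤ θ u, absorbed by (1 + θ)^k < κ, or u ≤ v/θ. Taking `κ` near 1 keeps the main term
sharp. -/
theorem ENNReal.exists_add_pow_le (k : ℕ) {κ : ℝ} (hκ : 1 < κ) :
    ∃ C : ℝ≥0, ∀ u v : ℝ≥0∞, (u + v) ^ k ≤ ENNReal.ofReal κ * u ^ k + C * v ^ k := by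
  have hc : Tendsto (fun θ : ℝ≥0 => (1 + (θ : ℝ)) ^ k) (𝓝[>] 0) (𝓝 1) := by
    have : Continuous fun θ : ℝ≥0 => (1 + (θ : ℝ)) ^ k := by fun_prop
    simpa using (this.tendsto 0).mono_left nhdsWithin_le_nhds
  obtain ⟨θ, h1, h2⟩ := ((hc.eventually (gt_mem_nhds hκ)).and self_mem_nhdsWithin).exists
  have hθ : θ ≠ 0 := ne_of_gt h2
  refine ⟨(1 + θ⁻¹) ^ k, fun u v => ?_⟩
  rcases le_total v (θ * u) with h | h
  · calc (u + v) ^ k ≤ (u + θ * u) ^ k := by gcongr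
      _ = ((1 + θ : ℝ≥0) : ℝ≥0∞) ^ k * u ^ k := by
        rw [← mul_pow]; push_cast; ring
      _ ≤ ENNReal.ofReal κ * u ^ k := by
        gcongr
        rw [← ENNReal.coe_pow, ← ENNReal.ofReal_coe_nnreal]
        refine ENNReal.ofReal_le_ofReal ?_
        push_cast
        exact h1.le
      _ ≤ _ := le_self_add
  · have hu : u ≤ (θ⁻¹ : ℝ≥0) * v := by
      rw [ENNReal.coe_inv hθ, ← ENNReal.div_eq_inv_mul]
      exact (ENNReal.le_div_iff_mul_le (by simp [hθ]) (by simp)).2 (by rwa [mul_comm])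
    calc (u + v) ^ k ≤ ((θ⁻¹ : ℝ≥0) * v + v) ^ k := by gcongr
      _ = ((1 + θ⁻¹ : ℝ≥0) : ℝ≥0∞) ^ k * v ^ k := by
        rw [← mul_pow]; push_cast; ring
      _ ≤ _ := by push_cast; exact le_add_self

/-- With a finite moment of the supremum, the k-th moment of the integral over [0, ε) is O(ε^k),
negligible against ε for k ≥ 2. -/
theorem enorm_headFunctional_le_iSup {E : Type*} [TopologicalSpace E] {f : ℝ≥0 → E → ℝ}
    {k : ℕ} (hk : k ≠ 0) (t : ℝ≥0) {ε δ : ℝ≥0} (hεδ : ε ≤ δ)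
    (w : CadlagPath E) : ‖headFunctional f t ε w‖ₑ ≤
      ε * (⨆ s ≤ δ, ‖f (t + s) (w.1 s)‖ₑ ^ k) ^ (1 / (k : ℝ)) := by
  have hk' : (k : ℝ) ≠ 0 := by exact_mod_cast hk
  refine (enorm_headFunctional_le f t ε w).trans ?_
  calc ∫⁻ s in Iio ε, ‖f (t + s) (w.1 s)‖ₑ ∂timeMeasure
      ≤ ∫⁻ _ in Iio ε, (⨆ s ≤ δ, ‖f (t + s) (w.1 s)‖ₑ ^ k) ^ (1 / (k : ℝ)) ∂timeMeasure := by
        refine setLIntegral_mono measurable_const fun s hs => ?_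
        rw [one_div, ENNReal.le_rpow_inv_iff (by positivity), ENNReal.rpow_natCast]
        exact le_iSup₂ (f := fun s (_ : s ≤ δ) => ‖f (t + s) (w.1 s)‖ₑ ^ k) s
          ((le_of_lt hs).trans hεδ)
    _ ≤ _ := by
        rw [setLIntegral_const, mul_comm]
        gcongr
        exact timeMeasure_Iio_le ε

namespace FellerProcess

open CadlagPath

section Basic

variable {E : Type*} [TopologicalSpace E] [MeasurableSpace E] [OpensMeasurableSpace E]
  {X : FellerProcess E} {f : ℝ≥0 → E → ℝ} {ρ : E → E → ℝ≥0∞}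

theorem IsRegular.isIntegrableFamily {k : ℕ} (h : X.IsRegular f k) : X.IsIntegrableFamily f :=
  ⟨h.measurable, fun x t => (h.integrable x t).2⟩

theorem couplingTime_pow_eq_ofReal {k : ℕ} {x y : E} (hfin : X.couplingTime ρ x y < ∞) :
    X.couplingTime ρ x y ^ k = ENNReal.ofReal (X.couplingTimePow ρ k y x) := by
  rw [couplingTimePow, ENNReal.ofReal_pow ENNReal.toReal_nonneg, ENNReal.ofReal_toReal hfin.ne]

/-- The function is nonnegative and vanishes at its reference point, so every difference quotient
there is nonnegative. -/
theorem HasGeneratorAt.couplingTimePow_nonneg (hρ : IsSemimetric ρ) {k : ℕ} (hk : k ≠ 0) {y : E}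
    {a : ℝ} (ha : X.HasGeneratorAt (X.couplingTimePow ρ k y) y a) : 0 ≤ a := by
  have h0 : X.couplingTimePow ρ k y y = 0 := by simp [couplingTimePow, couplingTime_self hρ, hk]
  refine ge_of_tendsto ha.2 (Eventually.of_forall fun ε => ?_)
  rw [h0, sub_zero]
  refine div_nonneg (integral_nonneg fun w => ?_) ε.coe_nonneg
  simp only [couplingTimePow, Pi.zero_apply]
  positivity

/-- The moments of the coupling time after a short time. -/
theorem eventually_lintegral_couplingTime_pow_le (hρ : IsSemimetric ρ)
    (hfin : ∀ x y : E, X.couplingTime ρ x y < ∞) {k : ℕ} (hk : k ≠ 0) {y : E} {a : ℝ}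
    (ha : X.HasGeneratorAt (X.couplingTimePow ρ k y) y a) {ζ : ℝ} (hζ : 0 < ζ) :
    ∀ᶠ ε in 𝓝[>] (0 : ℝ≥0),
      AEMeasurable (fun w : CadlagPath E => X.couplingTime ρ (w.1 ε) y ^ k) (X.law y) ∧
      ∫⁻ w, X.couplingTime ρ (w.1 ε) y ^ k ∂(X.law y) ≤ ENNReal.ofReal (ε * (a + ζ)) := by
  have h0 : X.couplingTimePow ρ k y y = 0 := by simp [couplingTimePow, couplingTime_self hρ, hk]
  filter_upwards [ha.1, ha.2.eventually (gt_mem_nhds (lt_add_of_pos_right a hζ)),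
    self_mem_nhdsWithin] with ε h1 h2 h3
  simp only [couplingTime_pow_eq_ofReal (hfin _ _)]
  refine ⟨h1.1.aemeasurable.ennreal_ofReal, ?_⟩
  rw [← ofReal_integral_eq_lintegral_ofReal h1 (Eventually.of_forall fun w => by
    simp only [couplingTimePow, Pi.zero_apply]; positivity)]
  refine ENNReal.ofReal_le_ofReal ?_
  have h3' : (0 : ℝ) < ε := by exact_mod_cast h3
  rw [h0, sub_zero, div_lt_iff₀ h3', mul_comm] at h2
  exact h2.le

end Basic

section Moments

variable {E : Type*} [TopologicalSpace E] [PolishSpace E] [MeasurableSpace E] [BorelSpace E]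
  {X : FellerProcess E} {f : ℝ≥0 → E → ℝ} {ρ : E → E → ℝ≥0∞}

theorem IsIntegrableFamily.enorm_tailMean_add_sub_le (hf : X.IsIntegrableFamily f) (t ε : ℝ≥0)
    (y : E) : ‖X.tailMean f (t + ε) y - X.tailMean f t y‖ₑ ≤
      ∫⁻ w, (∫⁻ s, ‖f (t + ε + s) (w.1 s) - f (t + s) (w.1 s)‖ₑ ∂timeMeasure) ∂(X.law y) := by
  rw [tailMean, tailMean, ← integral_sub (hf.integrable_tailFunctional y (t + ε))
    (hf.integrable_tailFunctional y t)]
  refine (enorm_integral_le_lintegral_enorm _).trans (lintegral_mono_ae ?_)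
  filter_upwards [hf.ae_absTail_lt_top y t, hf.ae_absTail_lt_top y (t + ε)] with w h1 h2
  rw [tailFunctional, tailFunctional, ← integral_sub (integrable_of_absTail hf.measurable h2)
    (integrable_of_absTail hf.measurable h1)]
  exact enorm_integral_le_lintegral_enorm _

/-- The moments of the increments of the martingale are governed by the generator applied to
powers of the coupling time. -/
theorem eventually_lintegral_increment_pow_le (hρ : IsSemimetric ρ)
    (hLip : (⨆ t : ℝ≥0, lipNorm ρ (f t)) < ∞) (hfin : ∀ x y : E, X.couplingTime ρ x y < ∞)
    {k : ℕ} (hk : 2 ≤ k) (hreg : X.IsRegular f k) {y : E} {a : ℝ}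
    (ha : X.HasGeneratorAt (X.couplingTimePow ρ k y) y a) (t : ℝ≥0) {η : ℝ} (hη : 0 < η) :
    ∀ᶠ ε in 𝓝[>] (0 : ℝ≥0),
      ∫⁻ w, ‖X.closedMart f t ε w - X.tailMean f t y‖ₑ ^ k ∂(X.law y) ≤
        ENNReal.ofReal (ε * ((lipSup ρ f (t + ε)).toReal ^ k * a + η)) := by
  have hk0 : k ≠ 0 := by omega
  have hkR : (k : ℝ) ≠ 0 := by exact_mod_cast hk0
  have hf := hreg.isIntegrableFamily
  have ha0 : 0 ≤ a := ha.couplingTimePow_nonneg hρ hk0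
  set L : ℝ := (⨆ t : ℝ≥0, lipNorm ρ (f t)).toReal with hL
  have hL0 : 0 ≤ L := ENNReal.toReal_nonneg
  -- the small parameter
  obtain ⟨ζ, hζ0, hζ1, hζ⟩ : ∃ ζ : ℝ, 0 < ζ ∧ ζ ≤ 1 ∧ ζ * ((a + 2) * L ^ k) ≤ η / 2 := by
    refine ⟨min 1 (η / 2 / ((a + 2) * L ^ k + 1)), by positivity, min_le_left _ _, ?_⟩
    have hD : 0 < (a + 2) * L ^ k + 1 := by positivity
    calc min 1 (η / 2 / ((a + 2) * L ^ k + 1)) * ((a + 2) * L ^ k)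
        ≤ (η / 2 / ((a + 2) * L ^ k + 1)) * ((a + 2) * L ^ k + 1) := by
          gcongr
          · exact min_le_right _ _
          · linarith
      _ = η / 2 := by field_simp
  obtain ⟨C, hC⟩ := ENNReal.exists_add_pow_le k (show (1 : ℝ) < 1 + ζ by linarith)
  obtain ⟨C', hC'⟩ := ENNReal.exists_add_pow_le k (show (1 : ℝ) < 2 by norm_num)
  obtain ⟨r, ε₀, -, hε₀, hr⟩ := hreg.time_increment
  -- the moment of the supremum
  obtain ⟨δ, ⟨hδm, hδ⟩, hδ0⟩ := ((hreg.sup_moment y t).and self_mem_nhdsWithin).exists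
  set S : CadlagPath E → ℝ≥0∞ := fun w => ⨆ s ≤ δ, ‖f (t + s) (w.1 s)‖ₑ ^ k with hS
  set B : ℝ≥0∞ := ∫⁻ w, (ENNReal.ofReal 2 * (r y : ℝ≥0∞) ^ k + C' * S w) ∂(X.law y) with hB
  have hBfin : B < ∞ := by
    rw [hB, lintegral_add_left measurable_const, lintegral_const, lintegral_const_mul' _ _
      ENNReal.coe_ne_top]
    refine ENNReal.add_lt_top.2 ⟨?_, ENNReal.mul_lt_top ENNReal.coe_lt_top hδ⟩
    simp [ENNReal.mul_lt_top_iff]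
  -- The regularity terms contribute C B ε^k = ε (C B ε^(k-1)), and `2 ≤ k` makes the second factor
  -- small.
  have hsmall : ∀ᶠ ε : ℝ≥0 in 𝓝[>] (0 : ℝ≥0), (C : ℝ) * B.toReal * (ε : ℝ) ^ (k - 1) ≤ η / 2 := by
    have hc : Continuous fun ε : ℝ≥0 => (C : ℝ) * B.toReal * (ε : ℝ) ^ (k - 1) := by fun_prop
    have := (hc.tendsto 0).mono_left (nhdsWithin_le_nhds (s := Ioi 0))
    rw [NNReal.coe_zero, zero_pow (by omega), mul_zero] at this
    exact (this.eventually (gt_mem_nhds (half_pos hη))).mono fun _ h => le_of_lt h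
  filter_upwards [hsmall, eventually_lintegral_couplingTime_pow_le hρ hfin hk0 ha hζ0,
    self_mem_nhdsWithin, mem_nhdsWithin_of_mem_nhds (Iio_mem_nhds hε₀),
    mem_nhdsWithin_of_mem_nhds (Iio_mem_nhds hδ0)] with ε h1 h2 h3 h4 h5
  set Lε : ℝ≥0∞ := lipSup ρ f (t + ε) with hLε
  have hLεfin : Lε < ∞ := (lipSup_le _).trans_lt hLip
  have hLεL : Lε.toReal ≤ L := ENNReal.toReal_mono hLip.ne (lipSup_le _)
  -- Pass through V_{t+ε}(y): the change of state is bounded by the coupling time, the change of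
  -- time by ε r(y), and the elapsed integral by the supremum.
  have hpt : ∀ w, ‖X.closedMart f t ε w - X.tailMean f t y‖ₑ ≤
      Lε * X.couplingTime ρ (w.1 ε) y + ε * (r y + S w ^ (1 / (k : ℝ))) := by
    intro w
    have e : X.closedMart f t ε w - X.tailMean f t y =
        (X.tailMean f (t + ε) (w.1 ε) - X.tailMean f (t + ε) y) +
        ((X.tailMean f (t + ε) y - X.tailMean f t y) + headFunctional f t ε w) := by
      rw [closedMart]; ring
    rw [e]
    refine (enorm_add_le _ _).trans (add_le_add
      (hf.enorm_tailMean_sub_le hρ hLεfin (hfin _ _)) ((enorm_add_le _ _).trans ?_))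
    rw [mul_add]
    refine add_le_add ((hf.enorm_tailMean_add_sub_le t ε y).trans ?_)
      (enorm_headFunctional_le_iSup hk0 t (le_of_lt h5) w)
    exact (le_iSup (fun t : ℝ≥0 => ∫⁻ w, (∫⁻ s, ‖f (t + ε + s) (w.1 s) - f (t + s) (w.1 s)‖ₑ
      ∂timeMeasure) ∂(X.law y)) t).trans (hr ε h3 h4 y).1
  have hpt2 : ∀ w, ‖X.closedMart f t ε w - X.tailMean f t y‖ₑ ^ k ≤
      ENNReal.ofReal (1 + ζ) * Lε ^ k * X.couplingTime ρ (w.1 ε) y ^ k +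
        C * (ε : ℝ≥0∞) ^ k * (ENNReal.ofReal 2 * (r y : ℝ≥0∞) ^ k + C' * S w) := by
    intro w
    refine (pow_le_pow_left' (hpt w) k).trans ((hC _ _).trans ?_)
    rw [mul_pow, mul_pow, ← mul_assoc, ← mul_assoc]
    gcongr
    refine (hC' _ _).trans_eq ?_
    rw [← ENNReal.rpow_natCast (S w ^ (1 / (k : ℝ))), ← ENNReal.rpow_mul, one_div_mul_cancel hkR,
      ENNReal.rpow_one]
  have hcne : ENNReal.ofReal (1 + ζ) * Lε ^ k ≠ ∞ :=
    ENNReal.mul_ne_top ENNReal.ofReal_ne_top (ENNReal.pow_ne_top hLεfin.ne)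
  have hcne2 : C * (ε : ℝ≥0∞) ^ k ≠ ∞ :=
    ENNReal.mul_ne_top ENNReal.coe_ne_top (ENNReal.pow_ne_top ENNReal.coe_ne_top)
  have hε0 : (0 : ℝ) ≤ ε := ε.coe_nonneg
  calc ∫⁻ w, ‖X.closedMart f t ε w - X.tailMean f t y‖ₑ ^ k ∂(X.law y)
      ≤ ∫⁻ w, (ENNReal.ofReal (1 + ζ) * Lε ^ k * X.couplingTime ρ (w.1 ε) y ^ k +
        C * (ε : ℝ≥0∞) ^ k * (ENNReal.ofReal 2 * (r y : ℝ≥0∞) ^ k + C' * S w)) ∂(X.law y) :=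
        lintegral_mono hpt2
    _ = ENNReal.ofReal (1 + ζ) * Lε ^ k * ∫⁻ w, X.couplingTime ρ (w.1 ε) y ^ k ∂(X.law y) +
        C * (ε : ℝ≥0∞) ^ k * B := by
        rw [lintegral_add_left' (h2.1.const_mul _), lintegral_const_mul' _ _ hcne,
          lintegral_const_mul' _ _ hcne2]
    _ ≤ ENNReal.ofReal (1 + ζ) * Lε ^ k * ENNReal.ofReal (ε * (a + ζ)) +
        C * (ε : ℝ≥0∞) ^ k * B := by gcongr; exact h2.2
    _ = ENNReal.ofReal ((1 + ζ) * Lε.toReal ^ k * (ε * (a + ζ)) +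
        C * (ε : ℝ) ^ k * B.toReal) := by
        have e1 : ENNReal.ofReal ((1 + ζ) * Lε.toReal ^ k * (ε * (a + ζ))) =
            ENNReal.ofReal (1 + ζ) * Lε ^ k * ENNReal.ofReal (ε * (a + ζ)) := by
          rw [ENNReal.ofReal_mul (by positivity), ENNReal.ofReal_mul (by positivity),
            ENNReal.ofReal_pow ENNReal.toReal_nonneg, ENNReal.ofReal_toReal hLεfin.ne]
        have e2 : ENNReal.ofReal (C * (ε : ℝ) ^ k * B.toReal) = C * (ε : ℝ≥0∞) ^ k * B := by
          rw [ENNReal.ofReal_mul (by positivity), ENNReal.ofReal_mul (by positivity),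
            ENNReal.ofReal_pow hε0, ENNReal.ofReal_toReal hBfin.ne,
            ENNReal.ofReal_coe_nnreal, ENNReal.ofReal_coe_nnreal]
        rw [ENNReal.ofReal_add (p := (1 + ζ) * Lε.toReal ^ k * (ε * (a + ζ)))
          (q := C * (ε : ℝ) ^ k * B.toReal) (by positivity) (by positivity), e1, e2]
    _ ≤ ENNReal.ofReal (ε * (Lε.toReal ^ k * a + η)) := by
        refine ENNReal.ofReal_le_ofReal ?_
        have hpow : (ε : ℝ) ^ k = ε * (ε : ℝ) ^ (k - 1) := by
          rw [← pow_succ']; congr 1; omega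
        have hLk : Lε.toReal ^ k ≤ L ^ k := pow_le_pow_left₀ ENNReal.toReal_nonneg hLεL k
        have hLk0 : 0 ≤ Lε.toReal ^ k := by positivity
        have h6 : Lε.toReal ^ k * ((1 + ζ) * (a + ζ)) ≤ Lε.toReal ^ k * a + η / 2 := by
          have : (1 + ζ) * (a + ζ) ≤ a + ζ * (a + 2) := by nlinarith
          have h7 : Lε.toReal ^ k * (ζ * (a + 2)) ≤ L ^ k * (ζ * (a + 2)) := by gcongr
          nlinarith [mul_le_mul_of_nonneg_left this hLk0]
        rw [hpow]
        have h8 := mul_le_mul_of_nonneg_left h6 hε0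
        have h9 := mul_le_mul_of_nonneg_left h1 hε0
        nlinarith
end Moments

end FellerProcess

/-! ### Exponential moments over short times -/

theorem integrable_abs_pow_of_lintegral_le {α : Type*} [MeasurableSpace α] {μ : Measure α}
    {g : α → ℝ} (hg : AEStronglyMeasurable g μ) {k : ℕ} {b : ℝ} (hb : 0 ≤ b)
    (h : ∫⁻ a, ‖g a‖ₑ ^ k ∂μ ≤ ENNReal.ofReal b) :
    Integrable (fun a => |g a| ^ k) μ ∧ ∫ a, |g a| ^ k ∂μ ≤ b := by
  have e : ∀ a, ‖|g a| ^ k‖ₑ = ‖g a‖ₑ ^ k := fun a => by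
    rw [enorm_pow, Real.enorm_abs]
  have hm : AEStronglyMeasurable (fun a => |g a| ^ k) μ := hg.norm.pow k
  refine ⟨⟨hm, ?_⟩, ?_⟩
  · rw [HasFiniteIntegral]
    simp only [e]
    exact h.trans_lt ENNReal.ofReal_lt_top
  · rw [integral_eq_lintegral_of_nonneg_ae (Eventually.of_forall fun a => by positivity) hm]
    refine ENNReal.toReal_le_of_le_ofReal hb (le_trans (le_of_eq ?_) h)
    refine lintegral_congr fun a => ?_
    rw [← e a, Real.enorm_of_nonneg (by positivity)]

namespace FellerProcess

open CadlagPath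

section Growth

variable {E : Type*} [TopologicalSpace E] [MeasurableSpace E] [OpensMeasurableSpace E]
  {X : FellerProcess E} {f : ℝ≥0 → E → ℝ} {ρ : E → E → ℝ≥0∞}

/-- The data of the main theorem that do not depend on the initial distributions. -/
structure CouplingBoundData (X : FellerProcess E) (ρ : E → E → ℝ≥0∞) (f : ℝ≥0 → E → ℝ) : Prop where
  semimetric : IsSemimetric ρ
  lip : (⨆ t : ℝ≥0, lipNorm ρ (f t)) < ∞
  regular : ∀ k : ℕ, 1 ≤ k → X.IsRegular f k
  fin : ∀ x y : E, X.couplingTime ρ x y < ∞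
  gen : ∀ k : ℕ, 2 ≤ k → ∀ x : E, ∃ v : ℝ, X.HasGeneratorAt (X.couplingTimePow ρ k x) x v

/-- The rate of growth of the logarithm of the exponential moment at time `t`. -/
def growthRate (X : FellerProcess E) (ρ : E → E → ℝ≥0∞) (f : ℝ≥0 → E → ℝ) (t : ℝ≥0) : ℝ≥0∞ :=
  ∑' j : ℕ, lipSup ρ f t ^ (j + 2) / ((j + 2).factorial : ℝ≥0∞) * X.supGenerator ρ (j + 2)

theorem growthRate_antitone : Antitone (X.growthRate ρ f) := fun s t hst =>
  ENNReal.tsum_le_tsum fun j => by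
    gcongr
    exact lipSup_antitone hst

theorem lintegral_growthRate_le : ∫⁻ t, X.growthRate ρ f t ∂timeMeasure ≤
    ∑' j : ℕ, constPow ρ f (j + 2) / ((j + 2).factorial : ℝ≥0∞) * X.supGenerator ρ (j + 2) := by
  have hm : Measurable (lipSup ρ f) := (lipSup_antitone (ρ := ρ) (f := f)).measurable
  have hm' : ∀ j : ℕ, Measurable fun t => lipSup ρ f t ^ (j + 2) / ((j + 2).factorial : ℝ≥0∞) :=
    fun j => (hm.pow_const _).div_const _
  unfold growthRate
  rw [lintegral_tsum fun j => ((hm' j).mul_const _).aemeasurable]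
  refine ENNReal.tsum_le_tsum fun j => ?_
  rw [lintegral_mul_const _ (hm' j)]
  gcongr
  simp only [div_eq_mul_inv]
  rw [lintegral_mul_const _ (hm.pow_const _)]
  gcongr
  exact lintegral_mono fun t => lipSup_pow_le (by omega) t

/-- The logarithmic bound for the exponential moment accumulated up to time `t`. -/
def growthClock (X : FellerProcess E) (ρ : E → E → ℝ≥0∞) (f : ℝ≥0 → E → ℝ) (η : ℝ) (t : ℝ≥0) : ℝ :=
  (∫⁻ s in Iio t, X.growthRate ρ f s ∂timeMeasure).toReal + η * (1 - Real.exp (-t))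

/-- The rate is decreasing, so its integral over [t, t+ε) is at least ε times its value at t+ε,
which must then be finite. The second term of the clock gives slack ε η exp(-(t+1)) in every step,
at total cost at most η. -/
theorem growthClock_add_le (hC : ∫⁻ t, X.growthRate ρ f t ∂timeMeasure < ∞)
    {η : ℝ} (hη : 0 ≤ η) (t : ℝ≥0) {ε : ℝ≥0} (hε : 0 < ε) (hε1 : ε ≤ 1) :
    X.growthRate ρ f (t + ε) < ∞ ∧
      ε * ((X.growthRate ρ f (t + ε)).toReal + η * Real.exp (-(t + 1))) ≤
        X.growthClock ρ f η (t + ε) - X.growthClock ρ f η t := by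
  have hfin : ∀ s : Set ℝ≥0, ∫⁻ u in s, X.growthRate ρ f u ∂timeMeasure < ∞ := fun s =>
    (setLIntegral_le_lintegral _ _).trans_lt hC
  have hsplit : ∫⁻ s in Iio (t + ε), X.growthRate ρ f s ∂timeMeasure =
      ∫⁻ s in Iio t, X.growthRate ρ f s ∂timeMeasure +
        ∫⁻ s in Ico t (t + ε), X.growthRate ρ f s ∂timeMeasure := by
    rw [← Iio_union_Ico_eq_Iio (show t ≤ t + ε from le_self_add),
      lintegral_union measurableSet_Ico]
    exact Set.disjoint_left.2 fun s h1 h2 => absurd h2.1 (not_le.2 h1)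
  have hlow : ε * X.growthRate ρ f (t + ε) ≤
      ∫⁻ s in Ico t (t + ε), X.growthRate ρ f s ∂timeMeasure := by
    have h1 : ∫⁻ _ in Ico t (t + ε), X.growthRate ρ f (t + ε) ∂timeMeasure ≤
        ∫⁻ s in Ico t (t + ε), X.growthRate ρ f s ∂timeMeasure :=
      setLIntegral_mono growthRate_antitone.measurable fun s hs =>
        growthRate_antitone (le_of_lt hs.2)
    rwa [setLIntegral_const, timeMeasure_Ico, ← ENNReal.coe_sub, add_tsub_cancel_left,
      mul_comm] at h1
  have hlt : X.growthRate ρ f (t + ε) < ∞ := by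
    by_contra h
    rw [not_lt, top_le_iff] at h
    rw [h, ENNReal.mul_top (by exact_mod_cast hε.ne')] at hlow
    exact absurd (hfin (Ico t (t + ε))) (not_lt.2 hlow)
  refine ⟨hlt, ?_⟩
  have hreal := ENNReal.toReal_mono (hfin _).ne hlow
  rw [ENNReal.toReal_mul, ENNReal.coe_toReal] at hreal
  rw [growthClock, growthClock, hsplit, ENNReal.toReal_add (hfin _).ne (hfin _).ne]
  have hexp : (ε : ℝ) * Real.exp (-((t : ℝ) + 1)) ≤
      Real.exp (-t) - Real.exp (-((t + ε : ℝ≥0) : ℝ)) := by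
    have e1 : Real.exp (-((t + ε : ℝ≥0) : ℝ)) = Real.exp (-t) * Real.exp (-ε) := by
      rw [← Real.exp_add]; congr 1; push_cast; ring
    have e2 : Real.exp (-((t : ℝ) + 1)) = Real.exp (-t) * Real.exp (-1) := by
      rw [← Real.exp_add]; congr 1; ring
    have hε1' : (ε : ℝ) ≤ 1 := by exact_mod_cast hε1
    have e3 : Real.exp (-1) ≤ Real.exp (-(ε : ℝ)) := Real.exp_le_exp.2 (by linarith)
    have e4 : (ε : ℝ) * Real.exp (-(ε : ℝ)) ≤ 1 - Real.exp (-(ε : ℝ)) := by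
      have h := Real.add_one_le_exp (ε : ℝ)
      have h2 : Real.exp (ε : ℝ) * Real.exp (-(ε : ℝ)) = 1 := by rw [← Real.exp_add]; simp
      nlinarith [Real.exp_pos (-(ε : ℝ))]
    have e5 : (ε : ℝ) * Real.exp (-1) ≤ 1 - Real.exp (-(ε : ℝ)) :=
      (mul_le_mul_of_nonneg_left e3 ε.coe_nonneg).trans e4
    rw [e1, e2]
    nlinarith [Real.exp_pos (-(t : ℝ))]
  nlinarith [mul_le_mul_of_nonneg_left hexp hη]

theorem growthClock_mono (hC : ∫⁻ t, X.growthRate ρ f t ∂timeMeasure < ∞)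
    {η : ℝ} (hη : 0 ≤ η) : Monotone (X.growthClock ρ f η) := by
  intro s t hst
  have h1 : ∫⁻ u in Iio s, X.growthRate ρ f u ∂timeMeasure ≤
      ∫⁻ u in Iio t, X.growthRate ρ f u ∂timeMeasure := lintegral_mono_set (Iio_subset_Iio hst)
  have h2 : Real.exp (-(t : ℝ)) ≤ Real.exp (-(s : ℝ)) :=
    Real.exp_le_exp.2 (neg_le_neg (by exact_mod_cast hst))
  unfold growthClock
  have h3 := ENNReal.toReal_mono
    (((setLIntegral_le_lintegral (Iio t) (X.growthRate ρ f)).trans_lt hC).ne) h1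
  nlinarith

theorem growthClock_le (hC : ∫⁻ t, X.growthRate ρ f t ∂timeMeasure < ∞)
    {η : ℝ} (hη : 0 ≤ η) (t : ℝ≥0) :
    X.growthClock ρ f η t ≤ (∫⁻ t, X.growthRate ρ f t ∂timeMeasure).toReal + η := by
  unfold growthClock
  have h3 := ENNReal.toReal_mono hC.ne (setLIntegral_le_lintegral (Iio t) (X.growthRate ρ f))
  nlinarith [Real.exp_pos (-(t : ℝ))]

theorem growthClock_zero (η : ℝ) : X.growthClock ρ f η 0 = 0 := by
  simp [growthClock]

namespace CouplingBoundData

theorem isIntegrableFamily (h : X.CouplingBoundData ρ f) : X.IsIntegrableFamily f :=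
  (h.regular 1 le_rfl).isIntegrableFamily

theorem hasGeneratorAt (h : X.CouplingBoundData ρ f) {k : ℕ} (hk : 2 ≤ k) (x : E) :
    X.HasGeneratorAt (X.couplingTimePow ρ k x) x (X.generator (X.couplingTimePow ρ k x) x) := by
  obtain ⟨v, hv⟩ := h.gen k hk x
  have : X.generator (X.couplingTimePow ρ k x) x = v := hv.2.limUnder_eq
  rwa [this]

/-- All terms are nonnegative, so a partial sum at one state is below the series of suprema. -/
theorem sum_le_growthRate (h : X.CouplingBoundData ρ f) {t : ℝ≥0}
    (ht : X.growthRate ρ f t < ∞) (y : E) (K : ℕ) :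
    ∑ k ∈ Finset.range K, (lipSup ρ f t).toReal ^ (k + 2) *
      X.generator (X.couplingTimePow ρ (k + 2) y) y / (k + 2).factorial ≤
        (X.growthRate ρ f t).toReal := by
  have hLfin : lipSup ρ f t < ∞ := (lipSup_le _).trans_lt h.lip
  have hgen0 : ∀ k : ℕ, 0 ≤ X.generator (X.couplingTimePow ρ (k + 2) y) y := fun k =>
    (h.hasGeneratorAt (by omega) y).couplingTimePow_nonneg h.semimetric (by omega)
  rw [← ENNReal.ofReal_le_iff_le_toReal ht.ne, ENNReal.ofReal_sum_of_nonneg fun k _ => by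
    have := hgen0 k
    positivity]
  refine le_trans (Finset.sum_le_sum fun k _ => ?_) (ENNReal.sum_le_tsum (Finset.range K))
  have e : (lipSup ρ f t).toReal ^ (k + 2) * X.generator (X.couplingTimePow ρ (k + 2) y) y /
      ((k + 2).factorial : ℝ) = (lipSup ρ f t).toReal ^ (k + 2) / ((k + 2).factorial : ℝ) *
        X.generator (X.couplingTimePow ρ (k + 2) y) y := by ring
  rw [e, ENNReal.ofReal_mul (by positivity), ENNReal.ofReal_div_of_pos (by positivity),
    ENNReal.ofReal_pow ENNReal.toReal_nonneg, ENNReal.ofReal_toReal hLfin.ne,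
    ENNReal.ofReal_natCast]
  gcongr
  exact le_iSup (fun y => ENNReal.ofReal (X.generator (X.couplingTimePow ρ (k + 2) y) y)) y

end CouplingBoundData

end Growth

section OneStep

variable {E : Type*} [TopologicalSpace E] [PolishSpace E] [MeasurableSpace E] [BorelSpace E]
  {X : FellerProcess E} {f : ℝ≥0 → E → ℝ} {ρ : E → E → ℝ≥0∞}

theorem IsIntegrableFamily.integrable_increment (hf : X.IsIntegrableFamily f) (t ε : ℝ≥0) (y : E) :
    Integrable (fun w => X.closedMart f t ε w - X.tailMean f t y) (X.law y) :=
  (hf.integrable_closedMart (isStopTime_const ε) t y).sub (integrable_const _)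

theorem IsIntegrableFamily.integral_increment (hf : X.IsIntegrableFamily f) (t ε : ℝ≥0) (y : E) :
    ∫ w, (X.closedMart f t ε w - X.tailMean f t y) ∂(X.law y) = 0 := by
  have h := hf.setIntegral_closedMart (isStopTime_const ε) t y (A := univ)
    (@MeasurableSet.univ _ (pastSigma fun _ => ε))
  simp only [Measure.restrict_univ] at h
  rw [integral_sub (hf.integrable_closedMart (isStopTime_const ε) t y) (integrable_const _), h]
  simp [tailMean]

/-- The second and higher moments of an increment control its (continued) exponential moment. -/
theorem IsIntegrableFamily.lintegral_truncExp_increment_le (hf : X.IsIntegrableFamily f)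
    (t ε : ℝ≥0) (y : E) {N m θ : ℝ} (hθ : 0 ≤ θ) {K : ℕ}
    (hK : ∀ z : ℝ, truncExp N (m + z) ≤ truncExp N m + Real.exp (min m N) * z + truncExp N m *
      (∑ k ∈ Finset.range K, |z| ^ (k + 2) / (k + 2).factorial + θ * |z| ^ 2))
    {b : ℕ → ℝ} (hb : ∀ k ∈ Finset.range K, 0 ≤ b k ∧
      ∫⁻ w, ‖X.closedMart f t ε w - X.tailMean f t y‖ₑ ^ (k + 2) ∂(X.law y) ≤
        ENNReal.ofReal (b k))
    {b₂ : ℝ} (hb₂ : 0 ≤ b₂) (hb₂' : ∫⁻ w, ‖X.closedMart f t ε w - X.tailMean f t y‖ₑ ^ 2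
      ∂(X.law y) ≤ ENNReal.ofReal b₂) :
    ∫⁻ w, ENNReal.ofReal (truncExp N (m + (X.closedMart f t ε w - X.tailMean f t y)))
      ∂(X.law y) ≤ ENNReal.ofReal (truncExp N m *
        (1 + (∑ k ∈ Finset.range K, b k / (k + 2).factorial + θ * b₂))) := by
  set Δ : CadlagPath E → ℝ := fun w => X.closedMart f t ε w - X.tailMean f t y with hΔ
  have hi := hf.integrable_increment t ε y
  have hQ := truncExp_pos N m
  have hmom : ∀ k ∈ Finset.range K, Integrable (fun w => |Δ w| ^ (k + 2)) (X.law y) ∧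
      ∫ w, |Δ w| ^ (k + 2) ∂(X.law y) ≤ b k := fun k hk =>
    integrable_abs_pow_of_lintegral_le hi.1 (hb k hk).1 (hb k hk).2
  have hmom2 := integrable_abs_pow_of_lintegral_le hi.1 hb₂ hb₂'
  have i1 : Integrable (fun w => truncExp N m + Real.exp (min m N) * Δ w) (X.law y) :=
    (integrable_const _).add (hi.const_mul _)
  have i2 : Integrable (fun w => ∑ k ∈ Finset.range K, |Δ w| ^ (k + 2) / (k + 2).factorial)
      (X.law y) := integrable_finsetSum _ fun k hk => (hmom k hk).1.div_const _
  have i3 : Integrable (fun w => θ * |Δ w| ^ 2) (X.law y) := hmom2.1.const_mul _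
  have i4 : Integrable (fun w => truncExp N m * (∑ k ∈ Finset.range K,
      |Δ w| ^ (k + 2) / (k + 2).factorial + θ * |Δ w| ^ 2)) (X.law y) := (i2.add i3).const_mul _
  refine (lintegral_mono fun w => ENNReal.ofReal_le_ofReal (hK (Δ w))).trans ?_
  have i5 : Integrable (fun w => truncExp N m + Real.exp (min m N) * Δ w + truncExp N m *
      (∑ k ∈ Finset.range K, |Δ w| ^ (k + 2) / (k + 2).factorial + θ * |Δ w| ^ 2)) (X.law y) :=
    i1.add i4
  rw [← ofReal_integral_eq_lintegral_ofReal i5 (Eventually.of_forall fun w =>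
    (truncExp_pos _ _).le.trans (hK (Δ w)))]
  refine ENNReal.ofReal_le_ofReal ?_
  rw [integral_add i1 i4, integral_add (integrable_const _) (hi.const_mul _), integral_const_mul,
    hf.integral_increment t ε y, integral_const_mul, integral_add i2 i3, integral_const_mul,
    integral_finsetSum _ fun k hk => (hmom k hk).1.div_const _]
  simp only [integral_div, integral_const, probReal_univ, one_smul, mul_zero, add_zero]
  rw [mul_one_add]
  gcongr with k hk
  · exact (hmom k hk).2
  · exact hmom2.2

namespace CouplingBoundData

/-- The local exponential estimate. -/
theorem eventually_lintegral_truncExp_le (h : X.CouplingBoundData ρ f)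
    (hC : ∫⁻ t, X.growthRate ρ f t ∂timeMeasure < ∞) {η : ℝ} (hη : 0 < η) (N m : ℝ) (t : ℝ≥0)
    (y : E) : ∀ᶠ ε in 𝓝[>] (0 : ℝ≥0),
      ∫⁻ w, ENNReal.ofReal (truncExp N (m + (X.closedMart f t ε w - X.tailMean f t y)))
        ∂(X.law y) ≤ ENNReal.ofReal (truncExp N m *
          Real.exp (X.growthClock ρ f η (t + ε) - X.growthClock ρ f η t)) := by
  have hf := h.isIntegrableFamily
  set a : ℕ → ℝ := fun k => X.generator (X.couplingTimePow ρ k y) y with ha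
  have hgen : ∀ k, 2 ≤ k → X.HasGeneratorAt (X.couplingTimePow ρ k y) y (a k) := fun k hk =>
    h.hasGeneratorAt hk y
  have ha0 : ∀ k, 2 ≤ k → 0 ≤ a k := fun k hk =>
    (hgen k hk).couplingTimePow_nonneg h.semimetric (by omega)
  set L : ℝ := (⨆ t : ℝ≥0, lipNorm ρ (f t)).toReal with hL
  -- The slack of the clock per unit time: one half pays for the errors in the K moments, the other
  -- for the quadratic remainder.
  set κ : ℝ := η * Real.exp (-(t + 1)) with hκ
  have hκ0 : 0 < κ := by positivity
  have hD : 0 < L ^ 2 * a 2 + 1 := by have := ha0 2 le_rfl; positivity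
  -- Makes θ (L² a₂ + 1) = κ/2, where the +1 is the error allowed in the second moment.
  set θ : ℝ := κ / 2 / (L ^ 2 * a 2 + 1) with hθ
  have hθ0 : 0 < θ := by positivity
  obtain ⟨K, hK⟩ := truncExp_add_le N m θ hθ0
  have hη' : 0 < κ / 2 / (K + 1) := by positivity
  have hev : ∀ᶠ ε in 𝓝[>] (0 : ℝ≥0), ∀ k ∈ Finset.range K,
      ∫⁻ w, ‖X.closedMart f t ε w - X.tailMean f t y‖ₑ ^ (k + 2) ∂(X.law y) ≤
        ENNReal.ofReal (ε * ((lipSup ρ f (t + ε)).toReal ^ (k + 2) * a (k + 2) +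
          κ / 2 / (K + 1))) :=
    (Filter.eventually_all_finset _).2 fun k _ =>
      eventually_lintegral_increment_pow_le h.semimetric h.lip h.fin (by omega)
        (h.regular (k + 2) (by omega)) (hgen (k + 2) (by omega)) t hη'
  have hev2 := eventually_lintegral_increment_pow_le h.semimetric h.lip h.fin le_rfl
    (h.regular 2 (by omega)) (hgen 2 le_rfl) t zero_lt_one
  filter_upwards [hev, hev2, self_mem_nhdsWithin, mem_nhdsWithin_of_mem_nhds
    (Iio_mem_nhds zero_lt_one)] with ε h1 h2 h3 h4
  obtain ⟨hlt, hclock⟩ := growthClock_add_le hC hη.le t h3 (le_of_lt h4)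
  have hε0 : (0 : ℝ) ≤ ε := ε.coe_nonneg
  set Lε : ℝ := (lipSup ρ f (t + ε)).toReal with hLε
  have hLε0 : 0 ≤ Lε := ENNReal.toReal_nonneg
  have hLεL : Lε ≤ L := ENNReal.toReal_mono h.lip.ne (lipSup_le _)
  have ha2 := ha0 2 le_rfl
  refine (hf.lintegral_truncExp_increment_le t ε y hθ0.le hK
    (fun k hk => ⟨by have := ha0 (k + 2) (by omega); positivity, h1 k hk⟩)
    (by positivity) h2).trans (ENNReal.ofReal_le_ofReal ?_)
  have hQ := truncExp_pos N m
  gcongr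
  -- By 1 + x ≤ exp x the one-step bound becomes a factor that telescopes along the clock.
  refine le_trans ?_ (Real.add_one_le_exp _)
  rw [add_comm]
  gcongr
  refine le_trans ?_ hclock
  have hsum := h.sum_le_growthRate hlt y K
  have s1 : ∑ k ∈ Finset.range K, (ε : ℝ) * (Lε ^ (k + 2) * a (k + 2) + κ / 2 / (K + 1)) /
      (k + 2).factorial ≤ ε * ((X.growthRate ρ f (t + ε)).toReal + κ / 2) := by
    calc _ ≤ ∑ k ∈ Finset.range K, (ε : ℝ) * (Lε ^ (k + 2) * a (k + 2) / (k + 2).factorial +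
          κ / 2 / (K + 1)) := by
          refine Finset.sum_le_sum fun k _ => ?_
          rw [mul_div_assoc, add_div]
          refine mul_le_mul_of_nonneg_left (add_le_add le_rfl (div_le_self hη'.le ?_)) hε0
          exact_mod_cast (k + 2).factorial_pos
      _ = ε * (∑ k ∈ Finset.range K, Lε ^ (k + 2) * a (k + 2) / (k + 2).factorial +
          K * (κ / 2 / (K + 1))) := by
          rw [← Finset.mul_sum, Finset.sum_add_distrib, Finset.sum_const, Finset.card_range,
            nsmul_eq_mul]
      _ ≤ _ := by
          gcongr
          rw [mul_div_assoc', div_le_iff₀ (by positivity)]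
          nlinarith
  have s2 : θ * (ε * (Lε ^ 2 * a 2 + 1)) ≤ ε * (κ / 2) := by
    have : θ * (Lε ^ 2 * a 2 + 1) ≤ κ / 2 := by
      calc θ * (Lε ^ 2 * a 2 + 1) ≤ θ * (L ^ 2 * a 2 + 1) := by gcongr
        _ = κ / 2 := by rw [hθ]; field_simp
    nlinarith [mul_le_mul_of_nonneg_left this hε0]
  calc _ ≤ ε * ((X.growthRate ρ f (t + ε)).toReal + κ / 2) + ε * (κ / 2) := add_le_add s1 s2
    _ = _ := by ring

end CouplingBoundData

end OneStep

end FellerProcess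

/-! ### From short to long times -/

/-- In a preorder whose increasing sequences are bounded above, a bounded monotone real function
takes a value that does not increase any further. -/
theorem exists_ge_forall_ge_le {α : Type*} [Preorder α] {φ : α → ℝ} (hφ : Monotone φ)
    (hb : BddAbove (range φ)) (hseq : ∀ u : ℕ → α, Monotone u → ∃ b, ∀ n, u n ≤ b) (a : α) :
    ∃ b, a ≤ b ∧ ∀ c, b ≤ c → φ c ≤ φ b := by
  -- Above any point there is one that nearly exhausts the further increase of `φ`. Iterating with
  -- errors 1/(n+1) and taking an upper bound leaves no increase.
  have hne : ∀ (a : α) (n : ℕ), ∃ c, a ≤ c ∧ ∀ d, a ≤ d → φ d ≤ φ c + 1 / ((n : ℝ) + 1) := by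
    intro a n
    have hS : (φ '' Ici a).Nonempty := ⟨φ a, a, self_mem_Ici, rfl⟩
    have hSb : BddAbove (φ '' Ici a) := hb.mono (image_subset_range _ _)
    have hpos : 0 < 1 / ((n : ℝ) + 1) := by positivity
    obtain ⟨_, ⟨c, hc, rfl⟩, h⟩ := exists_lt_of_lt_csSup hS (sub_lt_self _ hpos)
    refine ⟨c, hc, fun d hd => ?_⟩
    have := le_csSup hSb (mem_image_of_mem φ (show d ∈ Ici a from hd))
    linarith
  choose next hnext1 hnext2 using hne
  let u : ℕ → α := fun n => Nat.rec a (fun n c => next c n) n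
  have hu : Monotone u := monotone_nat_of_le_succ fun n => hnext1 (u n) n
  obtain ⟨b, hb'⟩ := hseq u hu
  refine ⟨b, hb' 0, fun c hc => ?_⟩
  have h : ∀ n : ℕ, φ c ≤ φ b + 1 / ((n : ℝ) + 1) := fun n => by
    have h1 := hnext2 (u n) n c ((hb' n).trans hc)
    have h2 : φ (u (n + 1)) ≤ φ b := hφ (hb' (n + 1))
    have h3 : u (n + 1) = next (u n) n := rfl
    rw [h3] at h2
    linarith
  have hlim : Tendsto (fun n : ℕ => φ b + 1 / ((n : ℝ) + 1)) atTop (𝓝 (φ b + 0)) :=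
    tendsto_const_nhds.add tendsto_one_div_add_atTop_nhds_zero_nat
  rw [add_zero] at hlim
  exact ge_of_tendsto' hlim h

namespace FellerProcess

open CadlagPath

section Exhaustion

variable {E : Type*} [TopologicalSpace E] [PolishSpace E] [MeasurableSpace E] [BorelSpace E]
  {X : FellerProcess E} {f : ℝ≥0 → E → ℝ}

/-- For every starting configuration, the exponential moment is controlled over some dyadic time
span. -/
def HasShortTimeBound (X : FellerProcess E) (f : ℝ≥0 → E → ℝ) (N : ℝ) (Γ : ℝ≥0 → ℝ) : Prop :=
  ∀ q : (ℝ≥0 × E) × ℝ, ∃ n : ℕ,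
    ∫⁻ w, ENNReal.ofReal (truncExp N (q.2 + (X.closedMart f q.1.1 ((1 / 2) ^ n) w -
      X.tailMean f q.1.1 q.1.2))) ∂(X.law q.1.2) ≤
        ENNReal.ofReal (truncExp N q.2 * Real.exp (Γ (q.1.1 + (1 / 2) ^ n) - Γ q.1.1))

/-- With dyadic spans the choice is the least admissible exponent, which is measurable because each
admissible set is. -/
theorem IsIntegrableFamily.exists_measurable_step (hf : X.IsIntegrableFamily f) {N : ℝ}
    {Γ : ℝ≥0 → ℝ} (hΓ : Monotone Γ) (hstep : X.HasShortTimeBound f N Γ) :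
    ∃ δ : (ℝ≥0 × E) × ℝ → ℝ≥0, Measurable δ ∧ ∀ q, 0 < δ q ∧ δ q ≤ 1 ∧
      ∫⁻ w, ENNReal.ofReal (truncExp N (q.2 + (X.closedMart f q.1.1 (δ q) w -
        X.tailMean f q.1.1 q.1.2))) ∂(X.law q.1.2) ≤
          ENNReal.ofReal (truncExp N q.2 * Real.exp (Γ (q.1.1 + δ q) - Γ q.1.1)) := by
  classical
  have hQ : Measurable (truncExp N) := (continuous_truncExp N).measurable
  have hm : ∀ n : ℕ, MeasurableSet {q : (ℝ≥0 × E) × ℝ |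
      ∫⁻ w, ENNReal.ofReal (truncExp N (q.2 + (X.closedMart f q.1.1 ((1 / 2) ^ n) w -
        X.tailMean f q.1.1 q.1.2))) ∂(X.law q.1.2) ≤
          ENNReal.ofReal (truncExp N q.2 * Real.exp (Γ (q.1.1 + (1 / 2) ^ n) - Γ q.1.1))} := by
    intro n
    refine measurableSet_le ?_ ?_
    · have h1 : Measurable fun p : ((ℝ≥0 × E) × ℝ) × CadlagPath E =>
          X.closedMart f p.1.1.1 ((1 / 2) ^ n) p.2 :=
        hf.measurable_closedMart_uncurry.comp
          ((measurable_fst.fst.fst.prodMk measurable_const).prodMk measurable_snd)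
      have h2 : Measurable fun p : ((ℝ≥0 × E) × ℝ) × CadlagPath E =>
          X.tailMean f p.1.1.1 p.1.1.2 := hf.measurable_tailMean.comp measurable_fst.fst
      have h3 : Measurable fun p : ((ℝ≥0 × E) × ℝ) × CadlagPath E =>
          ENNReal.ofReal (truncExp N (p.1.2 + (X.closedMart f p.1.1.1 ((1 / 2) ^ n) p.2 -
            X.tailMean f p.1.1.1 p.1.1.2))) :=
        (hQ.comp (measurable_fst.snd.add (h1.sub h2))).ennreal_ofReal
      exact Measurable.lintegral_kernel_prod_right' (κ := X.law.comap (fun q => q.1.2)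
        measurable_fst.snd) h3
    · exact ((hQ.comp measurable_snd).mul (Real.measurable_exp.comp
        ((hΓ.measurable.comp (measurable_fst.fst.add_const _)).sub
          (hΓ.measurable.comp measurable_fst.fst)))).ennreal_ofReal
  refine ⟨fun q => (1 / 2) ^ Nat.find (hstep q), ?_, fun q => ⟨by positivity, ?_,
    Nat.find_spec (hstep q)⟩⟩
  · have : Measurable fun n : ℕ => (1 / 2 : ℝ≥0) ^ n := measurable_from_top
    exact this.comp (measurable_find hstep hm)
  · exact pow_le_one₀ zero_le (by rw [← NNReal.coe_le_coe]; norm_num)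

/-- The exponential moment of the martingale at the stopping time `τ` is at most the exponential of
the clock. -/
structure IsControlled (X : FellerProcess E) (f : ℝ≥0 → E → ℝ) (N : ℝ) (Γ : ℝ≥0 → ℝ) (x : E)
    (T : ℝ≥0) (τ : CadlagPath E → ℝ≥0) : Prop where
  isStopTime : IsStopTime τ
  le : ∀ w, τ w ≤ T + 1
  moment_le : ∫⁻ w, ENNReal.ofReal (truncExp N (X.closedMart f 0 (τ w) w - X.tailMean f 0 x) *
    Real.exp (-Γ (τ w))) ∂(X.law x) ≤ 1

namespace IsControlled

variable {N : ℝ} {Γ : ℝ≥0 → ℝ} {x : E} {T : ℝ≥0} {τ : CadlagPath E → ℝ≥0}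

theorem measurable_moment (hf : X.IsIntegrableFamily f) (hΓ : Monotone Γ) (hτ : IsStopTime τ) :
    Measurable fun w => ENNReal.ofReal (truncExp N (X.closedMart f 0 (τ w) w - X.tailMean f 0 x) *
      Real.exp (-Γ (τ w))) :=
  (((continuous_truncExp N).measurable.comp
    ((hf.measurable_closedMart_stopTime hτ 0).sub_const _)).mul
      (Real.measurable_exp.comp (hΓ.measurable.comp hτ.measurable).neg)).ennreal_ofReal

theorem zero (hN : 0 ≤ N) (hΓ0 : Γ 0 = 0) : X.IsControlled f N Γ x T fun _ => 0 := by
  refine ⟨isStopTime_const 0, fun _ => zero_le, ?_⟩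
  have h : ∀ᵐ w ∂(X.law x), ENNReal.ofReal (truncExp N (X.closedMart f 0 0 w -
      X.tailMean f 0 x) * Real.exp (-Γ 0)) = 1 := by
    filter_upwards [X.start x] with w hw
    simp [closedMart, headFunctional, hw, hΓ0, truncExp_of_le hN]
  rw [lintegral_congr_ae h]
  simp

/-- Fatou's lemma along the convergent martingale values. Monotonicity of `Γ` suffices: the discount
at the supremum is at most the discount at each `τ n`. -/
theorem iSup (hf : X.IsIntegrableFamily f) (hΓ : Monotone Γ) {τ : ℕ → CadlagPath E → ℝ≥0}
    (hτ : ∀ n, X.IsControlled f N Γ x T (τ n)) (hm : ∀ w, Monotone fun n => τ n w) :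
    X.IsControlled f N Γ x T fun w => ⨆ n, τ n w := by
  have hb : ∀ w, BddAbove (range fun n => τ n w) := fun w =>
    ⟨T + 1, by rintro _ ⟨n, rfl⟩; exact (hτ n).le w⟩
  refine ⟨IsStopTime.iSup (fun n => (hτ n).isStopTime) hb, fun w => ciSup_le fun n => (hτ n).le w,
    ?_⟩
  have hlim := hf.ae_tendsto_closedMart_iSup 0 x (fun n => (hτ n).isStopTime) hm hb
  calc _ ≤ ∫⁻ w, liminf (fun n => ENNReal.ofReal (truncExp N (X.closedMart f 0 (τ n w) w -
        X.tailMean f 0 x) * Real.exp (-Γ (τ n w)))) atTop ∂(X.law x) := by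
        refine lintegral_mono_ae ?_
        filter_upwards [hlim] with w hw
        have h1 : Tendsto (fun n => ENNReal.ofReal (truncExp N (X.closedMart f 0 (τ n w) w -
            X.tailMean f 0 x) * Real.exp (-Γ (⨆ n, τ n w)))) atTop
            (𝓝 (ENNReal.ofReal (truncExp N (X.closedMart f 0 (⨆ n, τ n w) w -
              X.tailMean f 0 x) * Real.exp (-Γ (⨆ n, τ n w))))) :=
          ENNReal.tendsto_ofReal ((((continuous_truncExp N).tendsto _).comp
            (hw.sub_const _)).mul_const _)
        rw [← h1.liminf_eq]
        refine liminf_le_liminf (Eventually.of_forall fun n => ?_)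
        refine ENNReal.ofReal_le_ofReal (mul_le_mul_of_nonneg_left ?_ (truncExp_pos _ _).le)
        exact Real.exp_le_exp.2 (neg_le_neg (hΓ (le_ciSup (hb w) n)))
    _ ≤ liminf (fun n => ∫⁻ w, ENNReal.ofReal (truncExp N (X.closedMart f 0 (τ n w) w -
        X.tailMean f 0 x) * Real.exp (-Γ (τ n w))) ∂(X.law x)) atTop :=
        lintegral_liminf_le fun n => measurable_moment hf hΓ (hτ n).isStopTime
    _ ≤ 1 := by
        refine (liminf_le_liminf (v := fun _ => (1 : ℝ≥0∞))
          (Eventually.of_forall fun n => (hτ n).moment_le)).trans_eq ?_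
        simp

/-- A controlled stopping time can be prolonged if it is below `T`. -/
theorem prolong (hf : X.IsIntegrableFamily f) (hΓ : Monotone Γ) (hstep : X.HasShortTimeBound f N Γ)
    (hτ : X.IsControlled f N Γ x T τ) : ∃ σ, X.IsControlled f N Γ x T σ ∧ (∀ w, τ w ≤ σ w) ∧
      ∀ w, τ w < T → τ w < σ w := by
  have hs := hτ.isStopTime
  obtain ⟨δ, hδm, hδ⟩ := hf.exists_measurable_step hΓ hstep
  -- Time, state and martingale increment at `τ`: the data on which the next step depends.
  set q : CadlagPath E → (ℝ≥0 × E) × ℝ := fun w =>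
    ((0 + τ w, w.1 (τ w)), X.closedMart f 0 (τ w) w - X.tailMean f 0 x) with hq
  have hqm : Measurable q := ((measurable_const.add hs.measurable).prodMk
    (measurable_eval_comp hs.measurable measurable_id)).prodMk
      ((hf.measurable_closedMart_stopTime hs 0).sub_const _)
  have hqstop : ∀ w, q (stopAt τ w) = q w := fun w => by
    have h1 : (stopAt τ w).1 (τ w) = w.1 (τ w) := by simp [stopAt]
    have h2 := closedMart_stopAt (X := X) (f := f) hs 0 w
    rw [hs.apply_stopAt] at h2
    simp only [hq, hs.apply_stopAt, h1, h2]
  -- No step is made once `T` is reached; with `δ ≤ 1` this preserves the bound `T + 1`.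
  set δ' : CadlagPath E → ℝ≥0 := fun w => if T ≤ τ w then 0 else δ (q w) with hδ'
  have hδ'm : Measurable δ' := Measurable.ite (measurableSet_le measurable_const hs.measurable)
    measurable_const (hδm.comp hqm)
  have hδ'stopped : ∀ w, δ' (stopAt τ w) = δ' w := fun w => by
    simp only [hδ', hs.apply_stopAt, hqstop]
  refine ⟨fun w => τ w + δ' w, ⟨hs.add hδ'm hδ'stopped, fun w => ?_, ?_⟩, fun w => le_self_add,
    fun w hw => ?_⟩
  · by_cases h : T ≤ τ w
    · simpa [hδ', h] using hτ.le w
    · simp only [hδ', h, if_false]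
      exact add_le_add (not_le.1 h).le (hδ (q w)).2.1
  · set Ψ : CadlagPath E × CadlagPath E → ℝ≥0∞ := fun p => ENNReal.ofReal (truncExp N
      ((q p.1).2 + (X.closedMart f (q p.1).1.1 (δ' p.1) p.2 -
        X.tailMean f (q p.1).1.1 (q p.1).1.2)) * Real.exp (-Γ (τ p.1 + δ' p.1))) with hΨ
    have hΨm : Measurable Ψ := by
      have h1 : Measurable fun p : CadlagPath E × CadlagPath E =>
          X.closedMart f (q p.1).1.1 (δ' p.1) p.2 :=
        hf.measurable_closedMart_uncurry.comp
          (((hqm.comp measurable_fst).fst.fst.prodMk (hδ'm.comp measurable_fst)).prodMk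
            measurable_snd)
      have h2 : Measurable fun p : CadlagPath E × CadlagPath E =>
          X.tailMean f (q p.1).1.1 (q p.1).1.2 :=
        hf.measurable_tailMean.comp (hqm.comp measurable_fst).fst
      exact (((continuous_truncExp N).measurable.comp ((hqm.comp measurable_fst).snd.add
        (h1.sub h2))).mul (Real.measurable_exp.comp (hΓ.measurable.comp
          ((hs.measurable.add hδ'm).comp measurable_fst)).neg)).ennreal_ofReal
    -- The further increment is that of the martingale of the shifted path, so the strong Markov
    -- property applies with `q` frozen.
    have hae : ∀ᵐ w ∂(X.law x), ENNReal.ofReal (truncExp N (X.closedMart f 0 (τ w + δ' w) w -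
        X.tailMean f 0 x) * Real.exp (-Γ (τ w + δ' w))) = Ψ (stopAt τ w, shiftAt τ w) := by
      filter_upwards [hf.ae_absTail_lt_top x 0] with w hw
      simp only [hΨ, hqstop, hδ'stopped, hs.apply_stopAt]
      rw [hf.closedMart_add hw]
      simp only [hq, shiftAt]
      congr 3
      ring
    rw [lintegral_congr_ae hae, X.lintegral_strongMarkov x hs hΨm]
    refine le_trans (lintegral_mono fun w => ?_) hτ.moment_le
    simp only [hΨ, hqstop, hδ'stopped, hs.apply_stopAt]
    have key : ∫⁻ w', ENNReal.ofReal (truncExp N ((q w).2 + (X.closedMart f (q w).1.1 (δ' w) w' -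
        X.tailMean f (q w).1.1 (q w).1.2))) ∂(X.law (q w).1.2) ≤
          ENNReal.ofReal (truncExp N (q w).2 * Real.exp (Γ ((q w).1.1 + δ' w) - Γ (q w).1.1)) := by
      by_cases h : T ≤ τ w
      · have h0 : δ' w = 0 := if_pos h
        rw [h0]
        have hae : ∀ᵐ w' ∂(X.law (q w).1.2), ENNReal.ofReal (truncExp N ((q w).2 +
            (X.closedMart f (q w).1.1 0 w' - X.tailMean f (q w).1.1 (q w).1.2))) =
              ENNReal.ofReal (truncExp N (q w).2) := by
          filter_upwards [X.start (q w).1.2] with w' hw'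
          simp [closedMart, headFunctional, hw']
        rw [lintegral_congr_ae hae]
        simp
      · have h0 : δ' w = δ (q w) := if_neg h
        rw [h0]
        exact (hδ (q w)).2.2
    have e : ∀ a : ℝ, ENNReal.ofReal (truncExp N a * Real.exp (-Γ (τ w + δ' w))) =
        ENNReal.ofReal (Real.exp (-Γ (τ w + δ' w))) * ENNReal.ofReal (truncExp N a) := fun a => by
      rw [mul_comm, ENNReal.ofReal_mul (Real.exp_pos _).le]
    simp only [e]
    rw [lintegral_const_mul' _ _ ENNReal.ofReal_ne_top]
    refine (mul_le_mul_right key _).trans_eq ?_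
    rw [← ENNReal.ofReal_mul (Real.exp_pos _).le]
    congr 1
    simp only [hq, zero_add]
    rw [mul_left_comm, ← Real.exp_add]
    congr 2
    ring
  · have : δ' w = δ (q w) := if_neg (not_le.2 hw)
    simp only [this]
    exact lt_add_of_pos_right _ (hδ (q w)).1

/-- There are controlled stopping times that are at least `T`. -/
theorem exists_ge (hf : X.IsIntegrableFamily f) (hN : 0 ≤ N) (hΓ : Monotone Γ) (hΓ0 : Γ 0 = 0)
    (hstep : X.HasShortTimeBound f N Γ) (x : E) (T : ℝ≥0) :
    ∃ τ, X.IsControlled f N Γ x T τ ∧ ∀ᵐ w ∂(X.law x), T ≤ τ w := by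
  let φ : {τ // X.IsControlled f N Γ x T τ} → ℝ := fun τ => ∫ w, (τ.1 w : ℝ) ∂(X.law x)
  have hint : ∀ τ : {τ // X.IsControlled f N Γ x T τ},
      Integrable (fun w => (τ.1 w : ℝ)) (X.law x) := fun τ =>
    Integrable.of_bound τ.2.isStopTime.measurable.coe_nnreal_real.aestronglyMeasurable
      ((T + 1 : ℝ≥0) : ℝ) (Eventually.of_forall fun w => by
        rw [Real.norm_of_nonneg (τ.1 w).coe_nonneg]
        exact_mod_cast τ.2.le w)
  have hφ : Monotone φ := fun τ σ h => integral_mono (hint τ) (hint σ) fun w => by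
    exact_mod_cast h w
  have hφb : BddAbove (range φ) := by
    refine ⟨((T + 1 : ℝ≥0) : ℝ), ?_⟩
    rintro _ ⟨τ, rfl⟩
    have h := integral_mono (hint τ) (integrable_const ((T + 1 : ℝ≥0) : ℝ)) fun w => by
      exact_mod_cast τ.2.le w
    simpa only [integral_const, probReal_univ, one_smul] using h
  -- A controlled time whose mean no controlled extension exceeds. Its prolongation is then almost
  -- surely trivial, whereas it is strict wherever `τ < T`.
  obtain ⟨τ, -, hmax⟩ := exists_ge_forall_ge_le hφ hφb (fun u hu =>
    ⟨⟨fun w => ⨆ n, (u n).1 w, iSup hf hΓ (fun n => (u n).2) fun w m n hmn => hu hmn w⟩,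
      fun n w => le_ciSup (f := fun n => (u n).1 w)
        ⟨T + 1, by rintro _ ⟨n, rfl⟩; exact (u n).2.le w⟩ n⟩) ⟨fun _ => 0, zero hN hΓ0⟩
  obtain ⟨σ, hσ, h1, h2⟩ := prolong hf hΓ hstep τ.2
  have h3 : φ ⟨σ, hσ⟩ ≤ φ τ := hmax ⟨σ, hσ⟩ h1
  have h4 : ∫ w, ((σ w : ℝ) - τ.1 w) ∂(X.law x) = 0 := by
    rw [integral_sub (hint ⟨σ, hσ⟩) (hint τ)]
    have : φ τ ≤ φ ⟨σ, hσ⟩ := hφ (show τ ≤ ⟨σ, hσ⟩ from h1)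
    simp only [φ] at this h3
    linarith
  rw [integral_eq_zero_iff_of_nonneg (fun w => sub_nonneg.2 (by exact_mod_cast h1 w))
    ((hint ⟨σ, hσ⟩).sub (hint τ))] at h4
  refine ⟨τ.1, τ.2, h4.mono fun w hw => ?_⟩
  by_contra hlt
  have h5 := h2 w (not_le.1 hlt)
  have h6 : (σ w : ℝ) = τ.1 w := sub_eq_zero.1 hw
  exact absurd (by exact_mod_cast h6) (ne_of_gt h5)

end IsControlled

end Exhaustion

end FellerProcess

/-! ### The exponential moment for a fixed starting point -/

/-- Fatou's lemma along a sequence that converges in mean. -/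
theorem lintegral_comp_le_of_tendsto_lintegral_enorm_sub {α : Type*} [MeasurableSpace α]
    {μ : Measure α} {g : ℕ → α → ℝ} {g₀ : α → ℝ} (hg : ∀ n, Measurable (g n))
    (hg₀ : Measurable g₀)
    (h : Tendsto (fun n => ∫⁻ a, ‖g n a - g₀ a‖ₑ ∂μ) atTop (𝓝 0)) {φ : ℝ → ℝ≥0∞}
    (hφ : Continuous φ) {C : ℝ≥0∞} (hC : ∀ n, ∫⁻ a, φ (g n a) ∂μ ≤ C) :
    ∫⁻ a, φ (g₀ a) ∂μ ≤ C := by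
  have hm : TendstoInMeasure μ g atTop g₀ := by
    refine tendstoInMeasure_of_tendsto_eLpNorm (p := 1) one_ne_zero
      (fun n => (hg n).aestronglyMeasurable) hg₀.aestronglyMeasurable ?_
    simpa only [eLpNorm_one_eq_lintegral_enorm, Pi.sub_apply] using h
  obtain ⟨ns, -, hns⟩ := hm.exists_seq_tendsto_ae
  calc ∫⁻ a, φ (g₀ a) ∂μ ≤ ∫⁻ a, liminf (fun n => φ (g (ns n) a)) atTop ∂μ := by
        refine lintegral_mono_ae ?_
        filter_upwards [hns] with a ha
        exact ((hφ.tendsto _).comp ha).liminf_eq.ge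
    _ ≤ liminf (fun n => ∫⁻ a, φ (g (ns n) a) ∂μ) atTop :=
        lintegral_liminf_le fun n => hφ.measurable.comp (hg (ns n))
    _ ≤ C := by
        refine (liminf_le_liminf (v := fun _ => C)
          (Eventually.of_forall fun n => hC (ns n))).trans_eq ?_
        simp

namespace FellerProcess

open CadlagPath

section Limit

variable {E : Type*} [TopologicalSpace E] [PolishSpace E] [MeasurableSpace E] [BorelSpace E]
  {X : FellerProcess E} {f : ℝ≥0 → E → ℝ} {ρ : E → E → ℝ≥0∞}

namespace IsIntegrableFamily

/-- Dominated convergence twice, first in time along a fixed path and then over the paths. -/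
theorem tendsto_lintegral_absTail_shift (hf : X.IsIntegrableFamily f) (t : ℝ≥0) (x : E) :
    Tendsto (fun n : ℕ => ∫⁻ w, absTail f (t + n) (shift (n : ℝ≥0) w) ∂(X.law x)) atTop (𝓝 0) := by
  have hm : ∀ n : ℕ, Measurable fun w : CadlagPath E => absTail f (t + n) (shift (n : ℝ≥0) w) :=
    fun n => (measurable_absTail hf.measurable).comp
      (measurable_const.prodMk (isStopTime_const (n : ℝ≥0)).measurable_shiftAt)
  have h := tendsto_lintegral_of_dominated_convergence (μ := X.law x)
    (F := fun (n : ℕ) w => absTail f (t + n) (shift (n : ℝ≥0) w)) (f := fun _ => 0)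
    (absTail f t) hm (fun n => Eventually.of_forall fun w => absTail_shift_le f t n w)
    (hf.lintegral_lt_top x t).ne ?_
  · simpa using h
  filter_upwards [hf.ae_absTail_lt_top x t] with w hw
  have hi : Measurable fun s : ℝ≥0 => ‖f (t + s) (w.1 s)‖ₑ :=
    ((measurable_integrand hf.measurable).comp (measurable_prodMk_left (x := (t, w)))).enorm
  have h2 := tendsto_lintegral_of_dominated_convergence (μ := timeMeasure)
    (F := fun (n : ℕ) s => (Ici (n : ℝ≥0)).indicator (fun s => ‖f (t + s) (w.1 s)‖ₑ) s)
    (f := fun _ => 0) (fun s => ‖f (t + s) (w.1 s)‖ₑ) (fun n => hi.indicator measurableSet_Ici)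
    (fun n => Eventually.of_forall fun s => indicator_le_self _ _ s) hw.ne
    (Eventually.of_forall fun s => by
      obtain ⟨m, hm⟩ := exists_nat_gt s
      refine tendsto_const_nhds.congr' ?_
      filter_upwards [eventually_ge_atTop m] with n hn
      rw [indicator_of_notMem]
      exact not_le.2 (hm.trans_le (by exact_mod_cast hn)))
  simpa only [absTail_shift, lintegral_indicator measurableSet_Ici, lintegral_zero] using h2

/-- The difference consists of the tail after `τ` and its restarted mean. Their absolute bounds have
equal expectation by the strong Markov property, hence the factor 2. -/
theorem lintegral_enorm_closedMart_sub_le (hf : X.IsIntegrableFamily f)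
    {τ : CadlagPath E → ℝ≥0} (hτ : IsStopTime τ) (t : ℝ≥0) {T : ℝ≥0} {x : E}
    (hT : ∀ᵐ w ∂(X.law x), T ≤ τ w) :
    ∫⁻ w, ‖X.closedMart f t (τ w) w - tailFunctional f t w‖ₑ ∂(X.law x) ≤
      2 * ∫⁻ w, absTail f (t + T) (shift T w) ∂(X.law x) := by
  have hm : Measurable fun w => absTail f (t + τ w) (shiftAt τ w) :=
    (measurable_absTail hf.measurable).comp
      ((measurable_const.add hτ.measurable).prodMk hτ.measurable_shiftAt)
  have hle : ∫⁻ w, absTail f (t + τ w) (shiftAt τ w) ∂(X.law x) ≤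
      ∫⁻ w, absTail f (t + T) (shift T w) ∂(X.law x) := by
    refine lintegral_mono_ae ?_
    filter_upwards [hT] with w hw
    rw [shiftAt, absTail_shift, absTail_shift]
    exact lintegral_mono_set (Ici_subset_Ici.2 hw)
  calc ∫⁻ w, ‖X.closedMart f t (τ w) w - tailFunctional f t w‖ₑ ∂(X.law x)
      ≤ ∫⁻ w, ((∫⁻ w', absTail f (t + τ w) w' ∂(X.law (w.1 (τ w)))) +
          absTail f (t + τ w) (shiftAt τ w)) ∂(X.law x) := by
        refine lintegral_mono_ae ?_
        filter_upwards [hf.ae_absTail_lt_top x t] with w hw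
        rw [← head_add_tail hf.measurable hw (τ w), closedMart, add_sub_add_left_eq_sub]
        exact enorm_sub_le.trans (add_le_add (enorm_tailMean_le _ _) (enorm_tailFunctional_le _ _ _))
    _ = 2 * ∫⁻ w, absTail f (t + τ w) (shiftAt τ w) ∂(X.law x) := by
        rw [lintegral_add_right _ hm, ← hf.lintegral_absTail_shift_eq hτ t x, two_mul]
    _ ≤ _ := by gcongr

/-- At controlled times `τ n ≥ n` the bound `Γ ≤ D` removes the discount at the price exp D. The
martingale there converges in mean to the functional, and Fatou's lemma applies. -/
theorem lintegral_truncExp_le (hf : X.IsIntegrableFamily f) {N : ℝ} (hN : 0 ≤ N) {Γ : ℝ≥0 → ℝ}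
    (hΓ : Monotone Γ) (hΓ0 : Γ 0 = 0) (hstep : X.HasShortTimeBound f N Γ) {D : ℝ}
    (hD : ∀ t, Γ t ≤ D) (x : E) :
    ∫⁻ w, ENNReal.ofReal (truncExp N (tailFunctional f 0 w - X.tailMean f 0 x)) ∂(X.law x) ≤
      ENNReal.ofReal (Real.exp D) := by
  choose τ hτ hle using fun n : ℕ => IsControlled.exists_ge hf hN hΓ hΓ0 hstep x (n : ℝ≥0)
  have hlim : Tendsto (fun n : ℕ => ∫⁻ w, ‖X.closedMart f 0 (τ n w) w - tailFunctional f 0 w‖ₑ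
      ∂(X.law x)) atTop (𝓝 0) := by
    have h := ENNReal.Tendsto.const_mul (a := 2) (hf.tendsto_lintegral_absTail_shift 0 x)
      (Or.inr ENNReal.ofNat_ne_top)
    rw [mul_zero] at h
    exact tendsto_of_tendsto_of_tendsto_of_le_of_le tendsto_const_nhds h (fun _ => zero_le)
      fun n => hf.lintegral_enorm_closedMart_sub_le (hτ n).isStopTime 0 (hle n)
  refine lintegral_comp_le_of_tendsto_lintegral_enorm_sub
    (φ := fun m => ENNReal.ofReal (truncExp N (m - X.tailMean f 0 x)))
    (fun n => hf.measurable_closedMart_stopTime (hτ n).isStopTime 0)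
    ((measurable_tailFunctional hf.measurable).comp measurable_prodMk_left) hlim
    (ENNReal.continuous_ofReal.comp ((continuous_truncExp N).comp (continuous_sub_right _)))
    fun n => ?_
  calc _ ≤ ∫⁻ w, ENNReal.ofReal (Real.exp D) * ENNReal.ofReal (truncExp N
        (X.closedMart f 0 (τ n w) w - X.tailMean f 0 x) * Real.exp (-Γ (τ n w))) ∂(X.law x) := by
        refine lintegral_mono fun w => ?_
        rw [← ENNReal.ofReal_mul (Real.exp_pos _).le]
        refine ENNReal.ofReal_le_ofReal ?_
        rw [mul_left_comm, ← Real.exp_add]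
        refine le_mul_of_one_le_right (truncExp_pos _ _).le (Real.one_le_exp ?_)
        linarith [hD (τ n w)]
    _ ≤ _ := by
        rw [lintegral_const_mul' _ _ ENNReal.ofReal_ne_top]
        exact mul_le_of_le_one_right' (hτ n).moment_le

end IsIntegrableFamily

namespace CouplingBoundData

theorem hasShortTimeBound (h : X.CouplingBoundData ρ f)
    (hC : ∫⁻ t, X.growthRate ρ f t ∂timeMeasure < ∞) {η : ℝ} (hη : 0 < η) (N : ℝ) :
    X.HasShortTimeBound f N (X.growthClock ρ f η) := fun q => by
  have hlim : Tendsto (fun n : ℕ => (1 / 2 : ℝ≥0) ^ n) atTop (𝓝[>] 0) :=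
    tendsto_nhdsWithin_iff.2 ⟨NNReal.tendsto_pow_atTop_nhds_zero_of_lt_one
      (by rw [← NNReal.coe_lt_coe]; norm_num), Eventually.of_forall fun n => by
        simp only [mem_Ioi]; positivity⟩
  exact (hlim.eventually (h.eventually_lintegral_truncExp_le hC hη N q.2 q.1.1 q.1.2)).exists

/-- The exponential moment of the centred additive functional for a fixed starting point. -/
theorem lintegral_exp_sub_tailMean_le (h : X.CouplingBoundData ρ f)
    (hC : ∫⁻ t, X.growthRate ρ f t ∂timeMeasure < ∞) (x : E) :
    ∫⁻ w, ENNReal.ofReal (Real.exp (additiveFunctional f w - X.tailMean f 0 x)) ∂(X.law x) ≤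
      ENNReal.ofReal (Real.exp (∫⁻ t, X.growthRate ρ f t ∂timeMeasure).toReal) := by
  have hf := h.isIntegrableFamily
  set D := (∫⁻ t, X.growthRate ρ f t ∂timeMeasure).toReal with hD
  have hFm : Measurable (tailFunctional f 0) :=
    (measurable_tailFunctional hf.measurable).comp (measurable_prodMk_left (x := 0))
  -- For fixed `N` the slack η = 1/(n+1) of the clock tends to 0.
  have hN : ∀ N : ℕ, ∫⁻ w, ENNReal.ofReal (truncExp N (tailFunctional f 0 w - X.tailMean f 0 x))
      ∂(X.law x) ≤ ENNReal.ofReal (Real.exp D) := by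
    intro N
    have hlim : Tendsto (fun n : ℕ => ENNReal.ofReal (Real.exp (D + 1 / ((n : ℝ) + 1)))) atTop
        (𝓝 (ENNReal.ofReal (Real.exp (D + 0)))) :=
      ENNReal.tendsto_ofReal ((Real.continuous_exp.tendsto _).comp
        (tendsto_const_nhds.add tendsto_one_div_add_atTop_nhds_zero_nat))
    rw [add_zero] at hlim
    refine ge_of_tendsto' hlim fun n => ?_
    have hη : 0 < 1 / ((n : ℝ) + 1) := by positivity
    exact hf.lintegral_truncExp_le N.cast_nonneg (growthClock_mono hC hη.le) (growthClock_zero _)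
      (h.hasShortTimeBound hC hη N) (growthClock_le hC hη.le) x
  rw [← tailFunctional_zero]
  calc _ ≤ ∫⁻ w, liminf (fun N : ℕ => ENNReal.ofReal (truncExp N
        (tailFunctional f 0 w - X.tailMean f 0 x))) atTop ∂(X.law x) := by
        refine lintegral_mono fun w => ?_
        have : Tendsto (fun N : ℕ => ENNReal.ofReal (truncExp N
            (tailFunctional f 0 w - X.tailMean f 0 x))) atTop
            (𝓝 (ENNReal.ofReal (Real.exp (tailFunctional f 0 w - X.tailMean f 0 x)))) := by
          -- For each path the truncation is inactive once `N` exceeds the exponent.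
          refine tendsto_const_nhds.congr' ?_
          filter_upwards [tendsto_natCast_atTop_atTop.eventually_ge_atTop
            (tailFunctional f 0 w - X.tailMean f 0 x)] with N hN
          rw [truncExp_of_le hN]
        exact this.liminf_eq.ge
    _ ≤ liminf (fun N : ℕ => ∫⁻ w, ENNReal.ofReal (truncExp N
        (tailFunctional f 0 w - X.tailMean f 0 x)) ∂(X.law x)) atTop :=
        lintegral_liminf_le fun N =>
          ((continuous_truncExp N).measurable.comp (hFm.sub_const _)).ennreal_ofReal
    _ ≤ ENNReal.ofReal (Real.exp D) := by
        refine (liminf_le_liminf (v := fun _ => ENNReal.ofReal (Real.exp D))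
          (Eventually.of_forall hN)).trans_eq ?_
        simp

end CouplingBoundData

end Limit

end FellerProcess

/-! ### General initial distributions -/

theorem ereal_exp_coe_ennreal {a : ℝ≥0∞} (h : a ≠ ∞) :
    EReal.exp (a : EReal) = ENNReal.ofReal (Real.exp a.toReal) := by
  rw [← EReal.coe_ennreal_toReal h, EReal.exp_coe]

theorem one_le_ereal_exp_coe_ennreal (a : ℝ≥0∞) : 1 ≤ EReal.exp (a : EReal) :=
  EReal.one_le_exp_iff.2 (EReal.coe_ennreal_nonneg a)

theorem ereal_exp_coe_ennreal_mono {a b : ℝ≥0∞} (h : a ≤ b) :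
    EReal.exp (a : EReal) ≤ EReal.exp (b : EReal) :=
  EReal.exp_monotone (EReal.coe_ennreal_le_coe_ennreal_iff.2 h)

/-- The first absolute moment of a centred random variable is controlled by its exponential
moment. -/
theorem lintegral_enorm_le_of_integral_eq_zero {α : Type*} [MeasurableSpace α] {μ : Measure α}
    {Y : α → ℝ} (hY : Integrable Y μ) (h0 : ∫ a, Y a ∂μ = 0)
    (he : ∫⁻ a, ENNReal.ofReal (Real.exp (Y a)) ∂μ < ∞) :
    ∫⁻ a, ‖Y a‖ₑ ∂μ ≤ 2 * ∫⁻ a, ENNReal.ofReal (Real.exp (Y a)) ∂μ := by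
  have hei : Integrable (fun a => Real.exp (Y a)) μ := by
    refine ⟨Real.continuous_exp.comp_aestronglyMeasurable hY.1, ?_⟩
    rwa [hasFiniteIntegral_iff_ofReal (Eventually.of_forall fun a => (Real.exp_pos _).le)]
  rw [← ofReal_integral_norm_eq_lintegral_enorm hY,
    ← ofReal_integral_eq_lintegral_ofReal hei (Eventually.of_forall fun a => (Real.exp_pos _).le),
    ← ENNReal.ofReal_ofNat 2, ← ENNReal.ofReal_mul (by norm_num)]
  refine ENNReal.ofReal_le_ofReal ?_
  -- Pointwise |y| ≤ 2 exp(y) - y, and the linear term integrates to zero.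
  calc ∫ a, ‖Y a‖ ∂μ ≤ ∫ a, (2 * Real.exp (Y a) - Y a) ∂μ := by
        refine integral_mono hY.norm ((hei.const_mul 2).sub hY) fun a => ?_
        have h1 := Real.add_one_le_exp (Y a)
        have h2 := Real.exp_pos (Y a)
        simp only [Real.norm_eq_abs]
        rcases abs_cases (Y a) with h | h <;> linarith
    _ = 2 * ∫ a, Real.exp (Y a) ∂μ := by
        rw [integral_sub (hei.const_mul 2) hY, integral_const_mul, h0, sub_zero]

theorem lipNorm_zero {E : Type*} (ρ : E → E → ℝ≥0∞) : lipNorm ρ (fun _ => 0) = 0 :=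
  le_antisymm (iInf₂_le_of_le 0 (by simp) (by simp)) zero_le

section Cutoff

variable {E : Type*} {ρ : E → E → ℝ≥0∞} {f : ℝ≥0 → E → ℝ}

theorem lipNorm_le_of_cutoff {g : E → ℝ} {T : ℝ≥0}
    (hg : ∀ t x, f t x = if t ≤ T then g x else 0) (t : ℝ≥0) :
    lipNorm ρ (f t) ≤ (Iic T).indicator (fun _ => lipNorm ρ g) t := by
  by_cases h : t ≤ T
  · have : f t = g := funext fun x => by simp [hg, h]
    simp [this, h]
  · have : f t = fun _ => 0 := funext fun x => by simp [hg, h]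
    simp [this, lipNorm_zero]

theorem constPow_le_of_cutoff {g : E → ℝ} {T : ℝ≥0}
    (hg : ∀ t x, f t x = if t ≤ T then g x else 0) {k : ℕ} (hk : k ≠ 0) :
    constPow ρ f k ≤ (T : ℝ≥0∞) * lipNorm ρ g ^ k := by
  calc constPow ρ f k ≤ ∫⁻ t, (Iic T).indicator (fun _ => lipNorm ρ g ^ k) t ∂timeMeasure := by
        refine lintegral_mono fun t => iSup₂_le fun s hs => ?_
        refine (pow_le_pow_left' (lipNorm_le_of_cutoff hg s) k).trans ?_
        by_cases h : s ≤ T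
        · simp [h, (show t ≤ T from le_trans hs h)]
        · simp [h, hk]
    _ = _ := by
        rw [lintegral_indicator measurableSet_Iic, setLIntegral_const, timeMeasure_Iic, mul_comm]

end Cutoff

/-! ### The constants, mixed initial laws, and the final estimate -/

namespace FellerProcess

section Constants

variable {E : Type*} [TopologicalSpace E] [MeasurableSpace E] [OpensMeasurableSpace E]
  {X : FellerProcess E} {ρ : E → E → ℝ≥0∞} {f : ℝ≥0 → E → ℝ} {μ ν : Measure E}

theorem initialFactor_mono {L L' : ℝ≥0∞} (h : L ≤ L') :
    initialFactor X ρ μ ν L ≤ initialFactor X ρ μ ν L' :=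
  lintegral_mono fun _ => ereal_exp_coe_ennreal_mono (by gcongr)

theorem expFactor_mono {c c' : ℕ → ℝ≥0∞} (h : ∀ k, 2 ≤ k → c k ≤ c' k) :
    expFactor X ρ c ≤ expFactor X ρ c' :=
  ereal_exp_coe_ennreal_mono (ENNReal.tsum_le_tsum fun j => by
    gcongr
    exact h _ (by omega))

theorem one_le_initialFactor [IsProbabilityMeasure μ] (L : ℝ≥0∞) :
    1 ≤ initialFactor X ρ μ ν L := by
  calc (1 : ℝ≥0∞) = ∫⁻ _, 1 ∂μ := by simp
    _ ≤ _ := lintegral_mono fun _ => one_le_ereal_exp_coe_ennreal _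

/-- Otherwise the integrand would be ∞ everywhere. The point found serves as the reference point for
integrability under `ν`. -/
theorem exists_lintegral_couplingTime_lt_top [IsProbabilityMeasure μ] {L : ℝ≥0∞}
    (h : initialFactor X ρ μ ν L < ∞) : ∃ x, L * ∫⁻ y, X.couplingTime ρ x y ∂ν < ∞ := by
  by_contra! hc
  have : ∀ x, EReal.exp ((L * ∫⁻ y, X.couplingTime ρ x y ∂ν : ℝ≥0∞) : EReal) = ∞ := fun x => by
    rw [top_le_iff.1 (hc x)]; simp
  rw [initialFactor, lintegral_congr this] at h
  simp at h

theorem lintegral_lawFrom (X : FellerProcess E) (ν : Measure E) {g : CadlagPath E → ℝ≥0∞}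
    (hg : Measurable g) :
    ∫⁻ w, g w ∂(X.lawFrom ν) = ∫⁻ x, (∫⁻ w, g w ∂(X.law x)) ∂ν :=
  Measure.lintegral_bind X.law.measurable.aemeasurable hg.aemeasurable

theorem integral_lawFrom (X : FellerProcess E) (ν : Measure E) {g : CadlagPath E → ℝ}
    (hg : Integrable g (X.lawFrom ν)) :
    ∫ w, g w ∂(X.lawFrom ν) = ∫ x, (∫ w, g w ∂(X.law x)) ∂ν := by
  have e : X.lawFrom ν = (X.law ∘ₖ Kernel.const Unit ν) () := by
    rw [lawFrom, Measure.comp_eq_comp_const_apply]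
  rw [e] at hg ⊢
  rw [ProbabilityTheory.Kernel.integral_comp hg, Kernel.const_apply]

end Constants

section InitialDistribution

variable {E : Type*} [TopologicalSpace E] [PolishSpace E] [MeasurableSpace E] [BorelSpace E]
  {X : FellerProcess E} {f : ℝ≥0 → E → ℝ} {ρ : E → E → ℝ≥0∞}

theorem IsIntegrableFamily.measurable_additiveFunctional (hf : X.IsIntegrableFamily f) :
    Measurable (additiveFunctional f : CadlagPath E → ℝ) := by
  rw [← tailFunctional_zero]
  exact (measurable_tailFunctional hf.measurable).comp (measurable_prodMk_left (x := 0))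

namespace CouplingBoundData

variable {μ ν : Measure E}

theorem lintegral_exp_sub_tailMean_le_expFactor (h : X.CouplingBoundData ρ f)
    (hK : expFactor X ρ (constPow ρ f) < ∞) (x : E) :
    ∫⁻ w, ENNReal.ofReal (Real.exp (additiveFunctional f w - X.tailMean f 0 x)) ∂(X.law x) ≤
      expFactor X ρ (constPow ρ f) := by
  have hS : ∑' j : ℕ, constPow ρ f (j + 2) / ((j + 2).factorial : ℝ≥0∞) *
      X.supGenerator ρ (j + 2) < ∞ := by
    have := EReal.exp_lt_top_iff.1 hK
    rwa [← EReal.coe_ennreal_top, EReal.coe_ennreal_lt_coe_ennreal_iff] at this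
  have hC := lintegral_growthRate_le.trans_lt hS
  refine (h.lintegral_exp_sub_tailMean_le hC x).trans ?_
  rw [← ereal_exp_coe_ennreal hC.ne]
  exact ereal_exp_coe_ennreal_mono lintegral_growthRate_le

theorem lintegral_enorm_tailMean_sub_le (h : X.CouplingBoundData ρ f) (x : E) :
    ∫⁻ y, ‖X.tailMean f 0 x - X.tailMean f 0 y‖ₑ ∂ν ≤
      (⨆ t : ℝ≥0, lipNorm ρ (f t)) * ∫⁻ y, X.couplingTime ρ x y ∂ν := by
  rw [← lintegral_const_mul' _ _ h.lip.ne]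
  refine lintegral_mono fun y => ?_
  refine (h.isIntegrableFamily.enorm_tailMean_sub_le h.semimetric ((lipSup_le 0).trans_lt h.lip)
    (h.fin x y)).trans ?_
  gcongr
  exact lipSup_le 0

variable [IsProbabilityMeasure μ] [IsProbabilityMeasure ν]

/-- For one suitable x, the difference V_0(x) - V_0(y) is dominated by a `ν`-integrable multiple of
h(x,y). -/
theorem integrable_tailMean (h : X.CouplingBoundData ρ f)
    (h0 : constZero X ρ f μ ν < ∞) : Integrable (X.tailMean f 0) ν := by
  have hm : Measurable (X.tailMean f 0) :=
    h.isIntegrableFamily.measurable_tailMean.comp measurable_prodMk_left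
  obtain ⟨x, hx⟩ := exists_lintegral_couplingTime_lt_top h0
  have hi : Integrable (fun y => X.tailMean f 0 x - X.tailMean f 0 y) ν :=
    ⟨(measurable_const.sub hm).aestronglyMeasurable,
      (h.lintegral_enorm_tailMean_sub_le x).trans_lt hx⟩
  refine ((integrable_const (X.tailMean f 0 x)).sub hi).congr (Eventually.of_forall fun y => ?_)
  simp

/-- 𝔼_x|F - V_0(x)| is at most twice the exponential moment, uniformly in x, and V_0 is
`ν`-integrable. -/
theorem integrable_additiveFunctional (h : X.CouplingBoundData ρ f)
    (h0 : constZero X ρ f μ ν < ∞) (hK : expFactor X ρ (constPow ρ f) < ∞) :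
    Integrable (additiveFunctional f) (X.lawFrom ν) := by
  have hf := h.isIntegrableFamily
  have hFm := hf.measurable_additiveFunctional
  refine ⟨hFm.aestronglyMeasurable, ?_⟩
  rw [HasFiniteIntegral, lintegral_lawFrom X ν hFm.enorm]
  calc ∫⁻ x, (∫⁻ w, ‖additiveFunctional f w‖ₑ ∂(X.law x)) ∂ν
      ≤ ∫⁻ x, (2 * expFactor X ρ (constPow ρ f) + ‖X.tailMean f 0 x‖ₑ) ∂ν := by
        refine lintegral_mono fun x => ?_
        have hFi : Integrable (additiveFunctional f) (X.law x) := by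
          rw [← tailFunctional_zero]; exact hf.integrable_tailFunctional x 0
        have hle := h.lintegral_exp_sub_tailMean_le_expFactor hK x
        have hY := lintegral_enorm_le_of_integral_eq_zero
          (hFi.sub (integrable_const (X.tailMean f 0 x)))
          (by
            rw [integral_sub' hFi (integrable_const _), tailMean, tailFunctional_zero]
            simp) (hle.trans_lt hK)
        calc ∫⁻ w, ‖additiveFunctional f w‖ₑ ∂(X.law x)
            ≤ ∫⁻ w, (‖additiveFunctional f w - X.tailMean f 0 x‖ₑ + ‖X.tailMean f 0 x‖ₑ)
                ∂(X.law x) := by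
              refine lintegral_mono fun w => ?_
              simpa using enorm_add_le (additiveFunctional f w - X.tailMean f 0 x)
                (X.tailMean f 0 x)
          _ ≤ _ := by
              rw [lintegral_add_right _ measurable_const, lintegral_const, measure_univ, mul_one]
              gcongr
              exact hY.trans (by gcongr; exact hle)
    _ < ∞ := by
        rw [lintegral_add_left measurable_const, lintegral_const, measure_univ, mul_one]
        exact ENNReal.add_lt_top.2 ⟨ENNReal.mul_lt_top ENNReal.ofNat_lt_top hK,
          (h.integrable_tailMean h0).2⟩

theorem ofReal_exp_tailMean_sub_le (h : X.CouplingBoundData ρ f)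
    (hi : Integrable (X.tailMean f 0) ν) (x : E) :
    ENNReal.ofReal (Real.exp (X.tailMean f 0 x - ∫ y, X.tailMean f 0 y ∂ν)) ≤
      EReal.exp (((⨆ t : ℝ≥0, lipNorm ρ (f t)) * ∫⁻ y, X.couplingTime ρ x y ∂ν : ℝ≥0∞) :
        EReal) := by
  rw [← EReal.exp_coe]
  refine EReal.exp_monotone ?_
  have e : X.tailMean f 0 x - ∫ y, X.tailMean f 0 y ∂ν =
      ∫ y, (X.tailMean f 0 x - X.tailMean f 0 y) ∂ν := by
    rw [integral_sub (integrable_const _) hi]; simp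
  calc ((X.tailMean f 0 x - ∫ y, X.tailMean f 0 y ∂ν : ℝ) : EReal)
      ≤ ((ENNReal.ofReal (X.tailMean f 0 x - ∫ y, X.tailMean f 0 y ∂ν) : ℝ≥0∞) : EReal) := by
        rw [EReal.coe_ennreal_ofReal]
        exact_mod_cast le_max_left _ _
    _ ≤ _ := by
        rw [EReal.coe_ennreal_le_coe_ennreal_iff, e]
        refine le_trans ?_ (h.lintegral_enorm_tailMean_sub_le x)
        refine le_trans ?_ (enorm_integral_le_lintegral_enorm _)
        rw [Real.enorm_eq_ofReal_abs]
        exact ENNReal.ofReal_le_ofReal (le_abs_self _)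

/-- Under ℙ_x factor out exp(V_0(x) - ν(V_0)), which produces c_0 after integration over `μ`; the
remaining centred moment is bounded uniformly in x. -/
theorem expMoment_le (h : X.CouplingBoundData ρ f) (h0 : constZero X ρ f μ ν < ∞)
    (hK : expFactor X ρ (constPow ρ f) < ∞) :
    expMoment X f μ ν ≤ constZero X ρ f μ ν * expFactor X ρ (constPow ρ f) := by
  have hFm := h.isIntegrableFamily.measurable_additiveFunctional
  have hmean : ∫ w, additiveFunctional f w ∂(X.lawFrom ν) = ∫ x, X.tailMean f 0 x ∂ν := by
    rw [integral_lawFrom X ν (h.integrable_additiveFunctional h0 hK)]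
    simp only [tailMean, tailFunctional_zero]
  have hm : Measurable fun w => ENNReal.ofReal (Real.exp (additiveFunctional f w -
      ∫ x, X.tailMean f 0 x ∂ν)) := (Real.measurable_exp.comp (hFm.sub_const _)).ennreal_ofReal
  rw [expMoment, hmean, lintegral_lawFrom X μ hm, constZero, initialFactor,
    ← lintegral_mul_const' _ _ hK.ne]
  refine lintegral_mono fun x => ?_
  calc ∫⁻ w, ENNReal.ofReal (Real.exp (additiveFunctional f w - ∫ x, X.tailMean f 0 x ∂ν))
        ∂(X.law x)
      = ∫⁻ w, ENNReal.ofReal (Real.exp (X.tailMean f 0 x - ∫ x, X.tailMean f 0 x ∂ν)) *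
          ENNReal.ofReal (Real.exp (additiveFunctional f w - X.tailMean f 0 x)) ∂(X.law x) := by
        refine lintegral_congr fun w => ?_
        rw [← ENNReal.ofReal_mul (Real.exp_pos _).le, ← Real.exp_add]
        congr 2
        ring
    _ ≤ _ := by
        rw [lintegral_const_mul' _ _ ENNReal.ofReal_ne_top]
        exact mul_le_mul' (h.ofReal_exp_tailMean_sub_le (h.integrable_tailMean h0) x)
          (h.lintegral_exp_sub_tailMean_le_expFactor hK x)

end CouplingBoundData

end InitialDistribution

end FellerProcess

end

theorem mainTheorem8 {E : Type*} [TopologicalSpace E] [PolishSpace E] [MeasurableSpace E]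
    [BorelSpace E] (X : FellerProcess E)
    (ρ : E → E → ℝ≥0∞) (hρ : IsSemimetric ρ)
    (hρlsc : LowerSemicontinuous fun p : E × E => ρ p.1 p.2)
    (f : ℝ≥0 → E → ℝ) (hLip : (⨆ t : ℝ≥0, lipNorm ρ (f t)) < ∞)
    (hreg : ∀ k : ℕ, 1 ≤ k → X.IsRegular f k)
    (hdom : ∀ k : ℕ, 1 ≤ k → ∀ (t : ℝ≥0) (x : E),
      X.InDomain fun y => X.coupledDiff f t y x ^ k)
    (hfin : ∀ x y : E, X.couplingTime ρ x y < ∞)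
    (hh : ∀ k : ℕ, 2 ≤ k → ∀ x : E, ∃ v : ℝ, X.HasGeneratorAt (X.couplingTimePow ρ k x) x v)
    (μ ν : Measure E) [IsProbabilityMeasure μ] [IsProbabilityMeasure ν] :
    (constZero X ρ f μ ν * expFactor X ρ (constPow ρ f) < ∞ →
        Integrable (additiveFunctional f) (X.lawFrom ν)) ∧
      expMoment X f μ ν ≤ constZero X ρ f μ ν * expFactor X ρ (constPow ρ f) ∧
      ∀ (g : E → ℝ) (T : ℝ≥0), (∀ t x, f t x = if t ≤ T then g x else 0) →
        constZero X ρ f μ ν ≤ initialFactor X ρ μ ν (lipNorm ρ g) ∧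
          (∀ k : ℕ, 2 ≤ k → constPow ρ f k ≤ (T : ℝ≥0∞) * lipNorm ρ g ^ k) ∧
          expMoment X f μ ν ≤ initialFactor X ρ μ ν (lipNorm ρ g) *
            expFactor X ρ (fun k => (T : ℝ≥0∞) * lipNorm ρ g ^ k) := by
  have hdata : X.CouplingBoundData ρ f := ⟨hρ, hLip, hreg, hfin, hh⟩
  -- Both factors are at least 1, so a finite product makes each of them finite, and an infinite one
  -- makes the bound trivial.
  have hfactors : constZero X ρ f μ ν * expFactor X ρ (constPow ρ f) < ∞ →
      constZero X ρ f μ ν < ∞ ∧ expFactor X ρ (constPow ρ f) < ∞ := fun h =>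
    ⟨(le_mul_of_one_le_right' (one_le_ereal_exp_coe_ennreal _)).trans_lt h,
      (le_mul_of_one_le_left' (FellerProcess.one_le_initialFactor _)).trans_lt h⟩
  have hbound : expMoment X f μ ν ≤ constZero X ρ f μ ν * expFactor X ρ (constPow ρ f) := by
    by_cases h : constZero X ρ f μ ν * expFactor X ρ (constPow ρ f) < ∞
    · exact hdata.expMoment_le (hfactors h).1 (hfactors h).2
    · rw [not_lt, top_le_iff] at h
      exact h ▸ le_top
  refine ⟨fun h => hdata.integrable_additiveFunctional (hfactors h).1 (hfactors h).2, hbound,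
    fun g T hg => ?_⟩
  have h1 : constZero X ρ f μ ν ≤ initialFactor X ρ μ ν (lipNorm ρ g) :=
    FellerProcess.initialFactor_mono (iSup_le fun t =>
      (lipNorm_le_of_cutoff hg t).trans (indicator_le_self _ _ t))
  have h2 : ∀ k : ℕ, 2 ≤ k → constPow ρ f k ≤ (T : ℝ≥0∞) * lipNorm ρ g ^ k := fun k hk =>
    constPow_le_of_cutoff hg (by omega)
  exact ⟨h1, h2, hbound.trans (mul_le_mul' h1 (FellerProcess.expFactor_mono h2))⟩
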